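/- Let $M$ be a smooth (Hausdorff) $n$-dimensional manifold, $\pi\colon E=TM\setminus 0\to M$ its slit tangent bundle, $VE=\ker\pi_*$, and let $y$ be the Liouville (tautological) section of $\pi^*(TM)\to E$. Let $g$ be a smooth field on $E$ of symmetric non-degenerate bilinear forms on the fibres of $\pi^*(TM)$ (a metric), and let a Finsler connection be a smooth Koszul connection $\nabla$ on $\pi^*(TM)\to E$; $D$ denotes the covariant exterior derivative. Put $\omega=\pi_*$ and $\bar\omega=Dy=\nabla y$ ($TM$-valued 1-forms on $E$), $T=D\omega$, and let $\Psi$ be the canonical horizontal torsion, $\Psi^a=T^a+\tfrac12 g^{ar}Dg_{rb}\wedge\omega^b$. Consider the conditions: ($\alpha$) regularity: for each $v\in E$ the map $V_vE\ni Z\mapsto\nabla_Zy$ is injective; ($\beta$) $\Psi\wedge(g\cdot\omega)=g_{ab}\Psi^a\wedge\omega^b=0$; ($\gamma$) $\Psi\cdot g\cdot y=g_{ab}\Psi^ay^b=0$; ($\delta$) $\Psi\wedge(g\cdot\bar\omega)=g_{ab}\Psi^a\wedge\bar\omega^b=0$; ($\varepsilon$) $y\cdot Dg=y^aDg_{ab}=0$.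 For regular $\nabla$ the connection forms $\omega^a{}_b$ ($\nabla e_b=\omega^a{}_be_a$, $e_b=\partial/\partial x^b$) of a chart of $M$ expand uniquely as $\omega^a{}_b=H^a{}_{bc}\omega^c+V^a{}_{bc}\bar\omega^c$; indices are lowered with $g$. A Finsler Lagrangian is a smooth function $\mathscr L\colon E\to\mathbb R$, positively homogeneous of degree two on the fibres, with non-degenerate vertical Hessian. With $g$ its vertical Hessian, put $2G^a=g^{ad}\big(\frac{\partial^2\mathscr L}{\partial x^c\partial y^d}y^c-\frac{\partial\mathscr L}{\partial x^d}\big)$, $N^a_c=\frac{\partial G^a}{\partial y^c}$ (Barthel's non-linear connection, the distribution $dy^a+N^a_c\,dx^c=0$), $\frac{\delta}{\delta x^c}=\frac{\partial}{\partial x^c}-N^a_c\frac{\partial}{\partial y^a}$, $\Gamma_{abc}=\frac12\big(\frac{\delta g_{ac}}{\delta x^b}+\frac{\delta g_{ab}}{\delta x^c}-\frac{\delta g_{bc}}{\delta x^a}\big)$, $G^a{}_{bc}=\frac{\partial^2G^a}{\partial y^b\partial y^c}$, $C_{abc}=\frac12\frac{\partial^3\mathscr L}{\partial y^a\partial y^b\partial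 y^c}$. The notable connections of $\mathscr L$ are the regular connections with $(H^a{}_{bc},V^a{}_{bc})$ equal, in every chart, to $(G^a{}_{bc},0)$ (Berwald), $(\Gamma^a{}_{bc},0)$ (Chern), $(\Gamma^a{}_{bc},C^a{}_{bc})$ (Cartan), $(G^a{}_{bc},C^a{}_{bc})$ (Hashiguchi). Two connections are related by the symmetry if $\omega'^a{}_b=\omega^a{}_b+W^a{}_b$ for an endomorphism-valued 1-form $W$ on $E$ with $W_{ab}=W_{ba}$, $W_{ab}y^b=0$; regular connections so related are called equivalent, $\nabla\sim_g\nabla'$. Then: 1. If $\nabla$ satisfies ($\alpha$), ($\beta$), ($\gamma$), then $\mathscr L=\tfrac12g_y(y,y)$ is a Finsler Lagrangian (in particular positively homogeneous of degree two) and $g$ is its vertical Hessian. 2. If $\nabla$ satisfies ($\alpha$)-($\varepsilon$), then, with $\mathscr L=\tfrac12 g_y(y,y)$, in every chart $H_{abc}=\Gamma_{abc}+\Lambda_{abc}$ with $\Lambda_{abc}=\Lambda_{bac}$ and $y^a\Lambda_{abc}=0$; $V_{abc}=V_{bac}$ and $y^aV_{abc}=0$; $\nabla$ is strongly regular ($Z\mapsto\nabla_Zy$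 is the identity on $VE\cong\pi^*(TM)$); and the induced non-linear connection $HE=\ker(X\mapsto\nabla_Xy)$ is Barthel's non-linear connection of $\mathscr L$. 3. Each of the conditions ($\alpha$)-($\varepsilon$) is invariant under the symmetry. 4. $\Lambda$ and $V$ are not constrained further: if $g$ is the vertical Hessian of a Finsler Lagrangian $\mathscr L$, every regular $\nabla$ whose coefficients have in every chart the form described in 2 satisfies ($\alpha$)-($\varepsilon$); in particular the Berwald, Chern, Cartan and Hashiguchi connections of $\mathscr L$ do. 5. If $\nabla$ satisfies ($\alpha$)-($\varepsilon$), the Finsler connections that satisfy ($\alpha$)-($\varepsilon$) are exactly those of the class $[\nabla]_g$, and this class contains a Berwald, a Chern, a Cartan and a Hashiguchi connection of $\mathscr L=\tfrac12g_y(y,y)$. -/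

import Mathlib

open Bundle
open scoped Manifold ContDiff

noncomputable section

namespace Finsler

/-- The model space of an `n`-dimensional manifold. -/
abbrev Coord (n : ℕ) : Type := EuclideanSpace ℝ (Fin n)

section Bundles

variable (n : ℕ) (M : Type*) [TopologicalSpace M] [ChartedSpace (Coord n) M]
  [IsManifold (𝓡 n) ∞ M]

/-- The bundle projection `π : TM → M` as a smooth map. -/
def proj : C^∞⟮(𝓡 n).tangent, TangentBundle (𝓡 n) M; 𝓡 n, M⟯ :=
  ⟨fun v => v.proj, contMDiff_proj _⟩

/-- The pullback bundle `π^*(TM)` over `TM`; its fibre at `v` is the tangent space of `M` at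
`π v`. It is only used over the slit tangent bundle. -/
abbrev PB : TangentBundle (𝓡 n) M → Type := proj n M *ᵖ (TangentSpace (𝓡 n) : M → Type)

instance (v : TangentBundle (𝓡 n) M) : AddCommGroup (PB n M v) :=
  inferInstanceAs (AddCommGroup (TangentSpace (𝓡 n) (proj n M v)))

instance (v : TangentBundle (𝓡 n) M) : IsTopologicalAddGroup (PB n M v) :=
  inferInstanceAs (IsTopologicalAddGroup (TangentSpace (𝓡 n) (proj n M v)))

instance (v : TangentBundle (𝓡 n) M) : ContinuousSMul ℝ (PB n M v) :=
  inferInstanceAs (ContinuousSMul ℝ (TangentSpace (𝓡 n) (proj n M v)))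

/-- The slit tangent bundle `E = TM \ 0`, an open subset of `TM`. -/
def Slit : Set (TangentBundle (𝓡 n) M) := {v | v.2 ≠ 0}

theorem isOpen_slit : IsOpen (Slit n M) := by
  rw [isOpen_iff_mem_nhds]
  intro v hv
  let e := trivializationAt (Coord n) (TangentSpace (𝓡 n) : M → Type) v.proj
  have hb : v.proj ∈ e.baseSet := mem_baseSet_trivializationAt _ _ _
  have hs : v ∈ e.source := e.mem_source.2 hb
  have h0 : (e v).2 ≠ 0 := by
    intro h
    apply hv
    have h1 := e.symm_apply_apply_mk hb v.2
    rw [show (e ⟨v.proj, v.2⟩).2 = 0 from h] at h1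
    rw [← h1]
    have h2 := map_zero (e.symmL ℝ v.proj)
    rwa [e.symmL_apply hb] at h2
  have hc : ContinuousAt (fun w => (e w).2) v :=
    (e.continuousAt hs).snd
  filter_upwards [hc.eventually_ne h0, e.open_source.mem_nhds hs] with w hw hws hw0
  apply hw
  have hwb : w.proj ∈ e.baseSet := e.mem_source.1 hws
  have h3 : e ⟨w.proj, 0⟩ = (w.proj, 0) := e.zeroSection ℝ hwb
  have h5 : w = ⟨w.proj, 0⟩ := by
    cases w
    exact congrArg _ hw0
  rw [h5, h3]

/-- A *Finsler connection*: a smooth Koszul connection `∇` on the bundle `π^*(TM) → E`.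
`D.toFun σ v X` is the covariant derivative `∇_X σ` at `v`. -/
structure FinslerConnection where
  toFun : (Π v, PB n M v) →
    Π v : TangentBundle (𝓡 n) M, TangentSpace (𝓡 n).tangent v →L[ℝ] PB n M v
  isCovariantDerivativeOn :
    IsCovariantDerivativeOn (I := (𝓡 n).tangent) (Coord n) toFun (Slit n M)
  contMDiff :
    ContMDiffCovariantDerivativeOn (I := (𝓡 n).tangent) (Coord n) ∞ toFun (Slit n M)

/-- A (pseudo-Riemannian) *metric* on the bundle `π^*(TM) → E`: a smooth field of symmetric
non-degenerate bilinear forms. -/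
structure FinslerMetric where
  toFun : Π v : TangentBundle (𝓡 n) M, PB n M v →L[ℝ] PB n M v →L[ℝ] ℝ
  symm : ∀ v ∈ Slit n M, ∀ u w, toFun v u w = toFun v w u
  nondegenerate : ∀ v ∈ Slit n M, ∀ u, (∀ w, toFun v u w = 0) → u = 0
  contMDiffOn : ContMDiffOn (𝓡 n).tangent
    ((𝓡 n).tangent.prod 𝓘(ℝ, Coord n →L[ℝ] Coord n →L[ℝ] ℝ)) ∞
    (fun v => TotalSpace.mk' (Coord n →L[ℝ] Coord n →L[ℝ] ℝ)
      (E := fun v => PB n M v →L[ℝ] PB n M v →L[ℝ] ℝ) v (toFun v)) (Slit n M)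

end Bundles

variable {n : ℕ} {M : Type*} [TopologicalSpace M] [ChartedSpace (Coord n) M]
  [IsManifold (𝓡 n) ∞ M]

/-! ### Intrinsic objects -/

/-- The section `σ` of `π^*(TM)` is differentiable at `v`. -/
def SecDiffAt (σ : Π v, PB n M v) (v : TangentBundle (𝓡 n) M) : Prop :=
  MDifferentiableAt (𝓡 n).tangent ((𝓡 n).tangent.prod 𝓘(ℝ, Coord n))
    (fun z => TotalSpace.mk' (Coord n) z (σ z)) v

/-- The Liouville field `y`, the tautological section of `π^*(TM)`. -/
def liouville (v : TangentBundle (𝓡 n) M) : PB n M v := v.2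

/-- The canonical `TM`-valued 1-form `ω = π_*`. -/
def omega (v : TangentBundle (𝓡 n) M) : TangentSpace (𝓡 n).tangent v →L[ℝ] PB n M v :=
  mfderiv (𝓡 n).tangent (𝓡 n) (proj n M) v

/-- The `TM`-valued 1-form `ω̄ = D y = ∇ y`. -/
def omegaBar (D : FinslerConnection n M) (v : TangentBundle (𝓡 n) M) :
    TangentSpace (𝓡 n).tangent v →L[ℝ] PB n M v :=
  D.toFun liouville v

/-- The vertical lift `T_{π v} M → V_v E`: the velocity at `t = 0` of the curve `v + t u`. -/
def verticalLift (v : TangentBundle (𝓡 n) M) (u : PB n M v) : TangentSpace (𝓡 n).tangent v :=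
  mfderiv 𝓘(ℝ, ℝ) (𝓡 n).tangent
    (fun t : ℝ => (⟨v.proj, (v.2 + t • (show TangentSpace (𝓡 n) v.proj from u) :
      TangentSpace (𝓡 n) v.proj)⟩ : TangentBundle (𝓡 n) M)) 0 (1 : ℝ)

/-- Regularity: `Z ↦ ∇_Z y` is injective on vertical vectors. -/
def Regular (D : FinslerConnection n M) : Prop :=
  ∀ v ∈ Slit n M, ∀ Z, omega v Z = 0 → omegaBar D v Z = 0 → Z = 0

/-- Strong regularity: `Z ↦ ∇_Z y` is the identity on vertical vectors. -/
def StronglyRegular (D : FinslerConnection n M) : Prop :=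
  ∀ v ∈ Slit n M, ∀ u, omegaBar D v (verticalLift v u) = u

/-- The non-linear connection `HE = ker (X ↦ ∇_X y)` induced by `∇`. -/
def inducedHorizontal (D : FinslerConnection n M) (v : TangentBundle (𝓡 n) M) :
    Submodule ℝ (TangentSpace (𝓡 n).tangent v) :=
  LinearMap.ker (omegaBar D v).toLinearMap

/-- `X (g (σ, τ)) - g (∇_X σ, τ) - g (σ, ∇_X τ)` at `v`. -/
def dMetricAux (D : FinslerConnection n M) (g : FinslerMetric n M)
    (v : TangentBundle (𝓡 n) M) (X : TangentSpace (𝓡 n).tangent v)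
    (σ τ : Π v, PB n M v) : ℝ :=
  mvfderiv (𝓡 n).tangent (fun z => g.toFun z (σ z) (τ z)) v X
    - g.toFun v (D.toFun σ v X) (τ v) - g.toFun v (σ v) (D.toFun τ v X)

theorem mdifferentiableAt_metric (g : FinslerMetric n M) {v : TangentBundle (𝓡 n) M}
    (hv : v ∈ Slit n M) {σ τ : Π v, PB n M v} (hσ : SecDiffAt σ v) (hτ : SecDiffAt τ v) :
    MDifferentiableAt (𝓡 n).tangent 𝓘(ℝ, ℝ) (fun z => g.toFun z (σ z) (τ z)) v := by
  have hg := ((g.contMDiffOn v hv).contMDiffAt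
    ((isOpen_slit n M).mem_nhds hv)).mdifferentiableAt (by simp)
  have := MDifferentiableAt.clm_bundle_apply₂ (F₁ := Coord n) (F₂ := Coord n) (F₃ := ℝ)
    (E₁ := PB n M) (E₂ := PB n M) (E₃ := Bundle.Trivial _ ℝ) hg hσ hτ
  rw [mdifferentiableAt_totalSpace] at this
  exact this.2

theorem dMetricAux_tensorial₁ (D : FinslerConnection n M) (g : FinslerMetric n M)
    {v : TangentBundle (𝓡 n) M} (hv : v ∈ Slit n M) (X : TangentSpace (𝓡 n).tangent v)
    (τ : Π v, PB n M v) (hτ : SecDiffAt τ v) :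
    TensorialAt (𝓡 n).tangent (Coord n) (dMetricAux D g v X · τ) v where
  smul {f σ} hf hσ := by
    have h := mvfderiv_fun_mul hf (mdifferentiableAt_metric g hv hσ hτ)
    simp [dMetricAux, h, D.isCovariantDerivativeOn.leibniz hσ hf hv]
    ring
  add hσ hσ' := by
    have h := mvfderiv_fun_add (mdifferentiableAt_metric g hv hσ hτ)
      (mdifferentiableAt_metric g hv hσ' hτ)
    simp [dMetricAux, h, D.isCovariantDerivativeOn.add hσ hσ' hv]
    ring

theorem dMetricAux_tensorial₂ (D : FinslerConnection n M) (g : FinslerMetric n M)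
    {v : TangentBundle (𝓡 n) M} (hv : v ∈ Slit n M) (X : TangentSpace (𝓡 n).tangent v)
    (σ : Π v, PB n M v) (hσ : SecDiffAt σ v) :
    TensorialAt (𝓡 n).tangent (Coord n) (dMetricAux D g v X σ ·) v where
  smul {f τ} hf hτ := by
    have h := mvfderiv_fun_mul hf (mdifferentiableAt_metric g hv hσ hτ)
    simp [dMetricAux, h, D.isCovariantDerivativeOn.leibniz hτ hf hv]
    ring
  add hτ hτ' := by
    have h := mvfderiv_fun_add (mdifferentiableAt_metric g hv hσ hτ)
      (mdifferentiableAt_metric g hv hσ hτ')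
    simp [dMetricAux, h, D.isCovariantDerivativeOn.add hτ hτ' hv]
    ring

open Classical in
/-- The covariant derivative `Dg` of the metric: `dMetric D g v X u w = (Dg) (X) (u, w)`. -/
def dMetric (D : FinslerConnection n M) (g : FinslerMetric n M)
    (v : TangentBundle (𝓡 n) M) (X : TangentSpace (𝓡 n).tangent v) :
    PB n M v →L[ℝ] PB n M v →L[ℝ] ℝ :=
  if hv : v ∈ Slit n M then
    TensorialAt.mkHom₂ (dMetricAux D g v X) v (dMetricAux_tensorial₁ D g hv X)
      (dMetricAux_tensorial₂ D g hv X)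
  else 0

/-- The covariant exterior derivative of a `TM`-valued 1-form `β`,
`(D β) (X, Y) = ∇_X (β Y) - ∇_Y (β X) - β [X, Y]`, evaluated on arbitrary extensions of
`X` and `Y` to vector fields. -/
def covExtDeriv (D : FinslerConnection n M)
    (β : Π v : TangentBundle (𝓡 n) M, TangentSpace (𝓡 n).tangent v →L[ℝ] PB n M v)
    (v : TangentBundle (𝓡 n) M) (X Y : TangentSpace (𝓡 n).tangent v) : PB n M v :=
  D.toFun (fun z => β z (FiberBundle.extend (Coord n × Coord n) Y z)) v X
    - D.toFun (fun z => β z (FiberBundle.extend (Coord n × Coord n) X z)) v Y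
    - β v (VectorField.mlieBracket (𝓡 n).tangent (FiberBundle.extend (Coord n × Coord n) X)
        (FiberBundle.extend (Coord n × Coord n) Y) v)

/-- The horizontal torsion `T = D ω`. -/
def torsion (D : FinslerConnection n M) (v : TangentBundle (𝓡 n) M)
    (X Y : TangentSpace (𝓡 n).tangent v) : PB n M v :=
  covExtDeriv D omega v X Y

/-- The canonical horizontal torsion `Ψ^a = T^a + (1/2) g^{ar} D g_{rb} ∧ ω^b`. The map
`(g.toFun v).inverse` raises an index. -/
def canonicalTorsion (D : FinslerConnection n M) (g : FinslerMetric n M)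
    (v : TangentBundle (𝓡 n) M) (X Y : TangentSpace (𝓡 n).tangent v) : PB n M v :=
  torsion D v X Y
    + (1 / 2 : ℝ) • ((g.toFun v).inverse (dMetric D g v X (omega v Y))
      - (g.toFun v).inverse (dMetric D g v Y (omega v X)))

/-- The 3-form `Θ ∧ (g · β) = g_{ab} Θ^a ∧ β^b`, for a `TM`-valued 2-form `Θ` and a
`TM`-valued 1-form `β`. -/
def wedgeMetric (g : FinslerMetric n M) (v : TangentBundle (𝓡 n) M)
    (Θ : TangentSpace (𝓡 n).tangent v → TangentSpace (𝓡 n).tangent v → PB n M v)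
    (β : TangentSpace (𝓡 n).tangent v →L[ℝ] PB n M v)
    (X Y Z : TangentSpace (𝓡 n).tangent v) : ℝ :=
  g.toFun v (Θ X Y) (β Z) + g.toFun v (Θ Y Z) (β X) + g.toFun v (Θ Z X) (β Y)

/-- Condition (β): `Ψ ∧ (g · ω) = 0`. -/
def CondBeta (g : FinslerMetric n M) (D : FinslerConnection n M) : Prop :=
  ∀ v ∈ Slit n M, ∀ X Y Z, wedgeMetric g v (canonicalTorsion D g v) (omega v) X Y Z = 0

/-- Condition (γ): `Ψ · g · y = 0`. -/
def CondGamma (g : FinslerMetric n M) (D : FinslerConnection n M) : Prop :=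
  ∀ v ∈ Slit n M, ∀ X Y, g.toFun v (canonicalTorsion D g v X Y) (liouville v) = 0

/-- Condition (δ): `Ψ ∧ (g · ω̄) = 0`. -/
def CondDelta (g : FinslerMetric n M) (D : FinslerConnection n M) : Prop :=
  ∀ v ∈ Slit n M, ∀ X Y Z, wedgeMetric g v (canonicalTorsion D g v) (omegaBar D v) X Y Z = 0

/-- Condition (ε): `y · Dg = 0`. -/
def CondEpsilon (g : FinslerMetric n M) (D : FinslerConnection n M) : Prop :=
  ∀ v ∈ Slit n M, ∀ X u, dMetric D g v X (liouville v) u = 0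

/-- Conditions (α)-(ε). -/
def Compatible (g : FinslerMetric n M) (D : FinslerConnection n M) : Prop :=
  Regular D ∧ CondBeta g D ∧ CondGamma g D ∧ CondDelta g D ∧ CondEpsilon g D

/-- The symmetry `ω'^a_b = ω^a_b + W^a_b`, where the endomorphism-valued 1-form `W` satisfies
`W_{ab} = W_{ba}` and `W_{ab} y^b = 0`. (On the slit tangent bundle `W` is determined by the
two smooth connections, hence it is smooth there.) -/
def SymmetryRelated (g : FinslerMetric n M) (D D' : FinslerConnection n M) : Prop :=
  ∃ W : Π v : TangentBundle (𝓡 n) M,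
      PB n M v →L[ℝ] TangentSpace (𝓡 n).tangent v →L[ℝ] PB n M v,
    (∀ v ∈ Slit n M, ∀ σ : Π v, PB n M v, SecDiffAt σ v →
      D'.toFun σ v = D.toFun σ v + W v (σ v)) ∧
    (∀ v ∈ Slit n M, ∀ X u w, g.toFun v u (W v w X) = g.toFun v w (W v u X)) ∧
    (∀ v ∈ Slit n M, ∀ X, W v (liouville v) X = 0)

/-- The equivalence relation `∇ ∼_g ∇'` between regular Finsler connections. -/
def Equivalent (g : FinslerMetric n M) (D D' : FinslerConnection n M) : Prop :=
  Regular D ∧ Regular D' ∧ SymmetryRelated g D D'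

/-- The vertical Hessian `∂²/∂r∂s 𝓛 (y + r u + s w)` at `r = s = 0`. -/
def verticalHessian (L : TangentBundle (𝓡 n) M → ℝ) (v : TangentBundle (𝓡 n) M)
    (u w : TangentSpace (𝓡 n) v.proj) : ℝ :=
  deriv (fun r : ℝ => deriv (fun s : ℝ => L ⟨v.proj, v.2 + r • u + s • w⟩) 0) 0

/-- A Finsler Lagrangian: smooth on the slit tangent bundle, positively homogeneous of degree
two, with non-degenerate vertical Hessian. -/
structure IsFinslerLagrangian (L : TangentBundle (𝓡 n) M → ℝ) : Prop where
  contMDiffOn : ContMDiffOn (𝓡 n).tangent 𝓘(ℝ, ℝ) ∞ L (Slit n M)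
  homogeneous : ∀ v ∈ Slit n M, ∀ s : ℝ, 0 < s → L ⟨v.proj, s • v.2⟩ = s ^ 2 * L v
  nondegenerate : ∀ v ∈ Slit n M, ∀ u, (∀ w, verticalHessian L v u w = 0) → u = 0

/-- `g` is the vertical Hessian of `𝓛`. -/
def IsVerticalHessian (L : TangentBundle (𝓡 n) M → ℝ) (g : FinslerMetric n M) : Prop :=
  ∀ v ∈ Slit n M, ∀ u w, g.toFun v u w = verticalHessian L v u w

/-- The function `𝓛 = (1/2) g_y (y, y)`. -/
def energy (g : FinslerMetric n M) (v : TangentBundle (𝓡 n) M) : ℝ :=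
  (1 / 2 : ℝ) * g.toFun v (liouville v) (liouville v)

/-! ### Coordinate expressions

Below `φ` is a chart of `M`, to be taken in the maximal smooth atlas, and the expressions are
used at points of `TM` over the domain of `φ`. -/

/-- The coordinate field `e_b = ∂/∂x^b`, as a section of `π^*(TM)`. -/
def frame (φ : OpenPartialHomeomorph M (Coord n)) (b : Fin n) (v : TangentBundle (𝓡 n) M) :
    PB n M v :=
  (mfderiv (𝓡 n) (𝓡 n) φ v.proj).inverse (EuclideanSpace.single b (1 : ℝ) : Coord n)

/-- The components `u^a` of a vector `u` tangent to `M`. -/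
def comp (φ : OpenPartialHomeomorph M (Coord n)) (v : TangentBundle (𝓡 n) M) (u : PB n M v) :
    Coord n :=
  mfderiv (𝓡 n) (𝓡 n) φ v.proj u

/-- The induced coordinates `(x^a, y^a)` on `TM`. -/
def tcoord (φ : OpenPartialHomeomorph M (Coord n)) (v : TangentBundle (𝓡 n) M) :
    Coord n × Coord n :=
  (φ v.proj, comp φ v (liouville v))

/-- The point of `TM` with given induced coordinates. -/
def tcoordSymm (φ : OpenPartialHomeomorph M (Coord n)) (p : Coord n × Coord n) :
    TangentBundle (𝓡 n) M :=
  ⟨φ.symm p.1, (mfderiv (𝓡 n) (𝓡 n) φ (φ.symm p.1)).inverse p.2⟩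

/-- `∂f/∂x^c`. -/
def pdx (φ : OpenPartialHomeomorph M (Coord n)) (c : Fin n) (f : TangentBundle (𝓡 n) M → ℝ)
    (v : TangentBundle (𝓡 n) M) : ℝ :=
  fderiv ℝ (fun p => f (tcoordSymm φ p)) (tcoord φ v) (EuclideanSpace.single c (1 : ℝ), 0)

/-- `∂f/∂y^c`. -/
def pdy (φ : OpenPartialHomeomorph M (Coord n)) (c : Fin n) (f : TangentBundle (𝓡 n) M → ℝ)
    (v : TangentBundle (𝓡 n) M) : ℝ :=
  fderiv ℝ (fun p => f (tcoordSymm φ p)) (tcoord φ v) (0, EuclideanSpace.single c (1 : ℝ))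

/-- The connection 1-forms: `∇ e_b = ω^a_b e_a`. -/
def connForm (D : FinslerConnection n M) (φ : OpenPartialHomeomorph M (Coord n))
    (v : TangentBundle (𝓡 n) M) (a b : Fin n) (X : TangentSpace (𝓡 n).tangent v) : ℝ :=
  comp φ v (D.toFun (frame φ b) v X) a

/-- For a regular connection, the vector `X` with `ω X = p.1` and `ω̄ X = p.2`. -/
def lift (D : FinslerConnection n M) (v : TangentBundle (𝓡 n) M) (p : PB n M v × PB n M v) :
    TangentSpace (𝓡 n).tangent v :=
  ((omega v).prod (omegaBar D v)).inverse p

/-- The coefficient `H^a_{bc}` in the expansion `ω^a_b = H^a_{bc} ω^c + V^a_{bc} ω̄^c` of the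
connection 1-forms of a regular connection in the basis `{ω^c, ω̄^c}`. -/
def hCoeff (D : FinslerConnection n M) (φ : OpenPartialHomeomorph M (Coord n))
    (v : TangentBundle (𝓡 n) M) (a b c : Fin n) : ℝ :=
  connForm D φ v a b (lift D v (frame φ c v, 0))

/-- The coefficient `V^a_{bc}` in the expansion `ω^a_b = H^a_{bc} ω^c + V^a_{bc} ω̄^c`. -/
def vCoeff (D : FinslerConnection n M) (φ : OpenPartialHomeomorph M (Coord n))
    (v : TangentBundle (𝓡 n) M) (a b c : Fin n) : ℝ :=
  connForm D φ v a b (lift D v (0, frame φ c v))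

/-- Lowering of the first index, `F_{abc} = g_{ad} F^d_{bc}`. -/
def lower (g : FinslerMetric n M) (φ : OpenPartialHomeomorph M (Coord n))
    (v : TangentBundle (𝓡 n) M) (F : Fin n → Fin n → Fin n → ℝ) (a b c : Fin n) : ℝ :=
  ∑ d, g.toFun v (frame φ a v) (frame φ d v) * F d b c

/-- The components `∂²𝓛/∂y^a∂y^b` of the vertical Hessian of `𝓛`. -/
def hess (L : TangentBundle (𝓡 n) M → ℝ) (φ : OpenPartialHomeomorph M (Coord n)) (a b : Fin n)
    (v : TangentBundle (𝓡 n) M) : ℝ :=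
  pdy φ a (pdy φ b L) v

/-- The components `g^{ab}` of the inverse of the vertical Hessian of `𝓛`. -/
def hessInv (L : TangentBundle (𝓡 n) M → ℝ) (φ : OpenPartialHomeomorph M (Coord n))
    (v : TangentBundle (𝓡 n) M) : Matrix (Fin n) (Fin n) ℝ :=
  (Matrix.of fun a b => hess L φ a b v)⁻¹

/-- The spray coefficients,
`2 G^a = g^{ad} (∂²𝓛/∂x^c∂y^d y^c - ∂𝓛/∂x^d)`. -/
def spray (L : TangentBundle (𝓡 n) M → ℝ) (φ : OpenPartialHomeomorph M (Coord n)) (a : Fin n)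
    (v : TangentBundle (𝓡 n) M) : ℝ :=
  (1 / 2 : ℝ) * ∑ d, hessInv L φ v a d *
    ((∑ c, pdx φ c (pdy φ d L) v * comp φ v (liouville v) c) - pdx φ d L v)

/-- The coefficients `N^a_c = ∂G^a/∂y^c` of Barthel's non-linear connection of `𝓛`. -/
def barthelCoeff (L : TangentBundle (𝓡 n) M → ℝ) (φ : OpenPartialHomeomorph M (Coord n))
    (a c : Fin n) (v : TangentBundle (𝓡 n) M) : ℝ :=
  pdy φ c (spray L φ a) v

/-- The derivative `δf/δx^c = ∂f/∂x^c - N^a_c ∂f/∂y^a`, with the coefficients of Barthel's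
non-linear connection of `𝓛`. -/
def delta (L : TangentBundle (𝓡 n) M → ℝ) (φ : OpenPartialHomeomorph M (Coord n)) (c : Fin n)
    (f : TangentBundle (𝓡 n) M → ℝ) (v : TangentBundle (𝓡 n) M) : ℝ :=
  pdx φ c f v - ∑ a, barthelCoeff L φ a c v * pdy φ a f v

/-- `Γ_{abc} = (1/2) (δg_{ac}/δx^b + δg_{ab}/δx^c - δg_{bc}/δx^a)`. -/
def gammaLow (L : TangentBundle (𝓡 n) M → ℝ) (φ : OpenPartialHomeomorph M (Coord n))
    (v : TangentBundle (𝓡 n) M) (a b c : Fin n) : ℝ :=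
  (1 / 2 : ℝ) * (delta L φ b (hess L φ a c) v + delta L φ c (hess L φ a b) v
    - delta L φ a (hess L φ b c) v)

/-- `Γ^a_{bc} = g^{ad} Γ_{dbc}`. -/
def gammaUp (L : TangentBundle (𝓡 n) M → ℝ) (φ : OpenPartialHomeomorph M (Coord n))
    (v : TangentBundle (𝓡 n) M) (a b c : Fin n) : ℝ :=
  ∑ d, hessInv L φ v a d * gammaLow L φ v d b c

/-- `G^a_{bc} = ∂²G^a/∂y^b∂y^c`. -/
def berwaldUp (L : TangentBundle (𝓡 n) M → ℝ) (φ : OpenPartialHomeomorph M (Coord n))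
    (v : TangentBundle (𝓡 n) M) (a b c : Fin n) : ℝ :=
  pdy φ b (pdy φ c (spray L φ a)) v

/-- The Cartan torsion `C^a_{bc} = g^{ad} C_{dbc}`, `C_{abc} = (1/2) ∂³𝓛/∂y^a∂y^b∂y^c`. -/
def cartanUp (L : TangentBundle (𝓡 n) M → ℝ) (φ : OpenPartialHomeomorph M (Coord n))
    (v : TangentBundle (𝓡 n) M) (a b c : Fin n) : ℝ :=
  ∑ d, hessInv L φ v a d * ((1 / 2 : ℝ) * pdy φ d (pdy φ b (pdy φ c L)) v)

/-- The distribution `HE` is Barthel's non-linear connection of `𝓛`: in every chart it is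
given by `dy^a + N^a_c dx^c = 0` with `N^a_c = ∂G^a/∂y^c`. -/
def IsBarthel (L : TangentBundle (𝓡 n) M → ℝ)
    (HE : Π v : TangentBundle (𝓡 n) M, Submodule ℝ (TangentSpace (𝓡 n).tangent v)) : Prop :=
  ∀ φ ∈ IsManifold.maximalAtlas (𝓡 n) ∞ M, ∀ v ∈ Slit n M, v.proj ∈ φ.source →
    ∀ X, X ∈ HE v ↔ ∀ a,
      (mvfderiv (𝓡 n).tangent (tcoord φ) v X).2 a
        + ∑ c, barthelCoeff L φ a c v * (mvfderiv (𝓡 n).tangent (tcoord φ) v X).1 c = 0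

/-- The regular connection `∇` has the coefficients `H^a_{bc}` and `V^a_{bc}` in every chart. -/
def HasCoefficients (D : FinslerConnection n M)
    (H V : OpenPartialHomeomorph M (Coord n) → TangentBundle (𝓡 n) M →
      Fin n → Fin n → Fin n → ℝ) : Prop :=
  Regular D ∧ ∀ φ ∈ IsManifold.maximalAtlas (𝓡 n) ∞ M, ∀ v ∈ Slit n M, v.proj ∈ φ.source →
    ∀ a b c, hCoeff D φ v a b c = H φ v a b c ∧ vCoeff D φ v a b c = V φ v a b c

/-- `∇` is the Berwald connection of `𝓛`. -/
def IsBerwald (L : TangentBundle (𝓡 n) M → ℝ) (D : FinslerConnection n M) : Prop :=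
  HasCoefficients D (berwaldUp L) (fun _ _ _ _ _ => 0)

/-- `∇` is the Chern connection of `𝓛`. -/
def IsChern (L : TangentBundle (𝓡 n) M → ℝ) (D : FinslerConnection n M) : Prop :=
  HasCoefficients D (gammaUp L) (fun _ _ _ _ _ => 0)

/-- `∇` is the Cartan connection of `𝓛`. -/
def IsCartan (L : TangentBundle (𝓡 n) M → ℝ) (D : FinslerConnection n M) : Prop :=
  HasCoefficients D (gammaUp L) (cartanUp L)

/-- `∇` is the Hashiguchi connection of `𝓛`. -/
def IsHashiguchi (L : TangentBundle (𝓡 n) M → ℝ) (D : FinslerConnection n M) : Prop :=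
  HasCoefficients D (berwaldUp L) (cartanUp L)

/-- The coefficients `F_{abc}` are symmetric in the first two indices and annihilated by `y`
in the first (hence also in the second) index. -/
def SymmAnnihilated (φ : OpenPartialHomeomorph M (Coord n)) (v : TangentBundle (𝓡 n) M)
    (F : Fin n → Fin n → Fin n → ℝ) : Prop :=
  (∀ a b c, F a b c = F b a c) ∧ ∀ b c, ∑ a, comp φ v (liouville v) a * F a b c = 0

/-- In every chart `H_{abc} = Γ_{abc} + Λ_{abc}` where `Λ_{abc}` and `V_{abc}` are symmetric in
the first two indices and annihilated by `y`. -/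
def HasCanonicalForm (L : TangentBundle (𝓡 n) M → ℝ) (g : FinslerMetric n M)
    (D : FinslerConnection n M) : Prop :=
  ∀ φ ∈ IsManifold.maximalAtlas (𝓡 n) ∞ M, ∀ v ∈ Slit n M, v.proj ∈ φ.source →
    (∃ Λ : Fin n → Fin n → Fin n → ℝ,
      (∀ a b c, lower g φ v (hCoeff D φ v) a b c = gammaLow L φ v a b c + Λ a b c) ∧
      SymmAnnihilated φ v Λ) ∧
    SymmAnnihilated φ v (lower g φ v (vCoeff D φ v))

end Finsler

end

open Bundle Filter Topology
open scoped Manifold ContDiff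

set_option linter.unusedSectionVars false

noncomputable section

namespace Finsler

variable {n : ℕ} {M : Type*} [TopologicalSpace M] [ChartedSpace (Coord n) M]
  [IsManifold (𝓡 n) ∞ M]

/-! Everything is decided by one family of local 1-forms. With indices lowered by g, the canonical
torsion in a chart is Ψ_a = θ_{ab} ∧ dx^b, where θ_{ab} = (dg_{ab} + ω_{ab} - ω_{ba})/2
(`metric_canonicalTorsion_frame`). Hence θ_{ab} + θ_{ba} = dg_{ab}, θ_{ab} - θ_{ba} = ω_{ab} -
ω_{ba} and ω_{ab} = θ_{ab} - (Dg)_{ab}/2. The five conditions see the connection only through θ, ω̄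
and y·Dg, and none of these changes when a symmetric W_{ab} with W_{ab} y^b = 0 is added to ω_{ab}.
That is the invariance under the symmetry.

The metric is a Hessian. On a vertical Z, (β) makes θ_{ab}(Z) symmetric, hence equal to Z(g_{ab})/2,
and (γ) gives y^a θ_{ab}(Z) = 0. So y^a ∂g_{ab}/∂y^c = 0, two vertical derivatives of g_{ab} y^a y^b
/ 2 return g, and Euler's relation integrates along rays to homogeneity
(`isFinslerLagrangian_energy`).

The non-linear connection. On vertical vectors (β), (γ) and (ε) give ω^a_b(Z) y^b = 0, so ω̄^a =
dy^a + N^a_c dx^c. On the horizontal fields δ_c of N, (δ) makes θ_{ab}(δ_c) symmetric in b and c,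
and the Levi-Civita argument identifies it with the Christoffel symbol Γ_{abc} formed with the
unknown N. By (ε), contraction with y turns this into the implicit equation N_{ac} = y^b Γ_{abc}. A
second contraction, with y^c, eliminates N on the right because y^a ∂g_{ab}/∂y^c = 0, and gives
N^a_c y^c = 2G^a. The single contraction depends on N only through N^a_c y^c, so N is determined,
and it is ∂G^a/∂y^c (`LagrangianOn.barthelCoeff_unique`).

Thus (α)-(ε) amount to `AdaptedAt`: ω̄ is Barthel's, θ_{ab} = Γ_{abc} dx^c + C_{abc} ω̄^c, and y·Dg
= 0. The freedom left is the symmetric part of ω_{ab}, that is Λ and V. Conversely these formulas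
give Ψ_a = C_{abc} ω̄^c ∧ dx^b, and (β), (γ), (δ) follow from the total symmetry of C and y^a
C_{abc} = 0.

The class. Since g fixes ω̄ and θ, two connections with (α)-(ε) differ by an admissible W
(`Compatible.symmetryRelated`). To reach the notable connections one adds tensors that have
chart-free expressions: Dg/2 leads to Cartan's connection (ω_{ab} = θ_{ab}); -Ψ paired with
horizontal lifts removes C and leads to Chern's; and Dω̄ paired with vertical lifts supplies the
Landsberg-type tensor that separates Γ_{abc} from G_{abc}, which leads from Chern to Berwald and
from Cartan to Hashiguchi. -/

/-! ### Charts of the tangent bundle -/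

/-- The part of the tangent bundle over the domain of a chart. -/
def chartDom (φ : OpenPartialHomeomorph M (Coord n)) : Set (TangentBundle (𝓡 n) M) :=
  {v | v.proj ∈ φ.source}

theorem isOpen_chartDom (φ : OpenPartialHomeomorph M (Coord n)) : IsOpen (chartDom φ) :=
  φ.open_source.preimage (FiberBundle.continuous_proj _ _)

section Chart

variable {φ : OpenPartialHomeomorph M (Coord n)}

theorem chart_mdifferentiable (hφ : φ ∈ IsManifold.maximalAtlas (𝓡 n) ∞ M) :
    φ.MDifferentiable (𝓡 n) (𝓡 n) :=
  ⟨(contMDiffOn_of_mem_maximalAtlas hφ).mdifferentiableOn (by simp),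
    (contMDiffOn_symm_of_mem_maximalAtlas hφ).mdifferentiableOn (by simp)⟩

theorem isInvertible_mfderiv_chart (hφ : φ ∈ IsManifold.maximalAtlas (𝓡 n) ∞ M) {x : M}
    (hx : x ∈ φ.source) : (mfderiv (𝓡 n) (𝓡 n) φ x).IsInvertible :=
  ⟨(chart_mdifferentiable hφ).mfderiv hx, rfl⟩

theorem inverse_mfderiv_chart (hφ : φ ∈ IsManifold.maximalAtlas (𝓡 n) ∞ M) {x : M}
    (hx : x ∈ φ.source) :
    (mfderiv (𝓡 n) (𝓡 n) φ x).inverse = mfderiv (𝓡 n) (𝓡 n) φ.symm (φ x) := by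
  apply ContinuousLinearMap.inverse_eq
  · have := (chart_mdifferentiable hφ).comp_symm_deriv (φ.map_source hx)
    rwa [φ.left_inv hx] at this
  · exact (chart_mdifferentiable hφ).symm_comp_deriv hx

/-- The components of a vector, as a continuous linear map. -/
def compL (φ : OpenPartialHomeomorph M (Coord n)) (v : TangentBundle (𝓡 n) M) :
    PB n M v →L[ℝ] Coord n :=
  mfderiv (𝓡 n) (𝓡 n) φ v.proj

theorem compL_apply (v : TangentBundle (𝓡 n) M) (u : PB n M v) : compL φ v u = comp φ v u := rfl

theorem inverse_compL_comp (hφ : φ ∈ IsManifold.maximalAtlas (𝓡 n) ∞ M)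
    {v : TangentBundle (𝓡 n) M} (hv : v ∈ chartDom φ) (u : PB n M v) :
    (mfderiv (𝓡 n) (𝓡 n) φ v.proj).inverse (comp φ v u) = u :=
  (isInvertible_mfderiv_chart hφ hv).inverse_apply_self u

theorem comp_inverse (hφ : φ ∈ IsManifold.maximalAtlas (𝓡 n) ∞ M)
    {v : TangentBundle (𝓡 n) M} (hv : v ∈ chartDom φ) (u : Coord n) :
    comp φ v ((mfderiv (𝓡 n) (𝓡 n) φ v.proj).inverse u) = u :=
  (isInvertible_mfderiv_chart hφ hv).self_apply_inverse u

theorem comp_injective (hφ : φ ∈ IsManifold.maximalAtlas (𝓡 n) ∞ M)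
    {v : TangentBundle (𝓡 n) M} (hv : v ∈ chartDom φ) {u w : PB n M v}
    (h : comp φ v u = comp φ v w) : u = w := by
  rw [← inverse_compL_comp hφ hv u, h, inverse_compL_comp hφ hv w]

theorem comp_frame (hφ : φ ∈ IsManifold.maximalAtlas (𝓡 n) ∞ M)
    {v : TangentBundle (𝓡 n) M} (hv : v ∈ chartDom φ) (b : Fin n) :
    comp φ v (frame φ b v) = EuclideanSpace.single b (1 : ℝ) :=
  comp_inverse hφ hv _

theorem tcoordSymm_tcoord (hφ : φ ∈ IsManifold.maximalAtlas (𝓡 n) ∞ M)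
    {v : TangentBundle (𝓡 n) M} (hv : v ∈ chartDom φ) : tcoordSymm φ (tcoord φ v) = v := by
  obtain ⟨x, u⟩ := v
  have hx : φ.symm (φ x) = x := φ.left_inv hv
  have h := inverse_compL_comp hφ hv u
  simp only [tcoordSymm, tcoord]
  rw [hx]
  exact congrArg _ h

theorem tcoordSymm_mem (p : Coord n × Coord n) (hp : p.1 ∈ φ.target) :
    tcoordSymm φ p ∈ chartDom φ := φ.map_target hp

theorem tcoord_tcoordSymm (hφ : φ ∈ IsManifold.maximalAtlas (𝓡 n) ∞ M)
    {p : Coord n × Coord n} (hp : p.1 ∈ φ.target) : tcoord φ (tcoordSymm φ p) = p :=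
  Prod.ext (φ.right_inv hp) (comp_inverse hφ (tcoordSymm_mem p hp) p.2)

theorem contMDiffOn_tcoord (hφ : φ ∈ IsManifold.maximalAtlas (𝓡 n) ∞ M) :
    ContMDiffOn (𝓡 n).tangent 𝓘(ℝ, Coord n × Coord n) ∞ (tcoord φ) (chartDom φ) := by
  have h1 : ContMDiffOn (𝓡 n).tangent 𝓘(ℝ, Coord n) ∞ (fun v => φ v.proj) (chartDom φ) :=
    (contMDiffOn_of_mem_maximalAtlas hφ).comp (contMDiff_proj _).contMDiffOn fun v hv => hv
  have h2 : ContMDiffOn (𝓡 n).tangent 𝓘(ℝ, Coord n) ∞ (fun v => comp φ v (liouville v))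
      (chartDom φ) := by
    have h := (contMDiffOn_of_mem_maximalAtlas hφ).contMDiffOn_tangentMapWithin (m := ∞)
      (by simp) φ.open_source.uniqueMDiffOn
    have h' := (contMDiff_snd_tangentBundle_modelSpace (Coord n) (𝓡 n)
      (n := ∞)).comp_contMDiffOn h
    refine h'.congr fun v hv => ?_
    simp only [Function.comp, tangentMapWithin]
    rw [mfderivWithin_of_isOpen φ.open_source hv]
    rfl
  exact h1.prodMk_space h2

theorem contMDiffOn_tcoordSymm (hφ : φ ∈ IsManifold.maximalAtlas (𝓡 n) ∞ M) :
    ContMDiffOn 𝓘(ℝ, Coord n × Coord n) (𝓡 n).tangent ∞ (tcoordSymm φ)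
      (φ.target ×ˢ Set.univ) := by
  have h := (contMDiffOn_symm_of_mem_maximalAtlas hφ).contMDiffOn_tangentMapWithin (m := ∞)
      (by simp) φ.open_target.uniqueMDiffOn
  have h0 : ContMDiff 𝓘(ℝ, Coord n × Coord n) (𝓡 n).tangent ∞
      (fun p : Coord n × Coord n => (⟨p.1, p.2⟩ : TangentBundle (𝓡 n) (Coord n))) := by
    intro p
    rw [contMDiffAt_totalSpace]
    refine ⟨contDiff_fst.contMDiff p, (contDiff_snd.contMDiff p).congr_of_eventuallyEq
      (Eventually.of_forall fun q => ?_)⟩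
    exact congrArg Prod.snd (trivializationAt_model_space_apply (I := 𝓡 n) ⟨q.1, q.2⟩ p.1)
  refine (h.comp h0.contMDiffOn fun p hp => hp.1).congr fun p hp => ?_
  simp only [Function.comp, tangentMapWithin, tcoordSymm]
  rw [mfderivWithin_of_isOpen φ.open_target hp.1,
    inverse_mfderiv_chart hφ (φ.map_target hp.1), φ.right_inv hp.1]

/-- A section of the pullback bundle is a map into `TM` over π. In the trivializations both have the
same fibre component, and the base components, the identity and π, are smooth anyway. -/
theorem contMDiffAt_section_iff_lift {σ : Π v, PB n M v} {v : TangentBundle (𝓡 n) M} {k : ℕ∞ω} :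
    ContMDiffAt (𝓡 n).tangent ((𝓡 n).tangent.prod 𝓘(ℝ, Coord n)) k
      (fun z => TotalSpace.mk' (Coord n) z (σ z)) v ↔
    ContMDiffAt (𝓡 n).tangent (𝓡 n).tangent k
      (fun z => (⟨z.proj, σ z⟩ : TangentBundle (𝓡 n) M)) v := by
  refine contMDiffAt_totalSpace.trans (Iff.trans ?_ contMDiffAt_totalSpace.symm)
  exact ⟨fun h => ⟨contMDiff_proj _ _, h.2⟩, fun h => ⟨contMDiffAt_id, h.2⟩⟩

theorem secDiffAt_iff_lift {σ : Π v, PB n M v} {v : TangentBundle (𝓡 n) M} :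
    SecDiffAt σ v ↔ MDifferentiableAt (𝓡 n).tangent (𝓡 n).tangent
      (fun z => (⟨z.proj, σ z⟩ : TangentBundle (𝓡 n) M)) v := by
  refine (mdifferentiableAt_totalSpace _ _).trans
    (Iff.trans ?_ (mdifferentiableAt_totalSpace _ _).symm)
  exact ⟨fun h => ⟨(contMDiff_proj (n := 1) _ _).mdifferentiableAt (by simp), h.2⟩,
    fun h => ⟨mdifferentiableAt_id, h.2⟩⟩

theorem contMDiffAt_tcoord (hφ : φ ∈ IsManifold.maximalAtlas (𝓡 n) ∞ M)
    {v : TangentBundle (𝓡 n) M} (hv : v ∈ chartDom φ) :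
    ContMDiffAt (𝓡 n).tangent 𝓘(ℝ, Coord n × Coord n) ∞ (tcoord φ) v :=
  (contMDiffOn_tcoord hφ).contMDiffAt ((isOpen_chartDom φ).mem_nhds hv)

theorem isOpen_target_prod (φ : OpenPartialHomeomorph M (Coord n)) :
    IsOpen (φ.target ×ˢ (Set.univ : Set (Coord n))) :=
  φ.open_target.prod isOpen_univ

theorem contMDiffAt_tcoordSymm (hφ : φ ∈ IsManifold.maximalAtlas (𝓡 n) ∞ M)
    {p : Coord n × Coord n} (hp : p.1 ∈ φ.target) :
    ContMDiffAt 𝓘(ℝ, Coord n × Coord n) (𝓡 n).tangent ∞ (tcoordSymm φ) p :=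
  (contMDiffOn_tcoordSymm hφ).contMDiffAt ((isOpen_target_prod φ).mem_nhds ⟨hp, trivial⟩)

theorem lift_eq_tcoordSymm (hφ : φ ∈ IsManifold.maximalAtlas (𝓡 n) ∞ M)
    {v : TangentBundle (𝓡 n) M} (hv : v ∈ chartDom φ) (u : PB n M v) :
    (⟨v.proj, u⟩ : TangentBundle (𝓡 n) M) = tcoordSymm φ (φ v.proj, comp φ v u) :=
  (tcoordSymm_tcoord hφ (v := ⟨v.proj, u⟩) hv).symm

/-- Smoothness of a section of `π^*(TM)` in terms of its components. -/
theorem contMDiffAt_section_iff_comp (hφ : φ ∈ IsManifold.maximalAtlas (𝓡 n) ∞ M)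
    {v : TangentBundle (𝓡 n) M} (hv : v ∈ chartDom φ) {σ : Π v, PB n M v} :
    ContMDiffAt (𝓡 n).tangent ((𝓡 n).tangent.prod 𝓘(ℝ, Coord n)) ∞
      (fun z => TotalSpace.mk' (Coord n) z (σ z)) v ↔
    ContMDiffAt (𝓡 n).tangent 𝓘(ℝ, Coord n) ∞ (fun z => comp φ z (σ z)) v := by
  rw [contMDiffAt_section_iff_lift]
  constructor
  · intro h
    have h1 := (contMDiffAt_tcoord hφ (v := ⟨v.proj, σ v⟩) hv).comp v h
    exact (contDiff_snd.contMDiff _).comp v h1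
  · intro h
    have h0 : ContMDiffAt (𝓡 n).tangent 𝓘(ℝ, Coord n) ∞
        (fun z : TangentBundle (𝓡 n) M => φ z.proj) v :=
      (contMDiffAt_of_mem_maximalAtlas hφ hv).comp v (contMDiff_proj _ _)
    have h1 := (contMDiffAt_tcoordSymm hφ (p := (φ v.proj, comp φ v (σ v)))
      (φ.map_source hv)).comp v (h0.prodMk_space h)
    refine h1.congr_of_eventuallyEq ?_
    filter_upwards [(isOpen_chartDom φ).mem_nhds hv] with z hz
    exact lift_eq_tcoordSymm hφ hz _

/-- Differentiability of a section of `π^*(TM)` in terms of its components. -/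
theorem secDiffAt_iff_comp (hφ : φ ∈ IsManifold.maximalAtlas (𝓡 n) ∞ M)
    {v : TangentBundle (𝓡 n) M} (hv : v ∈ chartDom φ) {σ : Π v, PB n M v} :
    SecDiffAt σ v ↔
    MDifferentiableAt (𝓡 n).tangent 𝓘(ℝ, Coord n) (fun z => comp φ z (σ z)) v := by
  rw [secDiffAt_iff_lift]
  constructor
  · intro h
    have h1 := ((contMDiffAt_tcoord hφ (v := ⟨v.proj, σ v⟩) hv).mdifferentiableAt
      (by simp)).comp v h
    exact (differentiableAt_snd.mdifferentiableAt).comp v h1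
  · intro h
    have h0 : ContMDiffAt (𝓡 n).tangent 𝓘(ℝ, Coord n) ∞
        (fun z : TangentBundle (𝓡 n) M => φ z.proj) v :=
      (contMDiffAt_of_mem_maximalAtlas hφ hv).comp v (contMDiff_proj _ _)
    have h1 := ((contMDiffAt_tcoordSymm hφ (p := (φ v.proj, comp φ v (σ v)))
      (φ.map_source hv)).mdifferentiableAt (by simp)).comp v
        ((h0.mdifferentiableAt (by simp)).prodMk_space h)
    refine h1.congr_of_eventuallyEq ?_
    filter_upwards [(isOpen_chartDom φ).mem_nhds hv] with z hz
    exact lift_eq_tcoordSymm hφ hz _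

theorem contMDiffAt_frame (hφ : φ ∈ IsManifold.maximalAtlas (𝓡 n) ∞ M)
    {v : TangentBundle (𝓡 n) M} (hv : v ∈ chartDom φ) (b : Fin n) :
    ContMDiffAt (𝓡 n).tangent ((𝓡 n).tangent.prod 𝓘(ℝ, Coord n)) ∞
      (fun z => TotalSpace.mk' (Coord n) z (frame φ b z)) v := by
  rw [contMDiffAt_section_iff_comp hφ hv]
  refine (contMDiffAt_const (c := (EuclideanSpace.single b (1 : ℝ) : Coord n))
    ).congr_of_eventuallyEq ?_
  filter_upwards [(isOpen_chartDom φ).mem_nhds hv] with z hz using comp_frame hφ hz b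

theorem secDiffAt_frame (hφ : φ ∈ IsManifold.maximalAtlas (𝓡 n) ∞ M)
    {v : TangentBundle (𝓡 n) M} (hv : v ∈ chartDom φ) (b : Fin n) : SecDiffAt (frame φ b) v :=
  (contMDiffAt_frame hφ hv b).mdifferentiableAt (by simp)

theorem contMDiffAt_liouville (v : TangentBundle (𝓡 n) M) :
    ContMDiffAt (𝓡 n).tangent ((𝓡 n).tangent.prod 𝓘(ℝ, Coord n)) ∞
      (fun z => TotalSpace.mk' (E := PB n M) (Coord n) z (liouville z : PB n M z)) v :=
  contMDiffAt_section_iff_lift.2 contMDiffAt_id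

theorem secDiffAt_liouville (v : TangentBundle (𝓡 n) M) : SecDiffAt liouville v :=
  (contMDiffAt_liouville v).mdifferentiableAt (by simp)

theorem sum_comp_smul_frame (hφ : φ ∈ IsManifold.maximalAtlas (𝓡 n) ∞ M)
    {v : TangentBundle (𝓡 n) M} (hv : v ∈ chartDom φ) (u : PB n M v) :
    u = ∑ b, comp φ v u b • frame φ b v := by
  apply comp_injective hφ hv
  have h : comp φ v (∑ b, comp φ v u b • frame φ b v) =
      ∑ b, comp φ v u b • comp φ v (frame φ b v) := by
    simp only [← compL_apply, map_sum, map_smul]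
  rw [h]
  ext a
  simp [comp_frame hφ hv, Pi.single_apply]

/-! ### The differential of the induced coordinates -/

/-- The differential of the induced coordinates. -/
def dtcoord (φ : OpenPartialHomeomorph M (Coord n)) (v : TangentBundle (𝓡 n) M) :
    TangentSpace (𝓡 n).tangent v →L[ℝ] Coord n × Coord n :=
  mvfderiv (𝓡 n).tangent (tcoord φ) v

theorem tcoord_mdifferentiableAt (hφ : φ ∈ IsManifold.maximalAtlas (𝓡 n) ∞ M)
    {v : TangentBundle (𝓡 n) M} (hv : v ∈ chartDom φ) :
    MDifferentiableAt (𝓡 n).tangent 𝓘(ℝ, Coord n × Coord n) (tcoord φ) v :=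
  (contMDiffAt_tcoord hφ hv).mdifferentiableAt (by simp)

theorem tcoordSymm_mdifferentiableAt (hφ : φ ∈ IsManifold.maximalAtlas (𝓡 n) ∞ M)
    {p : Coord n × Coord n} (hp : p.1 ∈ φ.target) :
    MDifferentiableAt 𝓘(ℝ, Coord n × Coord n) (𝓡 n).tangent (tcoordSymm φ) p :=
  (contMDiffAt_tcoordSymm hφ hp).mdifferentiableAt (by simp)

theorem hasMFDerivAt_tcoord (hφ : φ ∈ IsManifold.maximalAtlas (𝓡 n) ∞ M)
    {v : TangentBundle (𝓡 n) M} (hv : v ∈ chartDom φ) :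
    HasMFDerivAt (𝓡 n).tangent 𝓘(ℝ, Coord n × Coord n) (tcoord φ) v (dtcoord φ v) :=
  (tcoord_mdifferentiableAt hφ hv).hasMFDerivAt

/-- The differential of the inverse of the induced coordinates. -/
def dtcoordSymm (φ : OpenPartialHomeomorph M (Coord n)) (v : TangentBundle (𝓡 n) M) :
    Coord n × Coord n →L[ℝ] TangentSpace (𝓡 n).tangent v :=
  mfderiv 𝓘(ℝ, Coord n × Coord n) (𝓡 n).tangent (tcoordSymm φ) (tcoord φ v)

theorem hasMFDerivAt_tcoordSymm (hφ : φ ∈ IsManifold.maximalAtlas (𝓡 n) ∞ M)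
    {v : TangentBundle (𝓡 n) M} (hv : v ∈ chartDom φ) :
    HasMFDerivAt 𝓘(ℝ, Coord n × Coord n) (𝓡 n).tangent (tcoordSymm φ) (tcoord φ v)
      (dtcoordSymm φ v) :=
  (tcoordSymm_mdifferentiableAt hφ (φ.map_source hv)).hasMFDerivAt

theorem dtcoordSymm_dtcoord (hφ : φ ∈ IsManifold.maximalAtlas (𝓡 n) ∞ M)
    {v : TangentBundle (𝓡 n) M} (hv : v ∈ chartDom φ) (X : TangentSpace (𝓡 n).tangent v) :
    dtcoordSymm φ v (dtcoord φ v X) = X := by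
  have h := (hasMFDerivAt_tcoordSymm hφ hv).comp v (hasMFDerivAt_tcoord hφ hv)
  have h2 : HasMFDerivAt (𝓡 n).tangent (𝓡 n).tangent (tcoordSymm φ ∘ tcoord φ) v
      (ContinuousLinearMap.id ℝ (TangentSpace (𝓡 n).tangent v)) := by
    refine (hasMFDerivAt_id v).congr_of_eventuallyEq ?_
    filter_upwards [(isOpen_chartDom φ).mem_nhds hv] with z hz using tcoordSymm_tcoord hφ hz
  exact congrArg (fun f : TangentSpace (𝓡 n).tangent v →L[ℝ] TangentSpace (𝓡 n).tangent v => f X)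
    (hasMFDerivAt_unique h h2)

theorem dtcoord_dtcoordSymm (hφ : φ ∈ IsManifold.maximalAtlas (𝓡 n) ∞ M)
    {v : TangentBundle (𝓡 n) M} (hv : v ∈ chartDom φ) (p : Coord n × Coord n) :
    dtcoord φ v (dtcoordSymm φ v p) = p := by
  have h0 := hasMFDerivAt_tcoord hφ hv
  rw [← tcoordSymm_tcoord hφ hv] at h0
  have h := h0.comp (tcoord φ v) (hasMFDerivAt_tcoordSymm hφ hv)
  have h2 : HasMFDerivAt 𝓘(ℝ, Coord n × Coord n) 𝓘(ℝ, Coord n × Coord n)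
      (tcoord φ ∘ tcoordSymm φ) (tcoord φ v) (ContinuousLinearMap.id ℝ (Coord n × Coord n)) := by
    refine (hasMFDerivAt_id (tcoord φ v)).congr_of_eventuallyEq ?_
    filter_upwards [(isOpen_target_prod φ).mem_nhds (x := tcoord φ v) ⟨φ.map_source hv, trivial⟩]
      with z hz using tcoord_tcoordSymm hφ hz.1
  have h3 := hasMFDerivAt_unique h h2
  rw [tcoordSymm_tcoord hφ hv] at h3
  exact congrArg (fun f : Coord n × Coord n →L[ℝ] Coord n × Coord n => f p) h3

/-- The differential of the induced coordinates as a linear equivalence. -/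
def dtcoordEquiv (hφ : φ ∈ IsManifold.maximalAtlas (𝓡 n) ∞ M)
    {v : TangentBundle (𝓡 n) M} (hv : v ∈ chartDom φ) :
    TangentSpace (𝓡 n).tangent v ≃L[ℝ] Coord n × Coord n :=
  ContinuousLinearEquiv.equivOfInverse (dtcoord φ v) (dtcoordSymm φ v)
    (dtcoordSymm_dtcoord hφ hv) (dtcoord_dtcoordSymm hφ hv)

/-- The derivative of a function on `TM` in the induced coordinates. -/
theorem mvfderiv_eq_fderiv (hφ : φ ∈ IsManifold.maximalAtlas (𝓡 n) ∞ M)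
    {v : TangentBundle (𝓡 n) M} (hv : v ∈ chartDom φ) {F : Type*} [NormedAddCommGroup F]
    [NormedSpace ℝ F] {f : TangentBundle (𝓡 n) M → F}
    (hf : DifferentiableAt ℝ (fun p => f (tcoordSymm φ p)) (tcoord φ v))
    (X : TangentSpace (𝓡 n).tangent v) :
    mvfderiv (𝓡 n).tangent f v X =
      fderiv ℝ (fun p => f (tcoordSymm φ p)) (tcoord φ v) (dtcoord φ v X) := by
  have h := (hf.hasFDerivAt.hasMFDerivAt).comp v (hasMFDerivAt_tcoord hφ hv)
  have h2 : HasMFDerivAt (𝓡 n).tangent 𝓘(ℝ, F) f v _ := h.congr_of_eventuallyEq (by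
    filter_upwards [(isOpen_chartDom φ).mem_nhds hv] with z hz
    simp only [Function.comp, tcoordSymm_tcoord hφ hz])
  rw [mvfderiv, h2.mfderiv]
  rfl

theorem mdifferentiableAt_iff_coord (hφ : φ ∈ IsManifold.maximalAtlas (𝓡 n) ∞ M)
    {v : TangentBundle (𝓡 n) M} (hv : v ∈ chartDom φ) {F : Type*} [NormedAddCommGroup F]
    [NormedSpace ℝ F] {f : TangentBundle (𝓡 n) M → F} :
    MDifferentiableAt (𝓡 n).tangent 𝓘(ℝ, F) f v ↔
      DifferentiableAt ℝ (fun p => f (tcoordSymm φ p)) (tcoord φ v) := by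
  constructor
  · intro h
    rw [← tcoordSymm_tcoord hφ hv] at h
    exact (h.comp (tcoord φ v)
      (tcoordSymm_mdifferentiableAt hφ (φ.map_source hv))).differentiableAt
  · intro h
    refine (h.mdifferentiableAt.comp v (tcoord_mdifferentiableAt hφ hv)).congr_of_eventuallyEq ?_
    filter_upwards [(isOpen_chartDom φ).mem_nhds hv] with z hz
    simp only [Function.comp, tcoordSymm_tcoord hφ hz]

theorem contMDiffAt_iff_coord (hφ : φ ∈ IsManifold.maximalAtlas (𝓡 n) ∞ M)
    {v : TangentBundle (𝓡 n) M} (hv : v ∈ chartDom φ) {F : Type*} [NormedAddCommGroup F]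
    [NormedSpace ℝ F] {f : TangentBundle (𝓡 n) M → F} :
    ContMDiffAt (𝓡 n).tangent 𝓘(ℝ, F) ∞ f v ↔
      ContDiffAt ℝ ∞ (fun p => f (tcoordSymm φ p)) (tcoord φ v) := by
  constructor
  · intro h
    rw [← tcoordSymm_tcoord hφ hv] at h
    exact (h.comp (tcoord φ v) (contMDiffAt_tcoordSymm hφ (φ.map_source hv))).contDiffAt
  · intro h
    refine (h.contMDiffAt.comp v (contMDiffAt_tcoord hφ hv)).congr_of_eventuallyEq ?_
    filter_upwards [(isOpen_chartDom φ).mem_nhds hv] with z hz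
    simp only [Function.comp, tcoordSymm_tcoord hφ hz]

theorem comp_omega (hφ : φ ∈ IsManifold.maximalAtlas (𝓡 n) ∞ M)
    {v : TangentBundle (𝓡 n) M} (hv : v ∈ chartDom φ) (X : TangentSpace (𝓡 n).tangent v) :
    comp φ v (omega v X) = (dtcoord φ v X).1 := by
  have h1 := ((chart_mdifferentiable hφ).mdifferentiableAt hv).hasMFDerivAt.comp v
    (((proj n M).contMDiff.mdifferentiableAt (by simp)).hasMFDerivAt)
  have h2 := (hasFDerivAt_fst (𝕜 := ℝ) (p := tcoord φ v)).hasMFDerivAt.comp v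
    (hasMFDerivAt_tcoord hφ hv)
  exact congrArg (fun f : TangentSpace (𝓡 n).tangent v →L[ℝ] Coord n => f X)
    (hasMFDerivAt_unique h1 h2)

/-- The curve that defines the vertical lift is an affine line in the induced coordinates, with
constant base point. -/
theorem dtcoord_verticalLift (hφ : φ ∈ IsManifold.maximalAtlas (𝓡 n) ∞ M)
    {v : TangentBundle (𝓡 n) M} (hv : v ∈ chartDom φ) (u : PB n M v) :
    dtcoord φ v (verticalLift v u) = (0, comp φ v u) := by
  let ℓ : ℝ → Coord n × Coord n := fun t => (φ v.proj, comp φ v (liouville v) + t • comp φ v u)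
  have hℓ0 : ℓ 0 = tcoord φ v := by simp [ℓ, tcoord]
  let A : ℝ →L[ℝ] Coord n × Coord n :=
    (0 : ℝ →L[ℝ] Coord n).prod (ContinuousLinearMap.toSpanSingleton ℝ (comp φ v u))
  have hℓ : HasMFDerivAt 𝓘(ℝ, ℝ) 𝓘(ℝ, Coord n × Coord n) ℓ 0 A := by
    apply HasFDerivAt.hasMFDerivAt
    refine (hasFDerivAt_const (φ v.proj) (0 : ℝ)).prodMk ?_
    have h : HasDerivAt (fun t : ℝ => comp φ v (liouville v) + t • comp φ v u) (comp φ v u) 0 := by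
      simpa using ((hasDerivAt_id (0 : ℝ)).smul_const (comp φ v u)).const_add (comp φ v (liouville v))
    exact h.hasFDerivAt
  have h1 := hasMFDerivAt_tcoordSymm hφ hv
  rw [← hℓ0] at h1
  have h2 := h1.comp (0 : ℝ) hℓ
  have h3 : (fun t : ℝ => (⟨v.proj, (v.2 + t • (show TangentSpace (𝓡 n) v.proj from u) :
      TangentSpace (𝓡 n) v.proj)⟩ : TangentBundle (𝓡 n) M)) = tcoordSymm φ ∘ ℓ := by
    funext t
    refine (lift_eq_tcoordSymm hφ hv _).trans ?_
    simp only [Function.comp, ℓ]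
    congr 2
    simp only [← compL_apply]
    exact (map_add (compL φ v) (v.2 : PB n M v) (t • u)).trans 
      (congrArg _ ((compL φ v).map_smul t u))
  have h4 : verticalLift v u = dtcoordSymm φ v ((0, comp φ v u) : Coord n × Coord n) := by
    rw [← h3] at h2
    rw [verticalLift, h2.mfderiv]
    have h5 : A 1 = (0, comp φ v u) := by simp [A]
    exact congrArg (dtcoordSymm φ v) h5
  rw [h4, dtcoord_dtcoordSymm hφ hv]

end Chart

/-! ### Calculus of smooth functions over the domain of a chart -/

section Calculus

variable {φ : OpenPartialHomeomorph M (Coord n)}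

/-- The derivative of a function on `TM` along a constant vector in the induced coordinates. -/
def pd (φ : OpenPartialHomeomorph M (Coord n)) (z : Coord n × Coord n)
    (f : TangentBundle (𝓡 n) M → ℝ) (v : TangentBundle (𝓡 n) M) : ℝ :=
  fderiv ℝ (fun p => f (tcoordSymm φ p)) (tcoord φ v) z

theorem pdx_eq_pd (c : Fin n) (f : TangentBundle (𝓡 n) M → ℝ) :
    pdx φ c f = pd φ (EuclideanSpace.single c (1 : ℝ), 0) f := rfl

theorem pdy_eq_pd (c : Fin n) (f : TangentBundle (𝓡 n) M → ℝ) :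
    pdy φ c f = pd φ (0, EuclideanSpace.single c (1 : ℝ)) f := rfl

/-- The part of the slit tangent bundle over the domain of a chart. -/
def slitDom (φ : OpenPartialHomeomorph M (Coord n)) : Set (TangentBundle (𝓡 n) M) :=
  Slit n M ∩ chartDom φ

theorem isOpen_slitDom (φ : OpenPartialHomeomorph M (Coord n)) : IsOpen (slitDom φ) :=
  (isOpen_slit n M).inter (isOpen_chartDom φ)

/-- Smooth functions on the slit tangent bundle over the domain of a chart. -/
def SmoothOver (φ : OpenPartialHomeomorph M (Coord n)) (f : TangentBundle (𝓡 n) M → ℝ) : Prop :=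
  ∀ v ∈ slitDom φ, ContDiffAt ℝ ∞ (fun p => f (tcoordSymm φ p)) (tcoord φ v)

/-- Transports identities that hold over the slit chart domain to neighbourhoods in coordinate
space, where they can be differentiated. -/
theorem eventually_tcoordSymm_mem (hφ : φ ∈ IsManifold.maximalAtlas (𝓡 n) ∞ M)
    {v : TangentBundle (𝓡 n) M} (hv : v ∈ slitDom φ) :
    ∀ᶠ p in 𝓝 (tcoord φ v), tcoordSymm φ p ∈ slitDom φ ∧ tcoord φ (tcoordSymm φ p) = p := by
  have h1 : ContinuousAt (tcoordSymm φ) (tcoord φ v) :=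
    (contMDiffAt_tcoordSymm hφ (φ.map_source hv.2)).continuousAt
  have h2 : slitDom φ ∈ 𝓝 (tcoordSymm φ (tcoord φ v)) := by
    rw [tcoordSymm_tcoord hφ hv.2]
    exact (isOpen_slitDom φ).mem_nhds hv
  filter_upwards [h1 h2, (isOpen_target_prod φ).mem_nhds (x := tcoord φ v)
    ⟨φ.map_source hv.2, trivial⟩] with p hp hp'
  exact ⟨hp, tcoord_tcoordSymm hφ hp'.1⟩

/-! ### Closure properties of smooth functions over a chart. -/

namespace SmoothOver

variable {f g : TangentBundle (𝓡 n) M → ℝ}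

theorem differentiableAt (hf : SmoothOver φ f) {v : TangentBundle (𝓡 n) M} (hv : v ∈ slitDom φ) :
    DifferentiableAt ℝ (fun p => f (tcoordSymm φ p)) (tcoord φ v) :=
  (hf v hv).differentiableAt (by simp)

theorem congr (hφ : φ ∈ IsManifold.maximalAtlas (𝓡 n) ∞ M) (hf : SmoothOver φ f)
    (h : ∀ v ∈ slitDom φ, g v = f v) : SmoothOver φ g := fun v hv =>
  (hf v hv).congr_of_eventuallyEq <| by
    filter_upwards [eventually_tcoordSymm_mem hφ hv] with p hp using h _ hp.1

theorem const (c : ℝ) : SmoothOver φ fun _ => c := fun _ _ => contDiffAt_const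

theorem add (hf : SmoothOver φ f) (hg : SmoothOver φ g) : SmoothOver φ fun v => f v + g v :=
  fun v hv => (hf v hv).add (hg v hv)

theorem sub (hf : SmoothOver φ f) (hg : SmoothOver φ g) : SmoothOver φ fun v => f v - g v :=
  fun v hv => (hf v hv).sub (hg v hv)

theorem mul (hf : SmoothOver φ f) (hg : SmoothOver φ g) : SmoothOver φ fun v => f v * g v :=
  fun v hv => (hf v hv).mul (hg v hv)

theorem inv (hf : SmoothOver φ f) (h : ∀ v ∈ slitDom φ, f v ≠ 0)
    (hφ : φ ∈ IsManifold.maximalAtlas (𝓡 n) ∞ M) : SmoothOver φ fun v => (f v)⁻¹ :=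
  fun v hv => (hf v hv).inv (by rw [tcoordSymm_tcoord hφ hv.2]; exact h v hv)

theorem sum {ι : Type*} {s : Finset ι} {f : ι → TangentBundle (𝓡 n) M → ℝ}
    (hf : ∀ i ∈ s, SmoothOver φ (f i)) : SmoothOver φ fun v => ∑ i ∈ s, f i v :=
  fun v hv => ContDiffAt.sum fun i hi => hf i hi v hv

theorem prod {ι : Type*} {s : Finset ι} {f : ι → TangentBundle (𝓡 n) M → ℝ}
    (hf : ∀ i ∈ s, SmoothOver φ (f i)) : SmoothOver φ fun v => ∏ i ∈ s, f i v :=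
  fun v hv => contDiffAt_prod fun i hi => hf i hi v hv

theorem det {ι : Type*} [Fintype ι] [DecidableEq ι]
    {A : TangentBundle (𝓡 n) M → Matrix ι ι ℝ} (hA : ∀ i j, SmoothOver φ fun v => A v i j) :
    SmoothOver φ fun v => (A v).det := by
  simp only [Matrix.det_apply']
  exact sum fun σ _ => (const _).mul (prod fun i _ => hA _ _)

theorem matrix_inv {ι : Type*} [Fintype ι] [DecidableEq ι]
    (hφ : φ ∈ IsManifold.maximalAtlas (𝓡 n) ∞ M)
    {A : TangentBundle (𝓡 n) M → Matrix ι ι ℝ} (hA : ∀ i j, SmoothOver φ fun v => A v i j)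
    (h : ∀ v ∈ slitDom φ, (A v).det ≠ 0) (i j : ι) : SmoothOver φ fun v => (A v)⁻¹ i j := by
  simp only [Matrix.inv_def, Matrix.smul_apply, Ring.inverse_eq_inv', smul_eq_mul,
    Matrix.adjugate_apply]
  refine ((det hA).inv h hφ).mul (det fun k l => ?_)
  by_cases hk : k = j
  · subst hk
    simp only [Matrix.updateRow_self]
    exact const _
  · simp only [Matrix.updateRow_ne hk]
    exact hA k l

theorem pd (hφ : φ ∈ IsManifold.maximalAtlas (𝓡 n) ∞ M) (hf : SmoothOver φ f)
    (z : Coord n × Coord n) : SmoothOver φ (pd φ z f) := fun v hv => by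
  have h := ((hf v hv).fderiv_right (m := ∞) (by simp)).clm_apply (contDiffAt_const (c := z))
  refine h.congr_of_eventuallyEq ?_
  filter_upwards [eventually_tcoordSymm_mem hφ hv] with p hp
  simp only [Finsler.pd, hp.2]

theorem pdx (hφ : φ ∈ IsManifold.maximalAtlas (𝓡 n) ∞ M) (hf : SmoothOver φ f) (c : Fin n) :
    SmoothOver φ (pdx φ c f) := hf.pd hφ _

theorem pdy (hφ : φ ∈ IsManifold.maximalAtlas (𝓡 n) ∞ M) (hf : SmoothOver φ f) (c : Fin n) :
    SmoothOver φ (pdy φ c f) := hf.pd hφ _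

theorem contMDiffAt (hφ : φ ∈ IsManifold.maximalAtlas (𝓡 n) ∞ M) (hf : SmoothOver φ f)
    {v : TangentBundle (𝓡 n) M} (hv : v ∈ slitDom φ) :
    ContMDiffAt (𝓡 n).tangent 𝓘(ℝ, ℝ) ∞ f v :=
  (contMDiffAt_iff_coord hφ hv.2).2 (hf v hv)

theorem of_contMDiffAt (hφ : φ ∈ IsManifold.maximalAtlas (𝓡 n) ∞ M)
    (hf : ∀ v ∈ slitDom φ, ContMDiffAt (𝓡 n).tangent 𝓘(ℝ, ℝ) ∞ f v) : SmoothOver φ f :=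
  fun v hv => (contMDiffAt_iff_coord hφ hv.2).1 (hf v hv)

end SmoothOver

/-! ### Rules of differentiation in the induced coordinates. -/

variable {f g : TangentBundle (𝓡 n) M → ℝ} {v : TangentBundle (𝓡 n) M}

theorem mvfderiv_eq_pd (hφ : φ ∈ IsManifold.maximalAtlas (𝓡 n) ∞ M) (hf : SmoothOver φ f)
    (hv : v ∈ slitDom φ) (X : TangentSpace (𝓡 n).tangent v) :
    mvfderiv (𝓡 n).tangent f v X = pd φ (dtcoord φ v X) f v :=
  mvfderiv_eq_fderiv hφ hv.2 (hf.differentiableAt hv) X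

/-- The device by which identities valid over the whole slit chart domain, such as Euler's, are
differentiated below. -/
theorem pd_congr (hφ : φ ∈ IsManifold.maximalAtlas (𝓡 n) ∞ M) (h : ∀ v ∈ slitDom φ, f v = g v)
    (hv : v ∈ slitDom φ) (z : Coord n × Coord n) : pd φ z f v = pd φ z g v := by
  have h1 : (fun p => f (tcoordSymm φ p)) =ᶠ[𝓝 (tcoord φ v)] fun p => g (tcoordSymm φ p) := by
    filter_upwards [eventually_tcoordSymm_mem hφ hv] with p hp using h _ hp.1
  rw [pd, pd, h1.fderiv_eq]

theorem pd_const (c : ℝ) (z : Coord n × Coord n) : pd φ z (fun _ => c) v = 0 := by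
  simp [pd]

theorem pd_add (hf : SmoothOver φ f) (hg : SmoothOver φ g) (hv : v ∈ slitDom φ)
    (z : Coord n × Coord n) : pd φ z (fun v => f v + g v) v = pd φ z f v + pd φ z g v := by
  simp only [pd]
  rw [fderiv_fun_add (hf.differentiableAt hv) (hg.differentiableAt hv)]
  rfl

theorem pd_sub (hf : SmoothOver φ f) (hg : SmoothOver φ g) (hv : v ∈ slitDom φ)
    (z : Coord n × Coord n) : pd φ z (fun v => f v - g v) v = pd φ z f v - pd φ z g v := by
  simp only [pd]
  rw [fderiv_fun_sub (hf.differentiableAt hv) (hg.differentiableAt hv)]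
  rfl

theorem pd_mul (hφ : φ ∈ IsManifold.maximalAtlas (𝓡 n) ∞ M) (hf : SmoothOver φ f)
    (hg : SmoothOver φ g) (hv : v ∈ slitDom φ) (z : Coord n × Coord n) :
    pd φ z (fun v => f v * g v) v = pd φ z f v * g v + f v * pd φ z g v := by
  simp only [pd]
  rw [fderiv_fun_mul (hf.differentiableAt hv) (hg.differentiableAt hv)]
  simp [tcoordSymm_tcoord hφ hv.2]
  ring

theorem pd_const_mul (hf : SmoothOver φ f) (hv : v ∈ slitDom φ) (c : ℝ)
    (z : Coord n × Coord n) : pd φ z (fun v => c * f v) v = c * pd φ z f v := by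
  simp only [pd]
  rw [fderiv_const_mul (hf.differentiableAt hv)]
  rfl

theorem pd_sum {ι : Type*} {s : Finset ι} {f : ι → TangentBundle (𝓡 n) M → ℝ}
    (hf : ∀ i ∈ s, SmoothOver φ (f i)) (hv : v ∈ slitDom φ) (z : Coord n × Coord n) :
    pd φ z (fun v => ∑ i ∈ s, f i v) v = ∑ i ∈ s, pd φ z (f i) v := by
  simp only [pd]
  rw [fderiv_fun_sum fun i hi => (hf i hi).differentiableAt hv]
  simp

theorem pd_comm (hφ : φ ∈ IsManifold.maximalAtlas (𝓡 n) ∞ M) (hf : SmoothOver φ f)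
    (hv : v ∈ slitDom φ) (z w : Coord n × Coord n) :
    pd φ z (pd φ w f) v = pd φ w (pd φ z f) v := by
  have key : ∀ z w : Coord n × Coord n, pd φ z (pd φ w f) v =
      fderiv ℝ (fderiv ℝ fun p => f (tcoordSymm φ p)) (tcoord φ v) z w := by
    intro z w
    -- Near the point the inner derivative is taken at `p` itself, so the iterated derivative is a
    -- value of the second Fréchet derivative, which is symmetric.
    have h1 : (fun p => pd φ w f (tcoordSymm φ p)) =ᶠ[𝓝 (tcoord φ v)]
        fun p => fderiv ℝ (fun p => f (tcoordSymm φ p)) p w := by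
      filter_upwards [eventually_tcoordSymm_mem hφ hv] with p hp
      simp only [pd, hp.2]
    rw [pd, h1.fderiv_eq, fderiv_clm_apply
      (((hf v hv).fderiv_right (m := ∞) (by simp)).differentiableAt (by simp))
      (differentiableAt_const _)]
    simp
  rw [key, key]
  exact ((hf v hv).isSymmSndFDerivAt (by
    simpa using ENat.LEInfty.out (m := 2))).eq z w

theorem pd_add_vec (z w : Coord n × Coord n) : pd φ (z + w) f v = pd φ z f v + pd φ w f v :=
  map_add _ _ _

theorem pd_smul_vec (c : ℝ) (z : Coord n × Coord n) : pd φ (c • z) f v = c * pd φ z f v :=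
  map_smul _ _ _

theorem pd_sum_vec {ι : Type*} (s : Finset ι) (z : ι → Coord n × Coord n) :
    pd φ (∑ i ∈ s, z i) f v = ∑ i ∈ s, pd φ (z i) f v :=
  map_sum _ _ _

theorem prod_eq_sum (z : Coord n × Coord n) :
    z = ∑ c, z.1 c • ((EuclideanSpace.single c (1 : ℝ), 0) : Coord n × Coord n) +
      ∑ c, z.2 c • ((0, EuclideanSpace.single c (1 : ℝ)) : Coord n × Coord n) := by
  ext a <;> simp [Prod.fst_sum, Prod.snd_sum, Pi.single_apply]

theorem pd_eq_sum (z : Coord n × Coord n) :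
    pd φ z f v = ∑ c, z.1 c * pdx φ c f v + ∑ c, z.2 c * pdy φ c f v := by
  conv_lhs => rw [prod_eq_sum z]
  simp only [pd_add_vec, pd_sum_vec, pd_smul_vec, pdx_eq_pd, pdy_eq_pd]

/-- The fibre coordinates `y^a`. -/
def ycoord (φ : OpenPartialHomeomorph M (Coord n)) (a : Fin n) (v : TangentBundle (𝓡 n) M) : ℝ :=
  comp φ v (liouville v) a

theorem SmoothOver.ycoord (hφ : φ ∈ IsManifold.maximalAtlas (𝓡 n) ∞ M) (a : Fin n) :
    SmoothOver φ (ycoord φ a) := fun v hv => by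
  have h : ContDiffAt ℝ ∞ (fun p : Coord n × Coord n => p.2 a) (tcoord φ v) := by fun_prop
  refine h.congr_of_eventuallyEq ?_
  filter_upwards [eventually_tcoordSymm_mem hφ hv] with p hp
  exact congrArg (fun q : Coord n × Coord n => q.2 a) hp.2

theorem pd_ycoord (hφ : φ ∈ IsManifold.maximalAtlas (𝓡 n) ∞ M) (hv : v ∈ slitDom φ) (a : Fin n)
    (z : Coord n × Coord n) : pd φ z (ycoord φ a) v = z.2 a := by
  have h1 : (fun p => ycoord φ a (tcoordSymm φ p)) =ᶠ[𝓝 (tcoord φ v)]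
      fun p : Coord n × Coord n => p.2 a := by
    filter_upwards [eventually_tcoordSymm_mem hφ hv] with p hp
    exact congrArg (fun q : Coord n × Coord n => q.2 a) hp.2
  rw [pd, h1.fderiv_eq]
  have : HasFDerivAt (fun p : Coord n × Coord n => p.2 a)
      ((EuclideanSpace.proj a : Coord n →L[ℝ] ℝ) ∘L ContinuousLinearMap.snd ℝ (Coord n) (Coord n))
      (tcoord φ v) :=
    ((EuclideanSpace.proj a : Coord n →L[ℝ] ℝ) ∘L
      ContinuousLinearMap.snd ℝ (Coord n) (Coord n)).hasFDerivAt
  rw [this.fderiv]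
  rfl

end Calculus

/-! ### Connections in induced coordinates -/

section Connection

variable {φ : OpenPartialHomeomorph M (Coord n)} {v : TangentBundle (𝓡 n) M}

theorem comp_smul (c : ℝ) (u : PB n M v) : comp φ v (c • u) = c • comp φ v u :=
  (compL φ v).map_smul c u

theorem comp_add (u w : PB n M v) : comp φ v (u + w) = comp φ v u + comp φ v w :=
  (compL φ v).map_add u w

theorem comp_sub (u w : PB n M v) : comp φ v (u - w) = comp φ v u - comp φ v w :=
  (compL φ v).map_sub u w

theorem comp_zero : comp φ v (0 : PB n M v) = 0 := (compL φ v).map_zero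

theorem cov_sum (D : FinslerConnection n M) (hv : v ∈ Slit n M) {ι : Type*} (s : Finset ι)
    {σ : ι → Π v, PB n M v} (hσ : ∀ i ∈ s, SecDiffAt (σ i) v) :
    D.toFun (fun z => ∑ i ∈ s, σ i z) v = ∑ i ∈ s, D.toFun (σ i) v := by
  classical
  induction s using Finset.induction_on with
  | empty =>
    simp only [Finset.sum_empty]
    exact D.isCovariantDerivativeOn.zero hv
  | insert a s ha ih =>
    have hs : ∀ i ∈ s, SecDiffAt (σ i) v := fun i hi => hσ i (Finset.mem_insert_of_mem hi)
    simp only [Finset.sum_insert ha, ← ih hs]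
    exact D.isCovariantDerivativeOn.add (hσ a (Finset.mem_insert_self a s))
      (MDifferentiableAt.sum_section hs) hv

theorem mdifferentiableAt_comp (hφ : φ ∈ IsManifold.maximalAtlas (𝓡 n) ∞ M)
    (hv : v ∈ chartDom φ) {σ : Π v, PB n M v} (hσ : SecDiffAt σ v) (a : Fin n) :
    MDifferentiableAt (𝓡 n).tangent 𝓘(ℝ, ℝ) (fun z => comp φ z (σ z) a) v :=
  (EuclideanSpace.proj a : Coord n →L[ℝ] ℝ).differentiableAt.mdifferentiableAt.comp v
    ((secDiffAt_iff_comp hφ hv).1 hσ)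

/-- The expansion of σ in the frame holds only over the chart domain; locality of ∇ allows the
replacement, and the Leibniz rule does the rest. -/
theorem cov_eq_sum (D : FinslerConnection n M) (hφ : φ ∈ IsManifold.maximalAtlas (𝓡 n) ∞ M)
    (hv : v ∈ slitDom φ) {σ : Π v, PB n M v} (hσ : SecDiffAt σ v)
    (X : TangentSpace (𝓡 n).tangent v) :
    D.toFun σ v X = ∑ b, (comp φ v (σ v) b • D.toFun (frame φ b) v X +
      mvfderiv (𝓡 n).tangent (fun z => comp φ z (σ z) b) v X • frame φ b v) := by
  have hf : ∀ b, SecDiffAt (frame φ b) v := secDiffAt_frame hφ hv.2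
  have hc : ∀ b, MDifferentiableAt (𝓡 n).tangent 𝓘(ℝ, ℝ) (fun z => comp φ z (σ z) b) v :=
    mdifferentiableAt_comp hφ hv.2 hσ
  have hs : ∀ b ∈ Finset.univ,
      SecDiffAt ((fun z => comp φ z (σ z) b : TangentBundle (𝓡 n) M → ℝ) • frame φ b) v :=
    fun b _ => (hc b).smul_section (hf b)
  have h1 : D.toFun σ v = D.toFun (fun z => ∑ b,
      ((fun z => comp φ z (σ z) b : TangentBundle (𝓡 n) M → ℝ) • frame φ b) z) v := by
    refine D.isCovariantDerivativeOn.congr_of_eventuallyEq hσ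
      (MDifferentiableAt.sum_section hs) ((isOpen_slit n M).mem_nhds hv.1) ?_
    filter_upwards [(isOpen_chartDom φ).mem_nhds hv.2] with z hz
    exact sum_comp_smul_frame hφ hz (σ z)
  rw [h1, cov_sum D hv.1 _ hs, sum_apply]
  refine Finset.sum_congr rfl fun b _ => ?_
  rw [D.isCovariantDerivativeOn.leibniz (hf b) (hc b) hv.1]
  rfl

/-- The components of the covariant derivative. -/
theorem comp_cov (D : FinslerConnection n M) (hφ : φ ∈ IsManifold.maximalAtlas (𝓡 n) ∞ M)
    (hv : v ∈ slitDom φ) {σ : Π v, PB n M v} (hσ : SecDiffAt σ v)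
    (X : TangentSpace (𝓡 n).tangent v) (a : Fin n) :
    comp φ v (D.toFun σ v X) a = mvfderiv (𝓡 n).tangent (fun z => comp φ z (σ z) a) v X +
      ∑ b, connForm D φ v a b X * comp φ v (σ v) b := by
  rw [cov_eq_sum D hφ hv hσ X, ← compL_apply, map_sum]
  simp only [map_add, map_smul, compL_apply, comp_frame hφ hv.2, WithLp.ofLp_sum, Finset.sum_apply,
    PiLp.add_apply, PiLp.smul_apply, smul_eq_mul, Finset.sum_add_distrib, connForm]
  rw [add_comm]
  congr 1
  · simp
  · exact Finset.sum_congr rfl fun b _ => mul_comm _ _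

theorem comp_omegaBar (D : FinslerConnection n M) (hφ : φ ∈ IsManifold.maximalAtlas (𝓡 n) ∞ M)
    (hv : v ∈ slitDom φ) (X : TangentSpace (𝓡 n).tangent v) (a : Fin n) :
    comp φ v (omegaBar D v X) a =
      (dtcoord φ v X).2 a + ∑ b, connForm D φ v a b X * ycoord φ b v := by
  rw [omegaBar, comp_cov D hφ hv (secDiffAt_liouville v)]
  congr 1
  exact (mvfderiv_eq_pd hφ (SmoothOver.ycoord hφ a) hv X).trans (pd_ycoord hφ hv a _)

/-- The components of the metric. -/
def gcomp (g : FinslerMetric n M) (φ : OpenPartialHomeomorph M (Coord n)) (a b : Fin n)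
    (v : TangentBundle (𝓡 n) M) : ℝ :=
  g.toFun v (frame φ a v) (frame φ b v)

theorem SmoothOver.gcomp (g : FinslerMetric n M) (hφ : φ ∈ IsManifold.maximalAtlas (𝓡 n) ∞ M)
    (a b : Fin n) : SmoothOver φ (gcomp g φ a b) := by
  refine .of_contMDiffAt hφ fun v hv => ?_
  have hg := (g.contMDiffOn v hv.1).contMDiffAt ((isOpen_slit n M).mem_nhds hv.1)
  have := ContMDiffAt.clm_bundle_apply₂ (F₁ := Coord n) (F₂ := Coord n) (F₃ := ℝ)
    (E₁ := PB n M) (E₂ := PB n M) (E₃ := Bundle.Trivial _ ℝ) hg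
    (contMDiffAt_frame hφ hv.2 a) (contMDiffAt_frame hφ hv.2 b)
  rw [contMDiffAt_totalSpace] at this
  exact this.2

theorem metric_eq_sum (g : FinslerMetric n M) (hφ : φ ∈ IsManifold.maximalAtlas (𝓡 n) ∞ M)
    (hv : v ∈ chartDom φ) (u w : PB n M v) :
    g.toFun v u w = ∑ a, ∑ b, gcomp g φ a b v * comp φ v u a * comp φ v w b := by
  conv_lhs => rw [sum_comp_smul_frame hφ hv u, sum_comp_smul_frame hφ hv w]
  simp only [map_sum, map_smul, sum_apply, smul_apply,
    smul_eq_mul, gcomp, Finset.mul_sum]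
  rw [Finset.sum_comm]
  exact Finset.sum_congr rfl fun a _ => Finset.sum_congr rfl fun b _ => by ring

theorem dMetric_apply (D : FinslerConnection n M) (g : FinslerMetric n M) (hv : v ∈ Slit n M)
    (X : TangentSpace (𝓡 n).tangent v) {σ τ : Π v, PB n M v} (hσ : SecDiffAt σ v)
    (hτ : SecDiffAt τ v) : dMetric D g v X (σ v) (τ v) = dMetricAux D g v X σ τ := by
  rw [dMetric, dif_pos hv]
  exact TensorialAt.mkHom₂_apply _ _ hσ hτ

/-- The connection forms with lowered index. -/
def connLow (D : FinslerConnection n M) (g : FinslerMetric n M)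
    (φ : OpenPartialHomeomorph M (Coord n)) (v : TangentBundle (𝓡 n) M) (a b : Fin n)
    (X : TangentSpace (𝓡 n).tangent v) : ℝ :=
  ∑ d, gcomp g φ a d v * connForm D φ v d b X

theorem metric_frame_cov (D : FinslerConnection n M) (g : FinslerMetric n M)
    (hφ : φ ∈ IsManifold.maximalAtlas (𝓡 n) ∞ M) (hv : v ∈ slitDom φ) (a b : Fin n)
    (X : TangentSpace (𝓡 n).tangent v) :
    g.toFun v (frame φ a v) (D.toFun (frame φ b) v X) = connLow D g φ v a b X := by
  conv_lhs => rw [sum_comp_smul_frame hφ hv.2 (D.toFun (frame φ b) v X)]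
  simp only [map_sum, map_smul, smul_eq_mul, connLow, connForm, gcomp]
  exact Finset.sum_congr rfl fun d _ => mul_comm _ _

theorem dMetric_frame (D : FinslerConnection n M) (g : FinslerMetric n M)
    (hφ : φ ∈ IsManifold.maximalAtlas (𝓡 n) ∞ M) (hv : v ∈ slitDom φ)
    (X : TangentSpace (𝓡 n).tangent v) (a b : Fin n) :
    dMetric D g v X (frame φ a v) (frame φ b v) =
      pd φ (dtcoord φ v X) (gcomp g φ a b) v - connLow D g φ v b a X - connLow D g φ v a b X := by
  rw [dMetric_apply D g hv.1 X (secDiffAt_frame hφ hv.2 a) (secDiffAt_frame hφ hv.2 b),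
    dMetricAux, metric_frame_cov D g hφ hv, g.symm v hv.1, metric_frame_cov D g hφ hv,
    ← mvfderiv_eq_pd hφ (SmoothOver.gcomp g hφ a b) hv X]
  rfl

end Connection

/-! ### The covariant exterior derivative in induced coordinates -/

section ExteriorDerivative

variable {φ : OpenPartialHomeomorph M (Coord n)} {v : TangentBundle (𝓡 n) M}

theorem mdifferentiableAt_dtcoord (hφ : φ ∈ IsManifold.maximalAtlas (𝓡 n) ∞ M)
    (hv : v ∈ chartDom φ) {V : Π v : TangentBundle (𝓡 n) M, TangentSpace (𝓡 n).tangent v}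
    (hV : MDifferentiableAt (𝓡 n).tangent ((𝓡 n).tangent.prod 𝓘(ℝ, Coord n × Coord n))
      (fun z => TotalSpace.mk' (E := TangentSpace (𝓡 n).tangent) (Coord n × Coord n) z (V z)) v) :
    MDifferentiableAt (𝓡 n).tangent 𝓘(ℝ, Coord n × Coord n) (fun z => dtcoord φ z (V z)) v := by
  have h := (contMDiffOn_tcoord hφ).contMDiffOn_tangentMapWithin (m := ∞)
      (by simp) (isOpen_chartDom φ).uniqueMDiffOn
  have h' := (contMDiff_snd_tangentBundle_modelSpace (Coord n × Coord n)
    𝓘(ℝ, Coord n × Coord n) (n := ∞)).comp_contMDiffOn h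
  have h1 : MDifferentiableAt _ 𝓘(ℝ, Coord n × Coord n) _ _ :=
    (h'.contMDiffAt (((isOpen_chartDom φ).preimage
      (FiberBundle.continuous_proj _ _)).mem_nhds (x := ⟨v, V v⟩) hv)).mdifferentiableAt (by simp)
  refine (h1.comp v hV).congr_of_eventuallyEq ?_
  filter_upwards [(isOpen_chartDom φ).mem_nhds hv] with z hz
  simp only [Function.comp, tangentMapWithin, mfderivWithin_of_isOpen (isOpen_chartDom φ) hz]
  rfl

theorem mpullback_tcoordSymm (hφ : φ ∈ IsManifold.maximalAtlas (𝓡 n) ∞ M)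
    (V : Π v : TangentBundle (𝓡 n) M, TangentSpace (𝓡 n).tangent v) {p : Coord n × Coord n}
    (hp : p.1 ∈ φ.target) :
    VectorField.mpullback 𝓘(ℝ, Coord n × Coord n) (𝓡 n).tangent (tcoordSymm φ) V p =
      dtcoord φ (tcoordSymm φ p) (V (tcoordSymm φ p)) := by
  rw [VectorField.mpullback_apply]
  have hv := tcoordSymm_mem (φ := φ) p hp
  have h1 : mfderiv 𝓘(ℝ, Coord n × Coord n) (𝓡 n).tangent (tcoordSymm φ) p =
      dtcoordSymm φ (tcoordSymm φ p) := by
    rw [dtcoordSymm, tcoord_tcoordSymm hφ hp]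
  rw [h1]
  exact congrArg (fun f : TangentSpace (𝓡 n).tangent (tcoordSymm φ p) →L[ℝ] Coord n × Coord n =>
    f (V (tcoordSymm φ p))) (ContinuousLinearMap.inverse_equiv (dtcoordEquiv hφ hv).symm)

theorem mlieBracket_vectorSpace {F : Type*} [NormedAddCommGroup F] [NormedSpace ℝ F]
    (V W : Π x : F, TangentSpace 𝓘(ℝ, F) x) (x : F) :
    VectorField.mlieBracket 𝓘(ℝ, F) V W x =
      fderiv ℝ (W : F → F) x (V x) - fderiv ℝ (V : F → F) x (W x) := by
  rw [← VectorField.mlieBracketWithin_univ, VectorField.mlieBracketWithin_eq_lieBracketWithin]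
  exact congrFun VectorField.lieBracketWithin_univ x

/-- The Lie bracket in induced coordinates. -/
theorem dtcoord_mlieBracket (hφ : φ ∈ IsManifold.maximalAtlas (𝓡 n) ∞ M)
    (hv : v ∈ chartDom φ) {V W : Π v : TangentBundle (𝓡 n) M, TangentSpace (𝓡 n).tangent v}
    (hV : MDifferentiableAt (𝓡 n).tangent ((𝓡 n).tangent.prod 𝓘(ℝ, Coord n × Coord n))
      (fun z => TotalSpace.mk' (E := TangentSpace (𝓡 n).tangent) (Coord n × Coord n) z (V z)) v)
    (hW : MDifferentiableAt (𝓡 n).tangent ((𝓡 n).tangent.prod 𝓘(ℝ, Coord n × Coord n))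
      (fun z => TotalSpace.mk' (E := TangentSpace (𝓡 n).tangent) (Coord n × Coord n) z (W z)) v) :
    dtcoord φ v (VectorField.mlieBracket (𝓡 n).tangent V W v) =
      mvfderiv (𝓡 n).tangent (fun z => dtcoord φ z (W z)) v (V v) -
        mvfderiv (𝓡 n).tangent (fun z => dtcoord φ z (V z)) v (W v) := by
  have hp : (tcoord φ v).1 ∈ φ.target := φ.map_source hv
  have hdV := (mdifferentiableAt_iff_coord hφ hv).1 (mdifferentiableAt_dtcoord hφ hv hV)
  have hdW := (mdifferentiableAt_iff_coord hφ hv).1 (mdifferentiableAt_dtcoord hφ hv hW)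
  rw [mvfderiv_eq_fderiv hφ hv hdW, mvfderiv_eq_fderiv hφ hv hdV]
  have hts := tcoordSymm_tcoord hφ hv
  have : IsManifold (𝓡 n).tangent (minSmoothness ℝ 2) (TangentBundle (𝓡 n) M) := by
    rw [minSmoothness_of_isRCLikeNormedField]
    infer_instance
  -- Pullback by the inverse coordinates commutes with the bracket, which is thereby computed in a
  -- vector space as a commutator of derivatives.
  have key := VectorField.mpullback_mlieBracket (x₀ := tcoord φ v) (f := tcoordSymm φ)
    (I := 𝓘(ℝ, Coord n × Coord n)) (I' := (𝓡 n).tangent) (V := V) (W := W) (n := ∞)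
    (by rw [hts]; exact hV) (by rw [hts]; exact hW) (contMDiffAt_tcoordSymm hφ hp)
    (by simpa using ENat.LEInfty.out (m := 2))
  rw [mpullback_tcoordSymm hφ _ hp, hts] at key
  rw [key]
  have hev : ∀ V : Π v : TangentBundle (𝓡 n) M, TangentSpace (𝓡 n).tangent v,
      VectorField.mpullback 𝓘(ℝ, Coord n × Coord n) (𝓡 n).tangent (tcoordSymm φ) V
        =ᶠ[𝓝 (tcoord φ v)] fun p => dtcoord φ (tcoordSymm φ p) (V (tcoordSymm φ p)) := by
    intro V
    filter_upwards [(isOpen_target_prod φ).mem_nhds (x := tcoord φ v) ⟨hp, trivial⟩] with p hp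
    exact mpullback_tcoordSymm hφ V hp.1
  rw [(hev V).mlieBracket_vectorField_eq (hev W)]
  refine (mlieBracket_vectorSpace _ _ _).trans ?_
  rw [hts]

/-- Here `B` is β written in dx, dy. The product rule splits the derivative of β on an extended
vector into the derivative of `B` and `B` applied to the derivative of the extension. The latter
terms, antisymmetrized, are β of the bracket and cancel, so the chosen extensions leave no trace. -/
theorem comp_covExtDeriv (D : FinslerConnection n M)
    (hφ : φ ∈ IsManifold.maximalAtlas (𝓡 n) ∞ M) (hv : v ∈ slitDom φ)
    {β : Π v : TangentBundle (𝓡 n) M, TangentSpace (𝓡 n).tangent v →L[ℝ] PB n M v}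
    {B : Fin n → Coord n × Coord n → Coord n × Coord n →L[ℝ] ℝ}
    (hβ : ∀ z ∈ slitDom φ, ∀ X a, comp φ z (β z X) a = B a (tcoord φ z) (dtcoord φ z X))
    (hB : ∀ a, DifferentiableAt ℝ (B a) (tcoord φ v)) (X Y : TangentSpace (𝓡 n).tangent v)
    (a : Fin n) :
    comp φ v (covExtDeriv D β v X Y) a =
      fderiv ℝ (B a) (tcoord φ v) (dtcoord φ v X) (dtcoord φ v Y) -
      fderiv ℝ (B a) (tcoord φ v) (dtcoord φ v Y) (dtcoord φ v X) +
      ∑ b, (connForm D φ v a b X * comp φ v (β v Y) b -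
        connForm D φ v a b Y * comp φ v (β v X) b) := by
  have hE : ∀ Y : TangentSpace (𝓡 n).tangent v,
      MDifferentiableAt (𝓡 n).tangent ((𝓡 n).tangent.prod 𝓘(ℝ, Coord n × Coord n))
      (fun z => TotalSpace.mk' (E := TangentSpace (𝓡 n).tangent) (Coord n × Coord n) z
        (FiberBundle.extend (Coord n × Coord n) Y z)) v := fun Y => FiberBundle.mdifferentiableAt_extend _ _ Y
  have hd := fun Y => (mdifferentiableAt_iff_coord hφ hv.2).1
    (mdifferentiableAt_dtcoord hφ hv.2 (hE Y))
  have hs : ∀ Y : TangentSpace (𝓡 n).tangent v, ∀ a, (fun p => comp φ (tcoordSymm φ p)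
      (β (tcoordSymm φ p) (FiberBundle.extend (Coord n × Coord n) Y (tcoordSymm φ p))) a)
      =ᶠ[𝓝 (tcoord φ v)] fun p => B a p (dtcoord φ (tcoordSymm φ p)
        (FiberBundle.extend (Coord n × Coord n) Y (tcoordSymm φ p))) := by
    intro Y a
    filter_upwards [eventually_tcoordSymm_mem hφ hv] with p hp
    rw [hβ _ hp.1, hp.2]
  have hdiff : ∀ Y : TangentSpace (𝓡 n).tangent v, ∀ a, DifferentiableAt ℝ (fun p =>
      comp φ (tcoordSymm φ p) (β (tcoordSymm φ p)
        (FiberBundle.extend (Coord n × Coord n) Y (tcoordSymm φ p))) a) (tcoord φ v) :=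
    fun Y a => ((hB a).clm_apply (hd Y)).congr_of_eventuallyEq (hs Y a)
  have hsec : ∀ Y : TangentSpace (𝓡 n).tangent v,
      SecDiffAt (fun z => β z (FiberBundle.extend (Coord n × Coord n) Y z)) v := by
    intro Y
    rw [secDiffAt_iff_comp hφ hv.2, mdifferentiableAt_iff_coord hφ hv.2]
    exact differentiableAt_euclidean.2 (hdiff Y)
  have hm : ∀ X Y : TangentSpace (𝓡 n).tangent v, mvfderiv (𝓡 n).tangent (fun z => comp φ z
      (β z (FiberBundle.extend (Coord n × Coord n) Y z)) a) v X =
      fderiv ℝ (B a) (tcoord φ v) (dtcoord φ v X) (dtcoord φ v Y) +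
      B a (tcoord φ v) (mvfderiv (𝓡 n).tangent (fun z => dtcoord φ z
        (FiberBundle.extend (Coord n × Coord n) Y z)) v X) := by
    intro X Y
    rw [mvfderiv_eq_fderiv hφ hv.2 (hdiff Y a), (hs Y a).fderiv_eq,
      fderiv_clm_apply (hB a) (hd Y), mvfderiv_eq_fderiv hφ hv.2 (hd Y)]
    rw [add_apply, add_comm, ContinuousLinearMap.comp_apply, ContinuousLinearMap.flip_apply,
      tcoordSymm_tcoord hφ hv.2, FiberBundle.extend_apply_self]
  rw [covExtDeriv, comp_sub, comp_sub, PiLp.sub_apply, PiLp.sub_apply,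
    comp_cov D hφ hv (hsec Y), comp_cov D hφ hv (hsec X), hm, hm, hβ v hv,
    dtcoord_mlieBracket hφ hv.2 (hE X) (hE Y), map_sub]
  simp only [FiberBundle.extend_apply_self, Finset.sum_sub_distrib]
  ring

/-- The form ω = dx has constant coefficients in a chart, so only the connection terms of the
exterior derivative remain. -/
theorem comp_torsion (D : FinslerConnection n M)
    (hφ : φ ∈ IsManifold.maximalAtlas (𝓡 n) ∞ M) (hv : v ∈ slitDom φ)
    (X Y : TangentSpace (𝓡 n).tangent v) (a : Fin n) :
    comp φ v (torsion D v X Y) a = ∑ b, (connForm D φ v a b X * (dtcoord φ v Y).1 b -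
        connForm D φ v a b Y * (dtcoord φ v X).1 b) := by
  rw [torsion, comp_covExtDeriv D hφ hv (B := fun a _ => (EuclideanSpace.proj a : Coord n →L[ℝ] ℝ) ∘L
    ContinuousLinearMap.fst ℝ (Coord n) (Coord n)) (fun z hz X a => ?_) (fun a => by fun_prop)]
  · simp [comp_omega hφ hv.2]
  · rw [comp_omega hφ hz.2]
    rfl

end ExteriorDerivative

/-! ### The canonical torsion in induced coordinates -/

theorem isInvertible_of_nondegenerate {E : Type*} [NormedAddCommGroup E] [NormedSpace ℝ E]
    [FiniteDimensional ℝ E] (B : E →L[ℝ] E →L[ℝ] ℝ) (hB : ∀ u, (∀ w, B u w = 0) → u = 0) :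
    B.IsInvertible := by
  have hinj : Function.Injective B.toLinearMap :=
    (injective_iff_map_eq_zero B.toLinearMap).2 fun u hu => hB u fun w => by
      rw [show B u = 0 from hu]; rfl
  have hdim : Module.finrank ℝ E = Module.finrank ℝ (E →L[ℝ] ℝ) := by
    rw [← (LinearMap.toContinuousLinearMap : (E →ₗ[ℝ] ℝ) ≃ₗ[ℝ] E →L[ℝ] ℝ).finrank_eq]
    exact Subspace.dual_finrank_eq.symm
  exact ⟨(LinearMap.linearEquivOfInjective B.toLinearMap hinj hdim).toContinuousLinearEquiv, by
    ext; rfl⟩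

section Torsion

variable {φ : OpenPartialHomeomorph M (Coord n)} {v : TangentBundle (𝓡 n) M}
  (D : FinslerConnection n M) (g : FinslerMetric n M)

theorem metric_isInvertible (hv : v ∈ Slit n M) : (g.toFun v).IsInvertible :=
  isInvertible_of_nondegenerate (E := Coord n) (g.toFun v) (g.nondegenerate v hv)

/-- `inverse` defaults to zero on maps that are not invertible; non-degeneracy over the slit bundle
is what makes it raise indices. -/
theorem metric_inverse_apply (hv : v ∈ Slit n M) (ℓ : PB n M v →L[ℝ] ℝ) (w : PB n M v) :
    g.toFun v ((g.toFun v).inverse ℓ) w = ℓ w := by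
  rw [(metric_isInvertible g hv).self_apply_inverse]

theorem eq_of_metric_frame_eq (hφ : φ ∈ IsManifold.maximalAtlas (𝓡 n) ∞ M) (hv : v ∈ slitDom φ)
    {u w : PB n M v} (h : ∀ a, g.toFun v u (frame φ a v) = g.toFun v w (frame φ a v)) :
    u = w := by
  rw [← sub_eq_zero]
  refine g.nondegenerate v hv.1 _ fun x => ?_
  rw [sum_comp_smul_frame hφ hv.2 x, map_sum]
  refine Finset.sum_eq_zero fun a _ => ?_
  rw [map_smul, map_sub, sub_apply, h a, sub_self, smul_zero]

theorem metric_apply_eq_sum (hφ : φ ∈ IsManifold.maximalAtlas (𝓡 n) ∞ M) (hv : v ∈ slitDom φ)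
    (u w : PB n M v) : g.toFun v u w = ∑ a, g.toFun v u (frame φ a v) * comp φ v w a := by
  conv_lhs => rw [sum_comp_smul_frame hφ hv.2 w, map_sum]
  exact Finset.sum_congr rfl fun a _ => by rw [map_smul, smul_eq_mul, mul_comm]

theorem gcomp_comm (hv : v ∈ Slit n M) (a b : Fin n) : gcomp g φ a b v = gcomp g φ b a v :=
  g.symm v hv _ _

/-- The forms `θ_{ab} = (1/2) (dg_{ab} + ω_{ab} - ω_{ba})`, for which
`Ψ_a = θ_{ab} ∧ ω^b`. -/
def theta (φ : OpenPartialHomeomorph M (Coord n)) (v : TangentBundle (𝓡 n) M) (a b : Fin n)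
    (X : TangentSpace (𝓡 n).tangent v) : ℝ :=
  (1 / 2 : ℝ) * (pd φ (dtcoord φ v X) (gcomp g φ a b) v + connLow D g φ v a b X
    - connLow D g φ v b a X)

/-- The lowered torsion is ω_{ab} ∧ dx^b and the correction is (dg_{ab} - ω_{ab} - ω_{ba}) ∧ dx^b /
2. In the sum only the antisymmetric part of ω_{ab} survives, and this is why Ψ is insensitive to
the symmetry. -/
theorem metric_canonicalTorsion_frame (hφ : φ ∈ IsManifold.maximalAtlas (𝓡 n) ∞ M)
    (hv : v ∈ slitDom φ) (X Y : TangentSpace (𝓡 n).tangent v) (a : Fin n) :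
    g.toFun v (canonicalTorsion D g v X Y) (frame φ a v) =
      ∑ b, (theta D g φ v a b X * (dtcoord φ v Y).1 b
        - theta D g φ v a b Y * (dtcoord φ v X).1 b) := by
  have hT : g.toFun v (torsion D v X Y) (frame φ a v) = ∑ b, (connLow D g φ v a b X *
      (dtcoord φ v Y).1 b - connLow D g φ v a b Y * (dtcoord φ v X).1 b) := by
    rw [g.symm v hv.1, metric_apply_eq_sum g hφ hv]
    simp only [comp_torsion D hφ hv, connLow, Finset.mul_sum, Finset.sum_mul]
    rw [Finset.sum_comm]
    refine Finset.sum_congr rfl fun b _ => ?_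
    rw [← Finset.sum_sub_distrib]
    exact Finset.sum_congr rfl fun d _ => by simp only [gcomp]; ring
  have hM : ∀ X Y : TangentSpace (𝓡 n).tangent v,
      dMetric D g v X (omega v Y) (frame φ a v) = ∑ b, (pd φ (dtcoord φ v X) (gcomp g φ a b) v
        - connLow D g φ v a b X - connLow D g φ v b a X) * (dtcoord φ v Y).1 b := by
    intro X Y
    conv_lhs => rw [sum_comp_smul_frame hφ hv.2 (omega v Y), map_sum, sum_apply]
    refine Finset.sum_congr rfl fun b _ => ?_
    rw [map_smul, smul_apply, dMetric_frame D g hφ hv, comp_omega hφ hv.2, smul_eq_mul,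
      pd_congr hφ (fun z hz => gcomp_comm g hz.1 b a) hv]
    ring
  rw [canonicalTorsion, map_add, map_smul, map_sub, add_apply, smul_apply, sub_apply, hT,
    metric_inverse_apply g hv.1, metric_inverse_apply g hv.1, hM, hM, ← Finset.sum_sub_distrib,
    smul_eq_mul, Finset.mul_sum, ← Finset.sum_add_distrib]
  refine Finset.sum_congr rfl fun b _ => ?_
  simp only [theta]
  ring

theorem chartAt_mem (v : TangentBundle (𝓡 n) M) :
    chartAt (Coord n) v.proj ∈ IsManifold.maximalAtlas (𝓡 n) ∞ M :=
  IsManifold.chart_mem_maximalAtlas _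

theorem mem_chartDom_chartAt (v : TangentBundle (𝓡 n) M) :
    v ∈ chartDom (chartAt (Coord n) v.proj) := mem_chart_source _ _

end Torsion

/-! ### Invariance under the symmetry -/

section Symmetry

variable {g : FinslerMetric n M} {D D' : FinslerConnection n M} {v : TangentBundle (𝓡 n) M}
  {W : Π v : TangentBundle (𝓡 n) M, PB n M v →L[ℝ] TangentSpace (𝓡 n).tangent v →L[ℝ] PB n M v}

theorem omegaBar_eq_of_symmetryRelated (h : SymmetryRelated g D D') (hv : v ∈ Slit n M) :
    omegaBar D' v = omegaBar D v := by
  obtain ⟨W, h1, -, h3⟩ := h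
  rw [omegaBar, h1 v hv _ (secDiffAt_liouville v)]
  ext1 X
  rw [add_apply, h3 v hv, add_zero]
  rfl

/-- Ψ is built from θ, and θ contains only the difference ω_{ab} - ω_{ba}, from which a symmetric
W_{ab} drops out. -/
theorem canonicalTorsion_eq_of_symmetryRelated (h : SymmetryRelated g D D') (hv : v ∈ Slit n M)
    (X Y : TangentSpace (𝓡 n).tangent v) :
    canonicalTorsion D' g v X Y = canonicalTorsion D g v X Y := by
  obtain ⟨W, h1, h2, -⟩ := h
  have hφ := chartAt_mem v
  have hv' : v ∈ slitDom (chartAt (Coord n) v.proj) := ⟨hv, mem_chartDom_chartAt v⟩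
  refine eq_of_metric_frame_eq g hφ hv' fun a => ?_
  rw [metric_canonicalTorsion_frame D' g hφ hv', metric_canonicalTorsion_frame D g hφ hv']
  have hth : ∀ a b X, theta D' g (chartAt (Coord n) v.proj) v a b X =
      theta D g (chartAt (Coord n) v.proj) v a b X := by
    intro a b X
    simp only [theta, ← metric_frame_cov _ g hφ hv', h1 v hv _ (secDiffAt_frame hφ hv'.2 _),
      add_apply, map_add]
    rw [h2 v hv X (frame _ a v) (frame _ b v)]
    ring
  simp only [hth]

/-- The change is -g(W y, u) - g(y, W u). The first term is zero, and by the symmetry of W the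
second equals -g(u, W y). -/
theorem dMetric_liouville_eq_of_symmetryRelated (h : SymmetryRelated g D D') (hv : v ∈ Slit n M)
    (X : TangentSpace (𝓡 n).tangent v) (u : PB n M v) :
    dMetric D' g v X (liouville v) u = dMetric D g v X (liouville v) u := by
  obtain ⟨W, h1, h2, h3⟩ := h
  have hE : SecDiffAt (FiberBundle.extend (Coord n) u) v :=
    FiberBundle.mdifferentiableAt_extend (𝓡 n).tangent (Coord n) (V := PB n M) u
  have hu : FiberBundle.extend (Coord n) u v = u := FiberBundle.extend_apply_self (Coord n) u
  have key := fun D : FinslerConnection n M =>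
    dMetric_apply D g hv X (secDiffAt_liouville v) hE
  rw [hu] at key
  simp only [key, dMetricAux, h1 v hv _ (secDiffAt_liouville v), h1 v hv _ hE, add_apply, map_add,
    h3 v hv]
  rw [hu, h2 v hv X (liouville v) u, h3 v hv]
  simp

theorem conditions_iff_of_symmetryRelated (h : SymmetryRelated g D D') :
    (Regular D ↔ Regular D') ∧ (CondBeta g D ↔ CondBeta g D') ∧ (CondGamma g D ↔ CondGamma g D') ∧
      (CondDelta g D ↔ CondDelta g D') ∧ (CondEpsilon g D ↔ CondEpsilon g D') := by
  refine ⟨?_, ?_, ?_, ?_, ?_⟩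
  · refine forall₂_congr fun v hv => ?_
    rw [omegaBar_eq_of_symmetryRelated h hv]
  · refine forall₂_congr fun v hv => ?_
    simp only [wedgeMetric, canonicalTorsion_eq_of_symmetryRelated h hv]
  · refine forall₂_congr fun v hv => ?_
    simp only [canonicalTorsion_eq_of_symmetryRelated h hv]
  · refine forall₂_congr fun v hv => ?_
    simp only [wedgeMetric, canonicalTorsion_eq_of_symmetryRelated h hv,
      omegaBar_eq_of_symmetryRelated h hv]
  · refine forall₂_congr fun v hv => ?_
    simp only [dMetric_liouville_eq_of_symmetryRelated h hv]

end Symmetry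

/-! ### Homogeneous functions -/

section Homogeneous

variable {φ : OpenPartialHomeomorph M (Coord n)} {v : TangentBundle (𝓡 n) M}
  {f : TangentBundle (𝓡 n) M → ℝ}

theorem pd_vertical (u : Coord n) : pd φ (0, u) f v = ∑ c, u c * pdy φ c f v := by
  rw [pd_eq_sum]
  simp

theorem hasDerivAt_fibre (hφ : φ ∈ IsManifold.maximalAtlas (𝓡 n) ∞ M) (hf : SmoothOver φ f)
    (hv : v ∈ slitDom φ) (u : TangentSpace (𝓡 n) v.proj) :
    HasDerivAt (fun r : ℝ => f ⟨v.proj, v.2 + r • u⟩) (pd φ (0, comp φ v u) f v) 0 := by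
  -- The derivative is kept opaque, so that rewriting the base point by `h0` does not reach into it.
  obtain ⟨A, hA⟩ : ∃ A, A = fderiv ℝ (fun p => f (tcoordSymm φ p)) (tcoord φ v) := ⟨_, rfl⟩
  have h1 : HasFDerivAt (fun p => f (tcoordSymm φ p)) A (tcoord φ v) :=
    hA ▸ (hf.differentiableAt hv).hasFDerivAt
  have h2 : HasDerivAt (fun r : ℝ => ((φ v.proj, comp φ v (liouville v) + r • comp φ v u) :
      Coord n × Coord n)) (0, comp φ v u) 0 := by
    refine (hasDerivAt_const (0 : ℝ) (φ v.proj)).prodMk ?_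
    simpa using ((hasDerivAt_id (0 : ℝ)).smul_const (comp φ v u)).const_add
      (comp φ v (liouville v))
  have h0 : ((φ v.proj, comp φ v (liouville v) + (0 : ℝ) • comp φ v u) : Coord n × Coord n) =
      tcoord φ v := by simp [tcoord]
  rw [← h0] at h1
  have h3 := h1.comp_hasDerivAt (0 : ℝ) h2
  rw [hA] at h3
  refine h3.congr_of_eventuallyEq (Eventually.of_forall fun r => ?_)
  have h4 := lift_eq_tcoordSymm hφ hv.2 ((v.2 + r • u : TangentSpace (𝓡 n) v.proj) : PB n M v)
  have h5 : comp φ v ((v.2 + r • u : TangentSpace (𝓡 n) v.proj) : PB n M v) =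
      comp φ v (liouville v) + r • comp φ v u :=
    (comp_add (φ := φ) (v := v) v.2 (r • u)).trans (congrArg _ (comp_smul r _))
  rw [h5] at h4
  exact congrArg f h4

theorem fibre_mem_slitDom (hv : v ∈ slitDom φ) (u : TangentSpace (𝓡 n) v.proj) :
    ∀ᶠ r : ℝ in 𝓝 0, (⟨v.proj, v.2 + r • u⟩ : TangentBundle (𝓡 n) M) ∈ slitDom φ := by
  have h : Continuous fun r : ℝ => v.2 + r • u :=
    continuous_const.add (continuous_id.smul continuous_const)
  have : T1Space (TangentSpace (𝓡 n) v.proj) := inferInstanceAs (T1Space (Coord n))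
  have h2 : ∀ᶠ r : ℝ in 𝓝 0, v.2 + r • u ≠ 0 := by
    refine h.continuousAt.eventually_ne ?_
    simpa using! (hv.1 : v.2 ≠ 0)
  filter_upwards [h2] with r hr using ⟨hr, hv.2⟩

/-- The inner derivative is identified only for small r, where v + r u stays off the zero section;
this suffices for the outer derivative at r = 0. -/
theorem verticalHessian_eq_pd (hφ : φ ∈ IsManifold.maximalAtlas (𝓡 n) ∞ M)
    (hf : SmoothOver φ f) (hv : v ∈ slitDom φ) (u w : TangentSpace (𝓡 n) v.proj) :
    verticalHessian f v u w = pd φ (0, comp φ v u) (pd φ (0, comp φ v w) f) v := by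
  rw [verticalHessian, ← (hasDerivAt_fibre hφ (hf.pd hφ _) hv u).deriv]
  refine EventuallyEq.deriv_eq ?_
  filter_upwards [fibre_mem_slitDom hv u] with r hr
  exact (hasDerivAt_fibre hφ hf hr w).deriv

/-- Euler's identity for functions homogeneous of degree `k` on the fibres. -/
def EulerHomogeneous (φ : OpenPartialHomeomorph M (Coord n)) (k : ℝ)
    (f : TangentBundle (𝓡 n) M → ℝ) : Prop :=
  ∀ v ∈ slitDom φ, ∑ a, ycoord φ a v * pdy φ a f v = k * f v

theorem pd_sum_ycoord_mul (hφ : φ ∈ IsManifold.maximalAtlas (𝓡 n) ∞ M)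
    {F : Fin n → TangentBundle (𝓡 n) M → ℝ} (hF : ∀ a, SmoothOver φ (F a)) (hv : v ∈ slitDom φ)
    (z : Coord n × Coord n) : pd φ z (fun v => ∑ a, ycoord φ a v * F a v) v =
      ∑ a, z.2 a * F a v + ∑ a, ycoord φ a v * pd φ z (F a) v := by
  rw [pd_sum (fun a _ => (SmoothOver.ycoord hφ a).mul (hF a)) hv, ← Finset.sum_add_distrib]
  exact Finset.sum_congr rfl fun a _ => by
    rw [pd_mul hφ (SmoothOver.ycoord hφ a) (hF a) hv, pd_ycoord hφ hv]

theorem EulerHomogeneous.pdx (hφ : φ ∈ IsManifold.maximalAtlas (𝓡 n) ∞ M) {k : ℝ}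
    (h : EulerHomogeneous φ k f) (hf : SmoothOver φ f) (b : Fin n) :
    EulerHomogeneous φ k (pdx φ b f) := fun v hv => by
  have h1 := pd_congr hφ h hv (EuclideanSpace.single b (1 : ℝ), 0)
  rw [pd_sum_ycoord_mul hφ (fun a => hf.pdy hφ a) hv, pd_const_mul hf hv] at h1
  simp only [PiLp.zero_apply, zero_mul, Finset.sum_const_zero, zero_add] at h1
  rw [pdx_eq_pd, ← h1]
  exact Finset.sum_congr rfl fun a _ => by rw [pdy_eq_pd, pdy_eq_pd, pd_comm hφ hf hv]

/-- When Euler's identity is differentiated along ∂/∂y^b, the factor y^a contributes one copy of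
∂f/∂y^b, which lowers the degree by one. -/
theorem EulerHomogeneous.pdy (hφ : φ ∈ IsManifold.maximalAtlas (𝓡 n) ∞ M) {k : ℝ}
    (h : EulerHomogeneous φ k f) (hf : SmoothOver φ f) (b : Fin n) :
    EulerHomogeneous φ (k - 1) (pdy φ b f) := fun v hv => by
  have h1 := pd_congr hφ h hv (0, EuclideanSpace.single b (1 : ℝ))
  rw [pd_sum_ycoord_mul hφ (fun a => hf.pdy hφ a) hv, pd_const_mul hf hv] at h1
  simp only [PiLp.single_apply, ite_mul, one_mul, zero_mul, Finset.sum_ite_eq',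
    Finset.mem_univ, if_true] at h1
  have h2 : ∑ a, ycoord φ a v * Finsler.pdy φ a (Finsler.pdy φ b f) v =
      ∑ a, ycoord φ a v * pd φ (0, EuclideanSpace.single b (1 : ℝ)) (Finsler.pdy φ a f) v :=
    Finset.sum_congr rfl fun a _ => by
      simp only [pdy_eq_pd]; rw [pd_comm hφ hf hv]
  rw [h2, pdy_eq_pd] at *
  linarith

end Homogeneous

/-! ### Finsler Lagrangians in induced coordinates -/

section Lagrangian

variable {φ : OpenPartialHomeomorph M (Coord n)} {v : TangentBundle (𝓡 n) M}
  {L : TangentBundle (𝓡 n) M → ℝ} {g : FinslerMetric n M}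

theorem IsFinslerLagrangian.smoothOver (hL : IsFinslerLagrangian L)
    (hφ : φ ∈ IsManifold.maximalAtlas (𝓡 n) ∞ M) : SmoothOver φ L :=
  .of_contMDiffAt hφ fun v hv =>
    (hL.contMDiffOn v hv.1).contMDiffAt ((isOpen_slit n M).mem_nhds hv.1)

theorem IsFinslerLagrangian.euler (hL : IsFinslerLagrangian L)
    (hφ : φ ∈ IsManifold.maximalAtlas (𝓡 n) ∞ M) : EulerHomogeneous φ 2 L := fun v hv => by
  have h1 := hasDerivAt_fibre hφ (hL.smoothOver hφ) hv v.2
  have h2 : HasDerivAt (fun r : ℝ => (1 + r) ^ 2 * L v) (2 * L v) 0 := by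
    simpa using (((hasDerivAt_id (0 : ℝ)).const_add 1).pow 2).mul_const (L v)
  have h3 : (fun r : ℝ => L ⟨v.proj, v.2 + r • v.2⟩) =ᶠ[𝓝 0] fun r => (1 + r) ^ 2 * L v := by
    -- For r > -1 the factor 1 + r is positive, as positive homogeneity requires.
    filter_upwards [lt_mem_nhds (show (-1 : ℝ) < 0 by norm_num)] with r hr
    rw [← hL.homogeneous v hv.1 (1 + r) (by linarith), add_smul, one_smul]
  rw [← (h1.unique (h2.congr_of_eventuallyEq h3))]
  exact (pd_vertical _).symm

theorem SmoothOver.hess (hφ : φ ∈ IsManifold.maximalAtlas (𝓡 n) ∞ M) (hL : SmoothOver φ L)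
    (a b : Fin n) : SmoothOver φ (hess L φ a b) :=
  (hL.pdy hφ b).pdy hφ a

theorem hess_comm (hφ : φ ∈ IsManifold.maximalAtlas (𝓡 n) ∞ M) (hL : SmoothOver φ L)
    (hv : v ∈ slitDom φ) (a b : Fin n) : hess L φ a b v = hess L φ b a v :=
  pd_comm hφ hL hv _ _

theorem pdy_hess_comm (hφ : φ ∈ IsManifold.maximalAtlas (𝓡 n) ∞ M) (hL : SmoothOver φ L)
    (hv : v ∈ slitDom φ) (a b c : Fin n) :
    pdy φ c (hess L φ a b) v = pdy φ a (hess L φ c b) v :=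
  pd_comm hφ (hL.pdy hφ b) hv _ _

theorem pd_hess_comm (hφ : φ ∈ IsManifold.maximalAtlas (𝓡 n) ∞ M) (hL : SmoothOver φ L)
    (hv : v ∈ slitDom φ) (a b : Fin n) (z : Coord n × Coord n) :
    pd φ z (hess L φ a b) v = pd φ z (hess L φ b a) v :=
  pd_congr hφ (fun _ hv => hess_comm hφ hL hv a b) hv z

theorem gcomp_eq_hess (hφ : φ ∈ IsManifold.maximalAtlas (𝓡 n) ∞ M) (hL : SmoothOver φ L)
    (hg : IsVerticalHessian L g) (hv : v ∈ slitDom φ) (a b : Fin n) :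
    gcomp g φ a b v = hess L φ a b v := by
  refine (hg v hv.1 _ _).trans ((verticalHessian_eq_pd hφ hL hv _ _).trans ?_)
  have h := fun a => comp_frame hφ hv.2 a
  simp only [h]
  rfl

theorem eq_zero_of_sum_gcomp (g : FinslerMetric n M) (hφ : φ ∈ IsManifold.maximalAtlas (𝓡 n) ∞ M)
    (hv : v ∈ slitDom φ) (x : Fin n → ℝ) (h : ∀ a, ∑ d, gcomp g φ a d v * x d = 0) : x = 0 := by
  have hu : ∑ d, x d • frame φ d v = 0 := by
    refine eq_of_metric_frame_eq g hφ hv fun a => ?_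
    rw [g.symm v hv.1, map_sum, map_zero, zero_apply, ← h a]
    exact Finset.sum_congr rfl fun d _ => by rw [map_smul, smul_eq_mul, mul_comm, gcomp]
  have h2 := congrArg (comp φ v) hu
  rw [comp_zero, ← compL_apply, map_sum] at h2
  funext d
  have h3 := congrArg (fun u : Coord n => u d) h2
  simpa [compL_apply, comp_frame hφ hv.2, Pi.single_apply] using h3

theorem det_gcomp_ne_zero (g : FinslerMetric n M) (hφ : φ ∈ IsManifold.maximalAtlas (𝓡 n) ∞ M)
    (hv : v ∈ slitDom φ) : (Matrix.of fun a b => gcomp g φ a b v).det ≠ 0 := by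
  intro h
  obtain ⟨x, hx, h0⟩ := Matrix.exists_mulVec_eq_zero_iff.2 h
  exact hx (eq_zero_of_sum_gcomp g hφ hv x fun a => congrFun h0 a)

theorem det_hess_ne_zero (hφ : φ ∈ IsManifold.maximalAtlas (𝓡 n) ∞ M) (hL : SmoothOver φ L)
    (hg : IsVerticalHessian L g) (hv : v ∈ slitDom φ) :
    (Matrix.of fun a b => hess L φ a b v).det ≠ 0 := by
  have := det_gcomp_ne_zero g hφ hv
  simpa only [gcomp_eq_hess hφ hL hg hv] using this

end Lagrangian

/-! ### Local identities of a Finsler Lagrangian -/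

section LocalIdentities

variable {φ : OpenPartialHomeomorph M (Coord n)} {v : TangentBundle (𝓡 n) M}
  {L : TangentBundle (𝓡 n) M → ℝ} {g : FinslerMetric n M}

theorem hess_mul_hessInv (hdet : (Matrix.of fun a b => hess L φ a b v).det ≠ 0)
    (F : Fin n → ℝ) (a : Fin n) :
    ∑ d, hess L φ a d v * ∑ e, hessInv L φ v d e * F e = F a := by
  have h : (Matrix.of fun a b => hess L φ a b v) * hessInv L φ v = 1 :=
    Matrix.mul_nonsing_inv _ (isUnit_iff_ne_zero.2 hdet)
  have h2 := congrFun (congrArg (fun A => Matrix.mulVec A F) h) a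
  rw [Matrix.one_mulVec, ← Matrix.mulVec_mulVec] at h2
  exact h2

theorem eq_of_sum_hess (hdet : (Matrix.of fun a b => hess L φ a b v).det ≠ 0) {x y : Fin n → ℝ}
    (h : ∀ a, ∑ d, hess L φ a d v * x d = ∑ d, hess L φ a d v * y d) : x = y := by
  have hinj := Matrix.mulVec_injective_iff_isUnit.2
    ((Matrix.isUnit_iff_isUnit_det _).2 (isUnit_iff_ne_zero.2 hdet))
  exact hinj (funext h)

/-- The hypotheses under which the local identities hold. -/
structure LagrangianOn (φ : OpenPartialHomeomorph M (Coord n)) (L : TangentBundle (𝓡 n) M → ℝ) :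
    Prop where
  mem : φ ∈ IsManifold.maximalAtlas (𝓡 n) ∞ M
  smooth : SmoothOver φ L
  euler : EulerHomogeneous φ 2 L
  det_ne_zero : ∀ v ∈ slitDom φ, (Matrix.of fun a b => hess L φ a b v).det ≠ 0

theorem IsFinslerLagrangian.lagrangianOn (hL : IsFinslerLagrangian L) (hg : IsVerticalHessian L g)
    (hφ : φ ∈ IsManifold.maximalAtlas (𝓡 n) ∞ M) : LagrangianOn φ L where
  mem := hφ
  smooth := hL.smoothOver hφ
  euler := hL.euler hφ
  det_ne_zero _ hv := det_hess_ne_zero hφ (hL.smoothOver hφ) hg hv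

/-! ### Euler identities for the Hessian and the spray. -/

namespace LagrangianOn

theorem smooth_hessInv (hL : LagrangianOn φ L) (a b : Fin n) :
    SmoothOver φ fun v => hessInv L φ v a b :=
  SmoothOver.matrix_inv hL.mem (A := fun v => Matrix.of fun a b => hess L φ a b v)
    (fun i j => hL.smooth.hess hL.mem i j) hL.det_ne_zero a b

theorem smooth_hess (hL : LagrangianOn φ L) (a b : Fin n) : SmoothOver φ (hess L φ a b) :=
  hL.smooth.hess hL.mem a b

theorem smooth_spray (hL : LagrangianOn φ L) (a : Fin n) : SmoothOver φ (spray L φ a) :=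
  (SmoothOver.const _).mul <| .sum fun d _ => (hL.smooth_hessInv a d).mul <|
    (SmoothOver.sum fun c _ => ((hL.smooth.pdy hL.mem d).pdx hL.mem c).mul
      (SmoothOver.ycoord hL.mem c)).sub (hL.smooth.pdx hL.mem d)

theorem smooth_barthelCoeff (hL : LagrangianOn φ L) (a c : Fin n) :
    SmoothOver φ (barthelCoeff L φ a c) :=
  (hL.smooth_spray a).pdy hL.mem c

/-- Lowering the index undoes the inverse Hessian in G^a. Later identities differentiate this form,
so no derivative of the inverse matrix has to be computed. -/
theorem hess_spray (hL : LagrangianOn φ L) (hv : v ∈ slitDom φ) (a : Fin n) :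
    ∑ d, hess L φ a d v * (2 * spray L φ d v) =
      (∑ c, ycoord φ c v * pdx φ c (pdy φ a L) v) - pdx φ a L v := by
  have h : ∀ d, 2 * spray L φ d v = ∑ e, hessInv L φ v d e *
      ((∑ c, pdx φ c (pdy φ e L) v * comp φ v (liouville v) c) - pdx φ e L v) := fun d => by
    rw [spray]; ring
  simp only [h]
  rw [hess_mul_hessInv (hL.det_ne_zero v hv)]
  congr 1
  exact Finset.sum_congr rfl fun c _ => mul_comm _ _

theorem euler_hess (hL : LagrangianOn φ L) (hv : v ∈ slitDom φ) (b : Fin n) :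
    ∑ c, ycoord φ c v * hess L φ c b v = pdy φ b L v := by
  have h := hL.euler.pdy hL.mem hL.smooth b v hv
  norm_num at h
  exact h

theorem euler_pd_hess (hL : LagrangianOn φ L) (hv : v ∈ slitDom φ) (a : Fin n)
    (z : Coord n × Coord n) : ∑ c, z.2 c * hess L φ c a v +
      ∑ c, ycoord φ c v * pd φ z (hess L φ c a) v = pd φ z (pdy φ a L) v := by
  rw [← pd_sum_ycoord_mul hL.mem (fun c => hL.smooth_hess c a) hv]
  exact pd_congr hL.mem (fun _ hv => hL.euler_hess hv a) hv z

theorem euler_pdx_hess (hL : LagrangianOn φ L) (hv : v ∈ slitDom φ) (a c : Fin n) :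
    ∑ b, ycoord φ b v * pdx φ c (hess L φ b a) v = pdx φ c (pdy φ a L) v := by
  have h := hL.euler_pd_hess hv a (EuclideanSpace.single c (1 : ℝ), 0)
  simpa only [PiLp.zero_apply, zero_mul, Finset.sum_const_zero, zero_add, pdx_eq_pd] using h

/-- The vertical derivative of y^b g_{ba} = ∂L/∂y^a produces g_{ca} on both sides. What remains
after cancellation is that y annihilates the Cartan torsion. -/
theorem euler_pdy_hess (hL : LagrangianOn φ L) (hv : v ∈ slitDom φ) (a c : Fin n) :
    ∑ b, ycoord φ b v * pdy φ c (hess L φ b a) v = 0 := by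
  have h := hL.euler_pd_hess hv a (0, EuclideanSpace.single c (1 : ℝ))
  simp only [PiLp.single_apply, ite_mul, one_mul, zero_mul, Finset.sum_ite_eq',
    Finset.mem_univ, if_true] at h
  simp only [pdy_eq_pd]
  have h2 : hess L φ c a v = pd φ (0, EuclideanSpace.single c (1 : ℝ)) (pdy φ a L) v := rfl
  linarith

theorem euler_pdx (hL : LagrangianOn φ L) (hv : v ∈ slitDom φ) (a : Fin n) :
    ∑ b, ycoord φ b v * pdx φ a (pdy φ b L) v = 2 * pdx φ a L v := by
  rw [← hL.euler.pdx hL.mem hL.smooth a v hv]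
  exact Finset.sum_congr rfl fun b _ => congrArg _ (pd_comm hL.mem hL.smooth hv _ _)

/-- This is the vertical derivative of the lowered spray equation. The derivative that falls on
g_{ad} becomes ∂g_{ac}/∂y^d by total symmetry, and the one that falls on y contributes ∂²L/∂x^c∂y^a.
-/
theorem two_hess_barthel (hL : LagrangianOn φ L) (hv : v ∈ slitDom φ) (a c : Fin n) :
    2 * ∑ d, hess L φ a d v * barthelCoeff L φ d c v =
      ∑ b, ycoord φ b v * pdx φ b (hess L φ a c) v + pdx φ c (pdy φ a L) v
        - pdx φ a (pdy φ c L) v - ∑ d, 2 * spray L φ d v * pdy φ d (hess L φ a c) v := by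
  have h := pd_congr hL.mem (fun v hv => hL.hess_spray hv a) hv (0, EuclideanSpace.single c (1 : ℝ))
  rw [pd_sub (.sum fun c _ => (SmoothOver.ycoord hL.mem c).mul
      ((hL.smooth.pdy hL.mem a).pdx hL.mem c)) (hL.smooth.pdx hL.mem a) hv,
    pd_sum_ycoord_mul hL.mem (fun c => (hL.smooth.pdy hL.mem a).pdx hL.mem c) hv,
    pd_sum (fun d _ => (hL.smooth_hess a d).mul ((SmoothOver.const 2).mul (hL.smooth_spray d)))
      hv] at h
  simp only [PiLp.single_apply, ite_mul, one_mul, zero_mul, Finset.sum_ite_eq',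
    Finset.mem_univ, if_true] at h
  have h1 : ∀ d, pd φ (0, EuclideanSpace.single c (1 : ℝ))
      (fun v => hess L φ a d v * (2 * spray L φ d v)) v =
      2 * spray L φ d v * pdy φ d (hess L φ a c) v +
        2 * (hess L φ a d v * barthelCoeff L φ d c v) := by
    intro d
    rw [pd_mul hL.mem (hL.smooth_hess a d) ((SmoothOver.const 2).mul (hL.smooth_spray d)) hv,
      pd_const_mul (hL.smooth_spray d) hv, ← pdy_eq_pd, ← pdy_eq_pd]
    have h2 : pdy φ c (hess L φ a d) v = pdy φ d (hess L φ a c) v := by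
      rw [pdy_eq_pd, pd_hess_comm hL.mem hL.smooth hv a d, ← pdy_eq_pd,
        pdy_hess_comm hL.mem hL.smooth hv d a c, pdy_eq_pd, pdy_eq_pd,
        pd_hess_comm hL.mem hL.smooth hv c a]
    rw [h2, barthelCoeff]
    ring
  have h3 : ∀ b, pd φ (0, EuclideanSpace.single c (1 : ℝ)) (pdx φ b (pdy φ a L)) v =
      pdx φ b (hess L φ a c) v := by
    intro b
    rw [pdx_eq_pd, pd_comm hL.mem (hL.smooth.pdy hL.mem a) hv, pdx_eq_pd,
      pd_hess_comm hL.mem hL.smooth hv a c]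
    rfl
  have h4 : pd φ (0, EuclideanSpace.single c (1 : ℝ)) (pdx φ a L) v = pdx φ a (pdy φ c L) v :=
    pd_comm hL.mem hL.smooth hv _ _
  simp only [h1, h3, h4, Finset.sum_add_distrib, ← Finset.mul_sum] at h
  linarith

end LagrangianOn

/-- The derivative `∂f/∂x^c - N^a_c ∂f/∂y^a` at a point, for arbitrary coefficients. -/
def hderiv (φ : OpenPartialHomeomorph M (Coord n)) (N : Fin n → Fin n → ℝ) (c : Fin n)
    (f : TangentBundle (𝓡 n) M → ℝ) (v : TangentBundle (𝓡 n) M) : ℝ :=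
  pdx φ c f v - ∑ a, N a c * pdy φ a f v

/-- The Christoffel symbols of the vertical Hessian with respect to arbitrary coefficients of a
non-linear connection. -/
def christoffel (L : TangentBundle (𝓡 n) M → ℝ) (φ : OpenPartialHomeomorph M (Coord n))
    (N : Fin n → Fin n → ℝ) (v : TangentBundle (𝓡 n) M) (a b c : Fin n) : ℝ :=
  (1 / 2 : ℝ) * (hderiv φ N b (hess L φ a c) v + hderiv φ N c (hess L φ a b) v
    - hderiv φ N a (hess L φ b c) v)

theorem gammaLow_eq_christoffel (a b c : Fin n) : gammaLow L φ v a b c =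
    christoffel L φ (fun a c => barthelCoeff L φ a c v) v a b c := rfl

/-! ### Contractions of the Christoffel symbols with y, and uniqueness of Barthel's connection. -/

namespace LagrangianOn

/-- The part of δ_c g_{ba} that depends on N is a combination of vertical derivatives of g, which y
annihilates. -/
theorem euler_hderiv_hess (hL : LagrangianOn φ L) (hv : v ∈ slitDom φ) (N : Fin n → Fin n → ℝ)
    (a c : Fin n) : ∑ b, ycoord φ b v * hderiv φ N c (hess L φ b a) v = pdx φ c (pdy φ a L) v := by
  simp only [hderiv, mul_sub, Finset.sum_sub_distrib, Finset.mul_sum]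
  rw [hL.euler_pdx_hess hv, Finset.sum_comm, sub_eq_self]
  refine Finset.sum_eq_zero fun d _ => ?_
  have h := hL.euler_pdy_hess hv a d
  calc _ = N d c * ∑ b, ycoord φ b v * pdy φ d (hess L φ b a) v := by
        rw [Finset.mul_sum]; exact Finset.sum_congr rfl fun b _ => by ring
    _ = 0 := by rw [h, mul_zero]

/-- In two of the three derivatives y is contracted with an index of g, and they lose N. Only y^b
δ_b g_{ac} retains it. -/
theorem euler_christoffel (hL : LagrangianOn φ L) (hv : v ∈ slitDom φ) (N : Fin n → Fin n → ℝ)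
    (a c : Fin n) : ∑ b, ycoord φ b v * christoffel L φ N v a b c =
      (1 / 2 : ℝ) * (∑ b, ycoord φ b v * hderiv φ N b (hess L φ a c) v + pdx φ c (pdy φ a L) v
        - pdx φ a (pdy φ c L) v) := by
  rw [← hL.euler_hderiv_hess hv N a c, ← hL.euler_hderiv_hess hv N c a, ← Finset.sum_add_distrib,
    ← Finset.sum_sub_distrib, Finset.mul_sum]
  refine Finset.sum_congr rfl fun b _ => ?_
  have h : hderiv φ N c (hess L φ a b) v = hderiv φ N c (hess L φ b a) v := by
    simp only [hderiv, pdx_eq_pd, pdy_eq_pd, pd_hess_comm hL.mem hL.smooth hv a b]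
  rw [christoffel, h]
  ring

/-- The operator y^b δ_b involves N only through y^b N^d_b. Once this is 2G^d, the contraction is
the right side of `two_hess_barthel`, halved. -/
theorem euler_christoffel_of_spray (hL : LagrangianOn φ L) (hv : v ∈ slitDom φ)
    {N : Fin n → Fin n → ℝ} (hN : ∀ d, ∑ c, ycoord φ c v * N d c = 2 * spray L φ d v)
    (a c : Fin n) : ∑ b, ycoord φ b v * christoffel L φ N v a b c =
      ∑ d, hess L φ a d v * barthelCoeff L φ d c v := by
  have h : ∑ b, ycoord φ b v * hderiv φ N b (hess L φ a c) v =
      ∑ b, ycoord φ b v * pdx φ b (hess L φ a c) v -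
        ∑ d, 2 * spray L φ d v * pdy φ d (hess L φ a c) v := by
    simp only [hderiv, mul_sub, Finset.sum_sub_distrib, Finset.mul_sum, ← hN, Finset.sum_mul]
    rw [Finset.sum_comm]
    simp only [mul_assoc]
  rw [hL.euler_christoffel hv, h]
  linarith [hL.two_hess_barthel hv a c]

/-- The second contraction pairs y with an index of g in the last term that contained N, so the
result is the lowered spray for every N. -/
theorem euler_euler_christoffel (hL : LagrangianOn φ L) (hv : v ∈ slitDom φ)
    (N : Fin n → Fin n → ℝ) (a : Fin n) :
    ∑ c, ycoord φ c v * ∑ b, ycoord φ b v * christoffel L φ N v a b c =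
      ∑ d, hess L φ a d v * (2 * spray L φ d v) := by
  have h1 : ∑ c, ycoord φ c v * ∑ b, ycoord φ b v * hderiv φ N b (hess L φ a c) v =
      ∑ b, ycoord φ b v * pdx φ b (pdy φ a L) v := by
    simp only [Finset.mul_sum]
    rw [Finset.sum_comm]
    refine Finset.sum_congr rfl fun b _ => ?_
    rw [← hL.euler_hderiv_hess hv N a b, Finset.mul_sum]
    refine Finset.sum_congr rfl fun c _ => ?_
    have h : hderiv φ N b (hess L φ a c) v = hderiv φ N b (hess L φ c a) v := by
      simp only [hderiv, pdx_eq_pd, pdy_eq_pd, pd_hess_comm hL.mem hL.smooth hv a c]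
    rw [h]
    ring
  have h2 := hL.euler_pdx hv a
  calc _ = (1 / 2 : ℝ) * (∑ c, ycoord φ c v * ∑ b, ycoord φ b v * hderiv φ N b (hess L φ a c) v +
        ∑ c, ycoord φ c v * pdx φ c (pdy φ a L) v - ∑ c, ycoord φ c v * pdx φ a (pdy φ c L) v) := by
        rw [← Finset.sum_add_distrib, ← Finset.sum_sub_distrib, Finset.mul_sum]
        exact Finset.sum_congr rfl fun c _ => by rw [hL.euler_christoffel hv]; ring
    _ = _ := by rw [h1, h2, hL.hess_spray hv]; ring

/-- Homogeneity of the spray follows by contracting the equation for g_{ad} N^d_c with y^c and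
cancelling the non-degenerate g; homogeneity of the inverse matrix is not needed. -/
theorem euler_barthelCoeff (hL : LagrangianOn φ L) (hv : v ∈ slitDom φ) (d : Fin n) :
    ∑ c, ycoord φ c v * barthelCoeff L φ d c v = 2 * spray L φ d v := by
  refine congrFun (eq_of_sum_hess (hL.det_ne_zero v hv)
    (x := fun d => ∑ c, ycoord φ c v * barthelCoeff L φ d c v)
    (y := fun d => 2 * spray L φ d v) fun a => ?_) d
  have h1 : ∑ c, ycoord φ c v * ∑ d, 2 * spray L φ d v * pdy φ d (hess L φ a c) v = 0 := by
    simp only [Finset.mul_sum]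
    rw [Finset.sum_comm]
    refine Finset.sum_eq_zero fun d _ => ?_
    have h := hL.euler_pdy_hess hv a d
    calc _ = 2 * spray L φ d v * ∑ c, ycoord φ c v * pdy φ d (hess L φ c a) v := by
          rw [Finset.mul_sum]
          exact Finset.sum_congr rfl fun c _ => by
            rw [pdy_eq_pd, pdy_eq_pd, pd_hess_comm hL.mem hL.smooth hv a c]; ring
      _ = 0 := by rw [h, mul_zero]
  have h2 : ∑ c, ycoord φ c v * ∑ b, ycoord φ b v * pdx φ b (hess L φ a c) v =
      ∑ b, ycoord φ b v * pdx φ b (pdy φ a L) v := by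
    simp only [Finset.mul_sum]
    rw [Finset.sum_comm]
    refine Finset.sum_congr rfl fun b _ => ?_
    rw [← hL.euler_pdx_hess hv a b, Finset.mul_sum]
    exact Finset.sum_congr rfl fun c _ => by
      rw [pdx_eq_pd, pdx_eq_pd, pd_hess_comm hL.mem hL.smooth hv a c]; ring
  have h3 := hL.euler_pdx hv a
  have h4 : ∑ c, ycoord φ c v * (2 * ∑ d, hess L φ a d v * barthelCoeff L φ d c v) =
      2 * ∑ d, hess L φ a d v * ∑ c, ycoord φ c v * barthelCoeff L φ d c v := by
    simp only [Finset.mul_sum]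
    rw [Finset.sum_comm]
    exact Finset.sum_congr rfl fun d _ => Finset.sum_congr rfl fun c _ => by ring
  simp only [hL.two_hess_barthel hv, mul_sub, mul_add, Finset.sum_sub_distrib,
    Finset.sum_add_distrib, h1, h2, h3] at h4
  rw [hL.hess_spray hv]
  linarith

/-- The contraction of `Γ_{abc}` with `y^b` gives Barthel's non-linear connection. -/
theorem euler_gammaLow (hL : LagrangianOn φ L) (hv : v ∈ slitDom φ) (a c : Fin n) :
    ∑ b, ycoord φ b v * gammaLow L φ v a b c = ∑ d, hess L φ a d v * barthelCoeff L φ d c v :=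
  hL.euler_christoffel_of_spray hv (fun d => hL.euler_barthelCoeff hv d) a c

/-- Barthel's non-linear connection is determined by its Christoffel symbols. -/
theorem barthelCoeff_unique (hL : LagrangianOn φ L) (hv : v ∈ slitDom φ) {N : Fin n → Fin n → ℝ}
    (hN : ∀ a c, ∑ d, hess L φ a d v * N d c = ∑ b, ycoord φ b v * christoffel L φ N v a b c) :
    N = fun d c => barthelCoeff L φ d c v := by
  -- The double contraction does not depend on N, so the implicit equation first fixes y^c N^d_c;
  -- the single contraction is then known as well.
  have hs : ∀ d, ∑ c, ycoord φ c v * N d c = 2 * spray L φ d v := by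
    refine congrFun (eq_of_sum_hess (hL.det_ne_zero v hv)
      (x := fun d => ∑ c, ycoord φ c v * N d c) (y := fun d => 2 * spray L φ d v) fun a => ?_)
    rw [← hL.euler_euler_christoffel hv N a]
    simp only [← hN, Finset.mul_sum]
    rw [Finset.sum_comm]
    exact Finset.sum_congr rfl fun c _ => Finset.sum_congr rfl fun b _ => by ring
  funext d c
  refine congrFun (eq_of_sum_hess (hL.det_ne_zero v hv) (x := fun d => N d c)
    (y := fun d => barthelCoeff L φ d c v) fun a => ?_) d
  rw [hN, hL.euler_christoffel_of_spray hv hs]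

end LagrangianOn
end LocalIdentities

/-! ### Berwald and Christoffel coefficients -/

section Landsberg

variable {φ : OpenPartialHomeomorph M (Coord n)} {v : TangentBundle (𝓡 n) M}
  {L : TangentBundle (𝓡 n) M → ℝ}

/-- The tensor `(∂L/∂y^d) ∂³G^d/∂y^a∂y^b∂y^c`, which is twice the Landsberg tensor up to sign. -/
def landsberg (L : TangentBundle (𝓡 n) M → ℝ) (φ : OpenPartialHomeomorph M (Coord n))
    (v : TangentBundle (𝓡 n) M) (a b c : Fin n) : ℝ :=
  ∑ d, pdy φ a (pdy φ b (barthelCoeff L φ d c)) v * pdy φ d L v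

/-- The Berwald coefficients with lowered index. -/
def berwaldLow (L : TangentBundle (𝓡 n) M → ℝ) (φ : OpenPartialHomeomorph M (Coord n))
    (v : TangentBundle (𝓡 n) M) (a b c : Fin n) : ℝ :=
  ∑ d, hess L φ a d v * berwaldUp L φ v d b c

namespace LagrangianOn

theorem berwaldUp_comm (hL : LagrangianOn φ L) (hv : v ∈ slitDom φ) (d b c : Fin n) :
    berwaldUp L φ v d b c = berwaldUp L φ v d c b :=
  pd_comm hL.mem (hL.smooth_spray d) hv _ _

theorem landsberg_swap (hL : LagrangianOn φ L) (hv : v ∈ slitDom φ) (a b c : Fin n) :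
    landsberg L φ v a b c = landsberg L φ v b a c :=
  Finset.sum_congr rfl fun d _ =>
    congrArg (· * _) (pd_comm hL.mem (hL.smooth_barthelCoeff d c) hv _ _)

theorem landsberg_swap_right (hL : LagrangianOn φ L) (hv : v ∈ slitDom φ) (a b c : Fin n) :
    landsberg L φ v a b c = landsberg L φ v a c b :=
  Finset.sum_congr rfl fun d _ => congrArg (· * _) <|
    pd_congr hL.mem (fun _ hz => pd_comm hL.mem (hL.smooth_spray d) hz _ _) hv _

theorem euler_spray (hL : LagrangianOn φ L) (d : Fin n) : EulerHomogeneous φ 2 (spray L φ d) :=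
  fun _ hv => hL.euler_barthelCoeff hv d

/-- Two vertical derivatives of G^d, which has degree two, leave degree zero, so their radial
derivative vanishes. -/
theorem euler_landsberg (hL : LagrangianOn φ L) (hv : v ∈ slitDom φ) (b c : Fin n) :
    ∑ a, ycoord φ a v * landsberg L φ v a b c = 0 := by
  simp only [landsberg, Finset.mul_sum]
  rw [Finset.sum_comm]
  refine Finset.sum_eq_zero fun d _ => ?_
  have h := ((hL.euler_spray d).pdy hL.mem (hL.smooth_spray d) c).pdy hL.mem
    (hL.smooth_barthelCoeff d c) b v hv
  norm_num at h
  calc _ = (∑ a, ycoord φ a v * pdy φ a (pdy φ b (barthelCoeff L φ d c)) v) * pdy φ d L v := by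
        rw [Finset.sum_mul]; exact Finset.sum_congr rfl fun a _ => by ring
    _ = 0 := by
      rw [show ∑ a, ycoord φ a v * pdy φ a (pdy φ b (barthelCoeff L φ d c)) v = 0 from h, zero_mul]

/-- The Lagrangian is constant along horizontal curves. -/
theorem pdx_eq_sum_barthelCoeff (hL : LagrangianOn φ L) (hv : v ∈ slitDom φ) (c : Fin n) :
    pdx φ c L v = ∑ d, barthelCoeff L φ d c v * pdy φ d L v := by
  -- The formula `two_hess_barthel` is contracted with y^a. The mixed derivatives y^b ∂²L/∂x^b∂y^c
  -- cancel, the Cartan term vanishes, and Euler's identity turns the remaining term into 2 ∂L/∂x^c.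
  have h1 : ∑ a, ycoord φ a v * (2 * ∑ d, hess L φ a d v * barthelCoeff L φ d c v) =
      2 * ∑ d, barthelCoeff L φ d c v * pdy φ d L v := by
    simp only [← hL.euler_hess hv, Finset.mul_sum]
    rw [Finset.sum_comm]
    exact Finset.sum_congr rfl fun d _ => Finset.sum_congr rfl fun a _ => by ring
  have h2 : ∑ a, ycoord φ a v * ∑ b, ycoord φ b v * pdx φ b (hess L φ a c) v =
      ∑ b, ycoord φ b v * pdx φ b (pdy φ c L) v := by
    simp only [Finset.mul_sum]
    rw [Finset.sum_comm]
    refine Finset.sum_congr rfl fun b _ => ?_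
    rw [← hL.euler_pdx_hess hv c b, Finset.mul_sum]
    exact Finset.sum_congr rfl fun a _ => by ring
  have h3 : ∑ a, ycoord φ a v * ∑ d, 2 * spray L φ d v * pdy φ d (hess L φ a c) v = 0 := by
    simp only [Finset.mul_sum]
    rw [Finset.sum_comm]
    refine Finset.sum_eq_zero fun d _ => ?_
    have h := hL.euler_pdy_hess hv c d
    calc _ = 2 * spray L φ d v * ∑ a, ycoord φ a v * pdy φ d (hess L φ a c) v := by
          rw [Finset.mul_sum]
          exact Finset.sum_congr rfl fun c _ => by ring
      _ = 0 := by rw [h, mul_zero]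
  have h4 := hL.euler_pdx hv c
  simp only [hL.two_hess_barthel hv, mul_sub, mul_add, Finset.sum_sub_distrib,
    Finset.sum_add_distrib, h2, h3, h4] at h1
  linarith

/-- The vertical derivative of the horizontal constancy of L. With the last term moved across it
reads δ_c(∂L/∂y^a) = G^d_{ac} ∂L/∂y^d. -/
theorem delta_pdy (hL : LagrangianOn φ L) (hv : v ∈ slitDom φ) (a c : Fin n) :
    pdx φ c (pdy φ a L) v = ∑ d, (berwaldUp L φ v d a c * pdy φ d L v +
      barthelCoeff L φ d c v * hess L φ a d v) := by
  have h := pd_congr hL.mem (fun v hv => hL.pdx_eq_sum_barthelCoeff hv c) hv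
    (0, EuclideanSpace.single a (1 : ℝ))
  rw [pd_sum fun d _ => (hL.smooth_barthelCoeff d c).mul (hL.smooth.pdy hL.mem d)] at h
  · refine (pd_comm hL.mem hL.smooth hv _ _).trans (h.trans ?_)
    exact Finset.sum_congr rfl fun d _ =>
      pd_mul hL.mem (hL.smooth_barthelCoeff d c) (hL.smooth.pdy hL.mem d) hv _
  · exact hv

/-- One more vertical derivative. The undifferentiated N turns ∂/∂x^c into δ/δx^c, its first
derivatives lower to Berwald coefficients, and its second derivative leaves the Landsberg-type term.
-/
theorem delta_hess (hL : LagrangianOn φ L) (hv : v ∈ slitDom φ) (a b c : Fin n) :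
    delta L φ c (hess L φ a b) v =
      landsberg L φ v a b c + berwaldLow L φ v a b c + berwaldLow L φ v b a c := by
  have h := pd_congr hL.mem (fun v hv => hL.delta_pdy hv b c) hv
    (0, EuclideanSpace.single a (1 : ℝ))
  have hB : ∀ d, SmoothOver φ fun v => berwaldUp L φ v d b c := fun d =>
    (hL.smooth_barthelCoeff d c).pdy hL.mem b
  rw [pd_sum (fun d _ => ((hB d).mul (hL.smooth.pdy hL.mem d)).add
    ((hL.smooth_barthelCoeff d c).mul (hL.smooth_hess b d))) hv] at h
  have h1 : pd φ (0, EuclideanSpace.single a (1 : ℝ)) (pdx φ c (pdy φ b L)) v =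
      pdx φ c (hess L φ a b) v := pd_comm hL.mem (hL.smooth.pdy hL.mem b) hv _ _
  have h2 : ∀ d, pd φ (0, EuclideanSpace.single a (1 : ℝ)) (fun v => berwaldUp L φ v d b c *
      pdy φ d L v + barthelCoeff L φ d c v * hess L φ b d v) v =
      pdy φ a (pdy φ b (barthelCoeff L φ d c)) v * pdy φ d L v +
      hess L φ a d v * berwaldUp L φ v d b c + hess L φ b d v * berwaldUp L φ v d a c +
      barthelCoeff L φ d c v * pdy φ d (hess L φ a b) v := by
    intro d
    rw [pd_add ((hB d).mul (hL.smooth.pdy hL.mem d))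
      ((hL.smooth_barthelCoeff d c).mul (hL.smooth_hess b d)) hv,
      pd_mul hL.mem (hB d) (hL.smooth.pdy hL.mem d) hv,
      pd_mul hL.mem (hL.smooth_barthelCoeff d c) (hL.smooth_hess b d) hv,
      pd_hess_comm hL.mem hL.smooth hv b d]
    have h3 : pd φ (0, EuclideanSpace.single a (1 : ℝ)) (hess L φ d b) v =
        pdy φ d (hess L φ a b) v := pdy_hess_comm hL.mem hL.smooth hv d b a
    rw [h3]
    change pdy φ a (pdy φ b (barthelCoeff L φ d c)) v * pdy φ d L v +
      berwaldUp L φ v d b c * hess L φ a d v + (berwaldUp L φ v d a c * hess L φ b d v +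
      barthelCoeff L φ d c v * pdy φ d (hess L φ a b) v) = _
    ring
  rw [h1] at h
  simp only [h2, Finset.sum_add_distrib] at h
  rw [delta, h]
  simp only [landsberg, berwaldLow]
  ring

/-- The Chern and Berwald coefficients differ by a totally symmetric tensor. -/
theorem gammaLow_eq_berwaldLow (hL : LagrangianOn φ L) (hv : v ∈ slitDom φ) (a b c : Fin n) :
    gammaLow L φ v a b c = berwaldLow L φ v a b c + (1 / 2 : ℝ) * landsberg L φ v a b c := by
  have hs : ∀ a b c, berwaldLow L φ v a b c = berwaldLow L φ v a c b := fun a b c =>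
    Finset.sum_congr rfl fun d _ => by rw [hL.berwaldUp_comm hv]
  -- In Γ_{abc} the Berwald terms with first index b or c cancel in pairs; of the three equal
  -- Landsberg terms one is left, with factor 1/2.
  rw [gammaLow, hL.delta_hess hv, hL.delta_hess hv, hL.delta_hess hv,
    hL.landsberg_swap_right hv a c b, hL.landsberg_swap hv b c a, hL.landsberg_swap_right hv c b a,
    hL.landsberg_swap hv c a b, hL.landsberg_swap_right hv a c b, hs b c a, hs a c b, hs c b a]
  ring

end LagrangianOn
end Landsberg

/-! ### The metric is a vertical Hessian -/

section Energy

variable {φ : OpenPartialHomeomorph M (Coord n)} {v : TangentBundle (𝓡 n) M}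
  {g : FinslerMetric n M} {D : FinslerConnection n M}

theorem metric_canonicalTorsion_apply (hφ : φ ∈ IsManifold.maximalAtlas (𝓡 n) ∞ M)
    (hv : v ∈ slitDom φ) (X Y : TangentSpace (𝓡 n).tangent v) (u : PB n M v) :
    g.toFun v (canonicalTorsion D g v X Y) u =
      ∑ a, (∑ b, (theta D g φ v a b X * (dtcoord φ v Y).1 b
        - theta D g φ v a b Y * (dtcoord φ v X).1 b)) * comp φ v u a := by
  rw [metric_apply_eq_sum g hφ hv]
  exact Finset.sum_congr rfl fun a _ => by rw [metric_canonicalTorsion_frame D g hφ hv]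

/-- On Z, ∂/∂x^a, ∂/∂x^b the cyclic term paired with ω(Z) vanishes, and the other two are θ_{ba}(Z)
and -θ_{ab}(Z). -/
theorem theta_comm_of_condBeta (hβ : CondBeta g D)
    (hφ : φ ∈ IsManifold.maximalAtlas (𝓡 n) ∞ M) (hv : v ∈ slitDom φ)
    {Z : TangentSpace (𝓡 n).tangent v} (hZ : (dtcoord φ v Z).1 = 0) (a b : Fin n) :
    theta D g φ v a b Z = theta D g φ v b a Z := by
  have h := hβ v hv.1 Z (dtcoordSymm φ v (EuclideanSpace.single a (1 : ℝ), 0))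
    (dtcoordSymm φ v (EuclideanSpace.single b (1 : ℝ), 0))
  simp only [wedgeMetric, metric_canonicalTorsion_apply hφ hv, comp_omega hφ hv.2,
    dtcoord_dtcoordSymm hφ hv.2, hZ] at h
  simp [PiLp.single_apply] at h
  linarith

/-- For vertical Z one has Ψ_a(Z, ∂/∂x^b) = θ_{ab}(Z), and (γ) contracts this with y^a. -/
theorem sum_ycoord_theta_of_condGamma (hγ : CondGamma g D)
    (hφ : φ ∈ IsManifold.maximalAtlas (𝓡 n) ∞ M) (hv : v ∈ slitDom φ)
    {Z : TangentSpace (𝓡 n).tangent v} (hZ : (dtcoord φ v Z).1 = 0) (b : Fin n) :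
    ∑ a, ycoord φ a v * theta D g φ v a b Z = 0 := by
  have h := hγ v hv.1 Z (dtcoordSymm φ v (EuclideanSpace.single b (1 : ℝ), 0))
  simp only [metric_canonicalTorsion_apply hφ hv, dtcoord_dtcoordSymm hφ hv.2, hZ] at h
  simp [PiLp.single_apply] at h
  rw [← h]
  exact Finset.sum_congr rfl fun a _ => mul_comm _ _

theorem pd_gcomp_comm (hφ : φ ∈ IsManifold.maximalAtlas (𝓡 n) ∞ M) (hv : v ∈ slitDom φ)
    (a b : Fin n) (z : Coord n × Coord n) :
    pd φ z (gcomp g φ a b) v = pd φ z (gcomp g φ b a) v :=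
  pd_congr hφ (fun _ hv => gcomp_comm g hv.1 a b) hv z

theorem theta_add_theta (hφ : φ ∈ IsManifold.maximalAtlas (𝓡 n) ∞ M) (hv : v ∈ slitDom φ)
    (a b : Fin n) (X : TangentSpace (𝓡 n).tangent v) :
    theta D g φ v a b X + theta D g φ v b a X = pd φ (dtcoord φ v X) (gcomp g φ a b) v := by
  rw [theta, theta, pd_gcomp_comm hφ hv b a]
  ring

/-- Under (β) and (γ) the components of the metric are homogeneous of degree zero, and their
vertical derivatives are annihilated by the Liouville field. -/
theorem sum_ycoord_pd_gcomp (hβ : CondBeta g D) (hγ : CondGamma g D)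
    (hφ : φ ∈ IsManifold.maximalAtlas (𝓡 n) ∞ M) (hv : v ∈ slitDom φ) (b : Fin n) (u : Coord n) :
    ∑ a, ycoord φ a v * pd φ (0, u) (gcomp g φ a b) v = 0 := by
  have hd := dtcoord_dtcoordSymm hφ hv.2 (0, u)
  have hZ : (dtcoord φ v (dtcoordSymm φ v (0, u))).1 = 0 := by rw [hd]
  have h1 := sum_ycoord_theta_of_condGamma hγ hφ hv hZ b
  have h2 : ∀ a, pd φ (0, u) (gcomp g φ a b) v =
      2 * theta D g φ v a b (dtcoordSymm φ v (0, u)) := fun a => by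
    rw [← hd, ← theta_add_theta (D := D) hφ hv, theta_comm_of_condBeta hβ hφ hv hZ b a, hd]
    ring
  simp only [h2, mul_left_comm _ (2 : ℝ), ← Finset.mul_sum, h1, mul_zero]

/-- The vertical derivatives of the metric components vanish on the Liouville field. -/
def VerticallyHomogeneous (g : FinslerMetric n M) (φ : OpenPartialHomeomorph M (Coord n)) :
    Prop :=
  ∀ v ∈ slitDom φ, ∀ b u, ∑ a, ycoord φ a v * pd φ (0, u) (gcomp g φ a b) v = 0

/-- The components `y_a = g_{ab} y^b`. -/
def ylow (g : FinslerMetric n M) (φ : OpenPartialHomeomorph M (Coord n)) (a : Fin n)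
    (v : TangentBundle (𝓡 n) M) : ℝ :=
  ∑ b, ycoord φ b v * gcomp g φ b a v

theorem SmoothOver.ylow (hφ : φ ∈ IsManifold.maximalAtlas (𝓡 n) ∞ M) (a : Fin n) :
    SmoothOver φ (ylow g φ a) :=
  .sum fun b _ => (SmoothOver.ycoord hφ b).mul (.gcomp g hφ b a)

theorem energy_eq_sum (hφ : φ ∈ IsManifold.maximalAtlas (𝓡 n) ∞ M) (hv : v ∈ slitDom φ) :
    energy g v = (1 / 2 : ℝ) * ∑ a, ycoord φ a v * ylow g φ a v := by
  rw [energy, metric_eq_sum g hφ hv.2]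
  simp only [ylow, Finset.mul_sum]
  refine Finset.sum_congr rfl fun a _ => Finset.sum_congr rfl fun b _ => ?_
  rw [gcomp_comm g hv.1 a b]
  simp only [ycoord]
  ring

theorem SmoothOver.energy (hφ : φ ∈ IsManifold.maximalAtlas (𝓡 n) ∞ M) :
    SmoothOver φ (energy g) :=
  ((SmoothOver.const (1 / 2 : ℝ)).mul (.sum fun a _ =>
    (SmoothOver.ycoord hφ a).mul (.ylow (g := g) hφ a))).congr hφ fun _ hv => energy_eq_sum hφ hv

theorem VerticallyHomogeneous.pd_ylow (h : VerticallyHomogeneous g φ)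
    (hφ : φ ∈ IsManifold.maximalAtlas (𝓡 n) ∞ M) (hv : v ∈ slitDom φ) (a : Fin n) (u : Coord n) :
    pd φ (0, u) (ylow g φ a) v = ∑ c, u c * gcomp g φ c a v := by
  have h1 := pd_sum_ycoord_mul hφ (fun b => SmoothOver.gcomp g hφ b a) hv (0, u)
  rw [h v hv a u, add_zero] at h1
  exact h1

/-- Since y annihilates the vertical derivatives of g, only the two factors y in g_{ab} y^a y^b / 2
are differentiated, and each contributes half. -/
theorem VerticallyHomogeneous.pd_energy (h : VerticallyHomogeneous g φ)
    (hφ : φ ∈ IsManifold.maximalAtlas (𝓡 n) ∞ M) (hv : v ∈ slitDom φ) (u : Coord n) :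
    pd φ (0, u) (energy g) v = ∑ c, u c * ylow g φ c v := by
  have hs : ∀ a, SmoothOver φ (ylow g φ a) := fun a => .ylow hφ a
  rw [pd_congr hφ (fun _ hv => energy_eq_sum (g := g) hφ hv) hv, pd_const_mul (.sum fun a _ =>
    (SmoothOver.ycoord hφ a).mul (hs a)) hv, pd_sum_ycoord_mul hφ hs hv]
  simp only [h.pd_ylow hφ hv]
  have h2 : ∑ a, ycoord φ a v * ∑ c, u c * gcomp g φ c a v = ∑ c, u c * ylow g φ c v := by
    simp only [ylow, Finset.mul_sum]
    rw [Finset.sum_comm]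
    refine Finset.sum_congr rfl fun c _ => Finset.sum_congr rfl fun a _ => ?_
    rw [gcomp_comm g hv.1 c a]
    ring
  rw [h2]
  ring

theorem VerticallyHomogeneous.verticalHessian_energy (h : VerticallyHomogeneous g φ)
    (hφ : φ ∈ IsManifold.maximalAtlas (𝓡 n) ∞ M) (hv : v ∈ slitDom φ) (u w : PB n M v) :
    verticalHessian (energy g) v u w = g.toFun v u w := by
  refine (verticalHessian_eq_pd hφ (.energy hφ) hv u w).trans ?_
  rw [pd_congr hφ (fun _ hv => h.pd_energy hφ hv (comp φ v w)) hv,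
    pd_sum fun c _ => (SmoothOver.const _).mul (.ylow hφ c)]
  · rw [metric_eq_sum g hφ hv.2, Finset.sum_comm]
    refine Finset.sum_congr rfl fun c _ => ?_
    rw [pd_const_mul (.ylow hφ c) hv, h.pd_ylow hφ hv, Finset.mul_sum]
    exact Finset.sum_congr rfl fun b _ => by ring
  · exact hv

theorem VerticallyHomogeneous.euler_energy (h : VerticallyHomogeneous g φ)
    (hφ : φ ∈ IsManifold.maximalAtlas (𝓡 n) ∞ M) (hv : v ∈ slitDom φ) :
    pd φ (0, comp φ v (liouville v)) (energy g) v = 2 * energy g v := by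
  rw [h.pd_energy hφ hv, energy_eq_sum hφ hv]
  simp only [ycoord]
  ring

/-- A function that satisfies Euler's relation along the rays is positively homogeneous of
degree two. -/
theorem homogeneous_of_euler {f : ℝ → ℝ} (h : ∀ r, 0 < r → HasDerivAt f (2 * f r / r) r) {s : ℝ}
    (hs : 0 < s) : f s = s ^ 2 * f 1 := by
  -- Euler's relation says that f(r)/r² is constant on the positive half-line.
  have h1 : ∀ r ∈ Set.Ioi (0 : ℝ), HasDerivAt (fun r => f r / r ^ 2) 0 r := fun r hr => by
    have hr' : r ≠ 0 := ne_of_gt hr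
    have := (h r hr).div (hasDerivAt_pow 2 r) (pow_ne_zero 2 hr')
    have h0 : (2 * f r / r * r ^ 2 - f r * (((2 : ℕ) : ℝ) * r ^ (2 - 1))) / (r ^ 2) ^ 2 = 0 := by
      field_simp
      simp
    exact h0 ▸ this
  have h2 := isOpen_Ioi.is_const_of_deriv_eq_zero isPreconnected_Ioi
    (fun r hr => (h1 r hr).differentiableAt.differentiableWithinAt)
    (fun r hr => (h1 r hr).deriv) (Set.mem_Ioi.2 hs) (Set.mem_Ioi.2 one_pos)
  field_simp at h2
  linarith

theorem energy_smul (h : ∀ φ ∈ IsManifold.maximalAtlas (𝓡 n) ∞ M, VerticallyHomogeneous g φ)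
    (hv : v ∈ Slit n M) {s : ℝ} (hs : 0 < s) :
    energy g ⟨v.proj, s • v.2⟩ = s ^ 2 * energy g v := by
  have hφ := chartAt_mem v
  have key : ∀ r : ℝ, 0 < r → HasDerivAt (fun r : ℝ => energy g ⟨v.proj, r • v.2⟩)
      (2 * energy g ⟨v.proj, r • v.2⟩ / r) r := fun r hr => by
    have hw : (⟨v.proj, r • v.2⟩ : TangentBundle (𝓡 n) M) ∈ slitDom (chartAt (Coord n) v.proj) :=
      ⟨fun h0 => hv ((smul_eq_zero_iff_right hr.ne').1 h0), mem_chartDom_chartAt v⟩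
    -- The direction of the ray is written as r⁻¹ times the Liouville vector at the point r v, so
    -- that Euler's relation at that point applies.
    have h1 := hasDerivAt_fibre hφ (.energy (g := g) hφ) hw (r⁻¹ • (r • v.2))
    have h2 := (h _ hφ).euler_energy hφ hw
    have h3 : pd (chartAt (Coord n) v.proj) (0, comp (chartAt (Coord n) v.proj)
        ⟨v.proj, r • v.2⟩ (r⁻¹ • (r • v.2))) (energy g) ⟨v.proj, r • v.2⟩ =
        2 * energy g ⟨v.proj, r • v.2⟩ / r := by
      rw [div_eq_inv_mul, ← h2, ← pd_smul_vec]
      refine congrArg (fun z => pd _ z _ _) ?_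
      rw [Prod.smul_mk, smul_zero]
      exact congrArg (Prod.mk 0) (comp_smul (v := ⟨v.proj, r • v.2⟩) _ _)
    rw [h3] at h1
    have h4 := HasDerivAt.comp_sub_const (x := r) r (by rwa [sub_self])
    refine h4.congr_of_eventuallyEq (Eventually.of_forall fun t => ?_)
    refine congrArg (fun x => energy g ⟨v.proj, x⟩) ?_
    show t • v.2 = r • v.2 + (t - r) • (r⁻¹ • (r • v.2))
    rw [inv_smul_smul₀ hr.ne', ← add_smul, add_sub_cancel]
  have := homogeneous_of_euler key hs
  rwa [one_smul] at this

/-- Under (β) and (γ) the metric is the vertical Hessian of its energy, a Finsler Lagrangian. -/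
theorem isFinslerLagrangian_energy (hβ : CondBeta g D) (hγ : CondGamma g D) :
    IsFinslerLagrangian (energy g) ∧ IsVerticalHessian (energy g) g := by
  have h : ∀ φ ∈ IsManifold.maximalAtlas (𝓡 n) ∞ M, VerticallyHomogeneous g φ :=
    fun φ hφ v hv b u => sum_ycoord_pd_gcomp hβ hγ hφ hv b u
  have hH : IsVerticalHessian (energy g) g := fun v hv u w =>
    ((h _ (chartAt_mem v)).verticalHessian_energy (chartAt_mem v)
      ⟨hv, mem_chartDom_chartAt v⟩ u w).symm
  refine ⟨⟨fun v hv => ?_, fun v hv s hs => energy_smul h hv hs, fun v hv u hu => ?_⟩, hH⟩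
  · exact ((SmoothOver.energy (chartAt_mem v)).contMDiffAt (chartAt_mem v)
      ⟨hv, mem_chartDom_chartAt v⟩).contMDiffWithinAt
  · exact g.nondegenerate v hv u fun w => (hH v hv u w).trans (hu w)

end Energy

/-! ### Connections that satisfy (α)-(ε) in coordinates -/

section Adapted

variable {φ : OpenPartialHomeomorph M (Coord n)} {v : TangentBundle (𝓡 n) M}
  {g : FinslerMetric n M} {D : FinslerConnection n M} {L : TangentBundle (𝓡 n) M → ℝ}

/-- The horizontal coordinate vector `∂/∂x^c - N^a_c ∂/∂y^a`. -/
def hvec (φ : OpenPartialHomeomorph M (Coord n)) (v : TangentBundle (𝓡 n) M)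
    (N : Fin n → Fin n → ℝ) (c : Fin n) : TangentSpace (𝓡 n).tangent v :=
  dtcoordSymm φ v (EuclideanSpace.single c (1 : ℝ), WithLp.toLp 2 fun a => -N a c)

/-- The vertical coordinate vector `∂/∂y^c`. -/
def vvec (φ : OpenPartialHomeomorph M (Coord n)) (v : TangentBundle (𝓡 n) M) (c : Fin n) :
    TangentSpace (𝓡 n).tangent v :=
  dtcoordSymm φ v (0, EuclideanSpace.single c (1 : ℝ))

theorem dtcoord_hvec (hφ : φ ∈ IsManifold.maximalAtlas (𝓡 n) ∞ M) (hv : v ∈ chartDom φ)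
    (N : Fin n → Fin n → ℝ) (c : Fin n) : dtcoord φ v (hvec φ v N c) =
      (EuclideanSpace.single c (1 : ℝ), WithLp.toLp 2 fun a => -N a c) :=
  dtcoord_dtcoordSymm hφ hv _

theorem dtcoord_vvec (hφ : φ ∈ IsManifold.maximalAtlas (𝓡 n) ∞ M) (hv : v ∈ chartDom φ)
    (c : Fin n) : dtcoord φ v (vvec φ v c) = (0, EuclideanSpace.single c (1 : ℝ)) :=
  dtcoord_dtcoordSymm hφ hv _

theorem pd_hvec (f : TangentBundle (𝓡 n) M → ℝ) (N : Fin n → Fin n → ℝ) (c : Fin n) :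
    pd φ (EuclideanSpace.single c (1 : ℝ), WithLp.toLp 2 fun a => -N a c) f v =
      hderiv φ N c f v := by
  rw [pd_eq_sum, hderiv, sub_eq_add_neg, ← Finset.sum_neg_distrib]
  simp [PiLp.single_apply]

theorem eq_sum_hvec_add_sum_vvec (hφ : φ ∈ IsManifold.maximalAtlas (𝓡 n) ∞ M)
    (hv : v ∈ chartDom φ) (N : Fin n → Fin n → ℝ) (X : TangentSpace (𝓡 n).tangent v) :
    X = ∑ c, (dtcoord φ v X).1 c • hvec φ v N c +
      ∑ a, ((dtcoord φ v X).2 a + ∑ c, N a c * (dtcoord φ v X).1 c) • vvec φ v a := by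
  apply (dtcoordEquiv hφ hv).injective
  change dtcoord φ v X = dtcoord φ v _
  simp only [map_add, map_sum, map_smul, dtcoord_hvec hφ hv, dtcoord_vvec hφ hv]
  ext a
  · simp [Prod.fst_sum, Pi.single_apply]
  · simp [Prod.snd_sum, Pi.single_apply, Finset.sum_neg_distrib, mul_comm]

theorem isLinearMap_connForm (D : FinslerConnection n M) (a b : Fin n) :
    IsLinearMap ℝ (connForm D φ v a b) where
  map_add X Y := by
    simp only [connForm, map_add, comp_add]
    rfl
  map_smul c X := by
    simp only [connForm, map_smul, comp_smul]
    rfl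

theorem isLinearMap_connLow (D : FinslerConnection n M) (g : FinslerMetric n M) (a b : Fin n) :
    IsLinearMap ℝ (connLow D g φ v a b) where
  map_add X Y := by
    simp only [connLow, (isLinearMap_connForm D _ _).map_add, mul_add, Finset.sum_add_distrib]
  map_smul c X := by
    simp only [connLow, (isLinearMap_connForm D _ _).map_smul, smul_eq_mul, Finset.mul_sum,
      mul_left_comm]

theorem isLinearMap_theta (D : FinslerConnection n M) (g : FinslerMetric n M) (a b : Fin n) :
    IsLinearMap ℝ (theta D g φ v a b) where
  map_add X Y := by
    simp only [theta, (isLinearMap_connLow D g _ _).map_add, map_add, pd_add_vec]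
    ring
  map_smul c X := by
    simp only [theta, (isLinearMap_connLow D g _ _).map_smul, map_smul, pd_smul_vec, smul_eq_mul]
    ring

/-- N is left arbitrary because three choices are used: zero, the coefficients induced by ∇, and
Barthel's. -/
theorem _root_.IsLinearMap.eq_sum_hvec_add_sum_vvec
    (hφ : φ ∈ IsManifold.maximalAtlas (𝓡 n) ∞ M) (hv : v ∈ chartDom φ)
    {F : TangentSpace (𝓡 n).tangent v → ℝ} (hF : IsLinearMap ℝ F) (N : Fin n → Fin n → ℝ)
    (X : TangentSpace (𝓡 n).tangent v) :
    F X = ∑ c, (dtcoord φ v X).1 c * F (hvec φ v N c) +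
      ∑ a, ((dtcoord φ v X).2 a + ∑ c, N a c * (dtcoord φ v X).1 c) * F (vvec φ v a) := by
  have h := congrArg (hF.mk' F) (Finsler.eq_sum_hvec_add_sum_vvec hφ hv N X)
  rw [map_add, map_sum, map_sum] at h
  simp only [map_smul] at h
  exact h

theorem dMetric_liouville_frame (hφ : φ ∈ IsManifold.maximalAtlas (𝓡 n) ∞ M)
    (hv : v ∈ slitDom φ) (X : TangentSpace (𝓡 n).tangent v) (b : Fin n) :
    dMetric D g v X (liouville v) (frame φ b v) = ∑ a, ycoord φ a v *
      (pd φ (dtcoord φ v X) (gcomp g φ a b) v - connLow D g φ v b a X - connLow D g φ v a b X) := by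
  conv_lhs => rw [sum_comp_smul_frame hφ hv.2 (liouville v), map_sum]
  rw [sum_apply]
  refine Finset.sum_congr rfl fun a _ => ?_
  rw [map_smul, smul_apply, dMetric_frame D g hφ hv, smul_eq_mul, ycoord]

theorem condEpsilon_iff : CondEpsilon g D ↔ ∀ φ ∈ IsManifold.maximalAtlas (𝓡 n) ∞ M,
    ∀ v ∈ slitDom φ, ∀ (X : TangentSpace (𝓡 n).tangent v) (b : Fin n), ∑ a, ycoord φ a v *
      (pd φ (dtcoord φ v X) (gcomp g φ a b) v - connLow D g φ v b a X
        - connLow D g φ v a b X) = 0 := by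
  refine ⟨fun h φ hφ v hv X b => ?_, fun h v hv X u => ?_⟩
  · rw [← dMetric_liouville_frame hφ hv, h v hv.1]
  · have hv' : v ∈ slitDom (chartAt (Coord n) v.proj) := ⟨hv, mem_chartDom_chartAt v⟩
    rw [sum_comp_smul_frame (chartAt_mem v) hv'.2 u, map_sum]
    refine Finset.sum_eq_zero fun b _ => ?_
    rw [map_smul, dMetric_liouville_frame (chartAt_mem v) hv', h _ (chartAt_mem v) v hv' X b,
      smul_zero]

/-- The coordinate form of (α)-(ε): `ω̄^a = dy^a + N^a_c dx^c`,
`θ_{ab} = Γ_{abc} ω^c + C_{abc} ω̄^c` and `y^a Dg_{ab} = 0`. -/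
structure AdaptedAt (g : FinslerMetric n M) (D : FinslerConnection n M)
    (L : TangentBundle (𝓡 n) M → ℝ) (φ : OpenPartialHomeomorph M (Coord n))
    (v : TangentBundle (𝓡 n) M) : Prop where
  comp_omegaBar : ∀ X a, comp φ v (omegaBar D v X) a =
    (dtcoord φ v X).2 a + ∑ c, barthelCoeff L φ a c v * (dtcoord φ v X).1 c
  theta_eq : ∀ X a b, theta D g φ v a b X = ∑ c, gammaLow L φ v a b c * (dtcoord φ v X).1 c +
    ∑ c, (1 / 2 : ℝ) * pdy φ c (hess L φ a b) v * comp φ v (omegaBar D v X) c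
  epsilon : ∀ X b, ∑ a, ycoord φ a v * (pd φ (dtcoord φ v X) (gcomp g φ a b) v
    - connLow D g φ v b a X - connLow D g φ v a b X) = 0

theorem sum_gcomp_sum_connForm (a : Fin n) (X : TangentSpace (𝓡 n).tangent v) :
    ∑ d, gcomp g φ a d v * ∑ b, connForm D φ v d b X * ycoord φ b v =
      ∑ b, ycoord φ b v * connLow D g φ v a b X := by
  simp only [connLow, Finset.mul_sum]
  rw [Finset.sum_comm]
  exact Finset.sum_congr rfl fun _ _ => Finset.sum_congr rfl fun _ _ => by ring

theorem connLow_comm_of_condBeta (hβ : CondBeta g D)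
    (hφ : φ ∈ IsManifold.maximalAtlas (𝓡 n) ∞ M) (hv : v ∈ slitDom φ)
    {Z : TangentSpace (𝓡 n).tangent v} (hZ : (dtcoord φ v Z).1 = 0) (a b : Fin n) :
    connLow D g φ v a b Z = connLow D g φ v b a Z := by
  have := theta_comm_of_condBeta hβ hφ hv hZ a b
  rw [theta, theta, pd_gcomp_comm hφ hv b a] at this
  linarith

/-- Strong regularity in coordinates. -/
theorem Compatible.omegaBar_vertical (h : Compatible g D)
    (hφ : φ ∈ IsManifold.maximalAtlas (𝓡 n) ∞ M) (hv : v ∈ slitDom φ)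
    {Z : TangentSpace (𝓡 n).tangent v} (hZ : (dtcoord φ v Z).1 = 0) (a : Fin n) :
    ∑ b, connForm D φ v a b Z * ycoord φ b v = 0 := by
  obtain ⟨-, hβ, hγ, -, hε⟩ := h
  refine congrFun (eq_zero_of_sum_gcomp g hφ hv
    (fun d => ∑ b, connForm D φ v d b Z * ycoord φ b v) fun b => ?_) a
  rw [sum_gcomp_sum_connForm]
  have h1 := condEpsilon_iff.1 hε φ hφ v hv Z b
  have hZ' : dtcoord φ v Z = (0, (dtcoord φ v Z).2) := Prod.ext hZ rfl
  rw [hZ'] at h1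
  have h2 := sum_ycoord_pd_gcomp hβ hγ hφ hv b (dtcoord φ v Z).2
  -- In (ε) the derivative of g drops out, and by (β) the two connection terms agree on the vertical
  -- Z, so each of their contractions with y vanishes.
  simp only [mul_sub, Finset.sum_sub_distrib, h2, connLow_comm_of_condBeta hβ hφ hv hZ _ b] at h1
  linarith

/-- The coefficients of the non-linear connection induced by `∇`. -/
def inducedCoeff (D : FinslerConnection n M) (φ : OpenPartialHomeomorph M (Coord n))
    (v : TangentBundle (𝓡 n) M) (a c : Fin n) : ℝ :=
  ∑ b, connForm D φ v a b (dtcoordSymm φ v (EuclideanSpace.single c (1 : ℝ), 0)) * ycoord φ b v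

theorem Compatible.comp_omegaBar_eq (h : Compatible g D)
    (hφ : φ ∈ IsManifold.maximalAtlas (𝓡 n) ∞ M) (hv : v ∈ slitDom φ)
    (X : TangentSpace (𝓡 n).tangent v) (a : Fin n) :
    comp φ v (omegaBar D v X) a =
      (dtcoord φ v X).2 a + ∑ c, inducedCoeff D φ v a c * (dtcoord φ v X).1 c := by
  rw [comp_omegaBar D hφ hv]
  congr 1
  have hF : IsLinearMap ℝ fun X => ∑ b, connForm D φ v a b X * ycoord φ b v :=
    { map_add := fun X Y => by
        simp only [(isLinearMap_connForm D _ _).map_add, add_mul, Finset.sum_add_distrib]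
      map_smul := fun c X => by
        simp only [(isLinearMap_connForm D _ _).map_smul, smul_eq_mul, Finset.mul_sum, mul_assoc] }
  -- With N = 0 the adapted vectors are ∂/∂x^c and ∂/∂y^c. The vertical ones contribute nothing, and
  -- the others give the induced coefficients.
  rw [hF.eq_sum_hvec_add_sum_vvec hφ hv.2 (fun _ _ => 0) X]
  have h0 : ∀ c, ∑ b, connForm D φ v a b (vvec φ v c) * ycoord φ b v = 0 := fun c =>
    h.omegaBar_vertical hφ hv (by rw [dtcoord_vvec hφ hv.2]) a
  simp only [h0, mul_zero, Finset.sum_const_zero, add_zero]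
  refine Finset.sum_congr rfl fun c _ => ?_
  rw [mul_comm]
  refine congrArg (· * _) (Finset.sum_congr rfl fun b _ => ?_)
  refine congrArg (fun z => connForm D φ v a b (dtcoordSymm φ v (_, z)) * _) ?_
  ext i
  simp

theorem Compatible.comp_omegaBar_hvec (h : Compatible g D)
    (hφ : φ ∈ IsManifold.maximalAtlas (𝓡 n) ∞ M) (hv : v ∈ slitDom φ) (c : Fin n) :
    comp φ v (omegaBar D v (hvec φ v (inducedCoeff D φ v) c)) = 0 := by
  ext a
  rw [h.comp_omegaBar_eq hφ hv, dtcoord_hvec hφ hv.2]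
  simp [PiLp.single_apply]

/-- On δ_c, δ_b, ∂/∂y^a only the term of (δ) paired with ω̄(∂/∂y^a) survives, as ω̄ kills the δ's.
It is Ψ_a(δ_c, δ_b) = θ_{ab}(δ_c) - θ_{ac}(δ_b). -/
theorem Compatible.theta_hvec_comm (h : Compatible g D)
    (hφ : φ ∈ IsManifold.maximalAtlas (𝓡 n) ∞ M) (hv : v ∈ slitDom φ) (a b c : Fin n) :
    theta D g φ v a b (hvec φ v (inducedCoeff D φ v) c) =
      theta D g φ v a c (hvec φ v (inducedCoeff D φ v) b) := by
  have h1 := h.2.2.2.1 v hv.1 (hvec φ v (inducedCoeff D φ v) c)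
    (hvec φ v (inducedCoeff D φ v) b) (vvec φ v a)
  have h2 : comp φ v (omegaBar D v (vvec φ v a)) = EuclideanSpace.single a (1 : ℝ) := by
    ext i
    rw [h.comp_omegaBar_eq hφ hv, dtcoord_vvec hφ hv.2]
    simp
  simp only [wedgeMetric, metric_canonicalTorsion_apply hφ hv, h.comp_omegaBar_hvec hφ hv, h2,
    dtcoord_hvec hφ hv.2] at h1
  simp [PiLp.single_apply] at h1
  linarith

theorem pd_gcomp_eq_pd_hess (hL : LagrangianOn φ L)
    (hg : ∀ v ∈ slitDom φ, ∀ a b, gcomp g φ a b v = hess L φ a b v) (hv : v ∈ slitDom φ)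
    (z : Coord n × Coord n) (a b : Fin n) :
    pd φ z (gcomp g φ a b) v = pd φ z (hess L φ a b) v :=
  pd_congr hL.mem (fun _ hv => hg _ hv a b) hv z

/-- The Levi-Civita argument: symmetry in b, c together with θ_{ab} + θ_{ba} = dg_{ab} determines
all components on horizontal vectors. -/
theorem Compatible.theta_hvec (h : Compatible g D) (hL : LagrangianOn φ L)
    (hg : ∀ v ∈ slitDom φ, ∀ a b, gcomp g φ a b v = hess L φ a b v) (hv : v ∈ slitDom φ)
    (a b c : Fin n) : theta D g φ v a b (hvec φ v (inducedCoeff D φ v) c) =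
      christoffel L φ (inducedCoeff D φ v) v a b c := by
  have hs : ∀ a b c, theta D g φ v a b (hvec φ v (inducedCoeff D φ v) c) +
      theta D g φ v b a (hvec φ v (inducedCoeff D φ v) c) =
      hderiv φ (inducedCoeff D φ v) c (hess L φ a b) v := fun a b c => by
    rw [theta_add_theta hL.mem hv, dtcoord_hvec hL.mem hv.2, pd_gcomp_eq_pd_hess hL hg hv, pd_hvec]
  have hc := h.theta_hvec_comm hL.mem hv
  rw [christoffel, ← hs, ← hs, ← hs, hc a c b, hc c a b, hc b a c]
  ring

theorem Compatible.adaptedAt (h : Compatible g D) (hL : LagrangianOn φ L)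
    (hg : ∀ v ∈ slitDom φ, ∀ a b, gcomp g φ a b v = hess L φ a b v) (hv : v ∈ slitDom φ) :
    AdaptedAt g D L φ v := by
  have hφ := hL.mem
  have hε := condEpsilon_iff.1 h.2.2.2.2 φ hφ v hv
  have hN : inducedCoeff D φ v = fun a c => barthelCoeff L φ a c v := by
    refine hL.barthelCoeff_unique hv fun a c => ?_
    -- The identity ω_{ab} = θ_{ab} - (Dg)_{ab}/2, evaluated on δ_c.
    have h1 : ∀ b, connLow D g φ v a b (hvec φ v (inducedCoeff D φ v) c) =
        christoffel L φ (inducedCoeff D φ v) v a b c - (1 / 2 : ℝ) *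
        (pd φ (dtcoord φ v (hvec φ v (inducedCoeff D φ v) c)) (gcomp g φ b a) v
          - connLow D g φ v a b (hvec φ v (inducedCoeff D φ v) c)
          - connLow D g φ v b a (hvec φ v (inducedCoeff D φ v) c)) := fun b => by
      rw [← h.theta_hvec hL hg hv, theta, pd_gcomp_comm hφ hv b a]
      ring
    -- Since ω̄(δ_c) = 0, the coefficient N^d_c is ω^d_b(δ_c) y^b.
    have h2 : ∀ d, inducedCoeff D φ v d c = ∑ b, connForm D φ v d b
        (hvec φ v (inducedCoeff D φ v) c) * ycoord φ b v := fun d => by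
      have h3 := congrArg (fun x : Coord n => x d) (h.comp_omegaBar_hvec hφ hv c)
      simp only [comp_omegaBar D hφ hv, dtcoord_hvec hφ hv.2, PiLp.zero_apply] at h3
      linarith
    calc ∑ d, hess L φ a d v * inducedCoeff D φ v d c
        = ∑ d, gcomp g φ a d v * ∑ b, connForm D φ v d b
            (hvec φ v (inducedCoeff D φ v) c) * ycoord φ b v :=
          Finset.sum_congr rfl fun d _ => by rw [hg v hv, ← h2]
      _ = ∑ b, ycoord φ b v * connLow D g φ v a b (hvec φ v (inducedCoeff D φ v) c) :=
          sum_gcomp_sum_connForm _ _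
      _ = ∑ b, ycoord φ b v * christoffel L φ (inducedCoeff D φ v) v a b c := by
          -- The two sides differ by -y^b (Dg)_{ba}(δ_c)/2, which is zero by (ε).
          rw [← sub_eq_zero, ← Finset.sum_sub_distrib]
          have h4 := hε (hvec φ v (inducedCoeff D φ v) c) a
          calc _ = ∑ b, -(1 / 2 : ℝ) * (ycoord φ b v *
                (pd φ (dtcoord φ v (hvec φ v (inducedCoeff D φ v) c)) (gcomp g φ b a) v
                - connLow D g φ v a b (hvec φ v (inducedCoeff D φ v) c)
                - connLow D g φ v b a (hvec φ v (inducedCoeff D φ v) c))) :=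
                Finset.sum_congr rfl fun b _ => by
                  linear_combination ycoord φ b v * h1 b
            _ = 0 := by rw [← Finset.mul_sum, h4, mul_zero]
  have hω : ∀ X a, comp φ v (omegaBar D v X) a =
      (dtcoord φ v X).2 a + ∑ c, inducedCoeff D φ v a c * (dtcoord φ v X).1 c :=
    h.comp_omegaBar_eq hφ hv
  refine ⟨fun X a => by rw [hω, hN], fun X a b => ?_, hε⟩
  rw [(isLinearMap_theta D g a b).eq_sum_hvec_add_sum_vvec hφ hv.2 (inducedCoeff D φ v) X]
  congr 1
  · exact Finset.sum_congr rfl fun c _ => by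
      rw [h.theta_hvec hL hg hv, hN, gammaLow_eq_christoffel, mul_comm]
  · refine Finset.sum_congr rfl fun c _ => ?_
    -- On vertical vectors θ_{ab} is symmetric by (β), hence half the derivative of g_{ab}: the
    -- Cartan torsion.
    have h5 := theta_add_theta (D := D) (g := g) hφ hv a b (vvec φ v c)
    rw [theta_comm_of_condBeta h.2.1 hφ hv (by rw [dtcoord_vvec hφ hv.2]) b a,
      dtcoord_vvec hφ hv.2, pd_gcomp_eq_pd_hess hL hg hv] at h5
    have h6 : theta D g φ v a b (vvec φ v c) = (1 / 2 : ℝ) * pdy φ c (hess L φ a b) v := by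
      rw [pdy_eq_pd]
      linarith
    rw [h6, hω, mul_comm]

end Adapted

/-! ### The canonical form of the connection coefficients -/

section CanonicalForm

variable {φ : OpenPartialHomeomorph M (Coord n)} {v : TangentBundle (𝓡 n) M}
  {g : FinslerMetric n M} {D : FinslerConnection n M} {L : TangentBundle (𝓡 n) M → ℝ}

theorem isInvertible_of_injective {E F : Type*} [NormedAddCommGroup E] [NormedSpace ℝ E]
    [NormedAddCommGroup F] [NormedSpace ℝ F] [FiniteDimensional ℝ E] [FiniteDimensional ℝ F]
    (A : E →L[ℝ] F) (hA : ∀ x, A x = 0 → x = 0)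
    (h : Module.finrank ℝ E = Module.finrank ℝ F) : A.IsInvertible := by
  have hinj : Function.Injective A.toLinearMap := (injective_iff_map_eq_zero A.toLinearMap).2 hA
  refine ⟨(LinearEquiv.ofInjectiveOfFinrankEq A.toLinearMap hinj h).toContinuousLinearEquiv, ?_⟩
  ext x
  rfl

/-- Regularity is injectivity of (ω, ω̄), and both sides have dimension 2n. So the default value of
`inverse` never enters `lift`. -/
theorem Regular.isInvertible (hD : Regular D) (hv : v ∈ Slit n M) :
    ((omega v).prod (omegaBar D v)).IsInvertible :=
  isInvertible_of_injective (E := Coord n × Coord n) (F := Coord n × Coord n)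
    ((omega v).prod (omegaBar D v))
    (fun X hX => hD v hv X (congrArg Prod.fst hX) (congrArg Prod.snd hX)) rfl

theorem Regular.omega_lift (hD : Regular D) (hv : v ∈ Slit n M) (p : PB n M v × PB n M v) :
    omega v (lift D v p) = p.1 :=
  congrArg Prod.fst ((hD.isInvertible hv).self_apply_inverse p)

theorem Regular.omegaBar_lift (hD : Regular D) (hv : v ∈ Slit n M) (p : PB n M v × PB n M v) :
    omegaBar D v (lift D v p) = p.2 :=
  congrArg Prod.snd ((hD.isInvertible hv).self_apply_inverse p)

theorem Regular.eq_of_omega_eq (hD : Regular D) (hv : v ∈ Slit n M)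
    {X Y : TangentSpace (𝓡 n).tangent v} (h : omega v X = omega v Y)
    (h' : omegaBar D v X = omegaBar D v Y) : X = Y := by
  rw [← sub_eq_zero]
  exact hD v hv _ (by rw [map_sub, h, sub_self]) (by rw [map_sub, h', sub_self])

theorem Regular.eq_sum_lift (hD : Regular D) (hφ : φ ∈ IsManifold.maximalAtlas (𝓡 n) ∞ M)
    (hv : v ∈ slitDom φ) (X : TangentSpace (𝓡 n).tangent v) :
    X = ∑ c, (dtcoord φ v X).1 c • lift D v (frame φ c v, 0) +
      ∑ c, comp φ v (omegaBar D v X) c • lift D v (0, frame φ c v) := by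
  refine hD.eq_of_omega_eq hv.1 ?_ ?_
  · simp only [map_add, map_sum, map_smul, hD.omega_lift hv.1, smul_zero, Finset.sum_const_zero,
      add_zero]
    rw [← comp_omega hφ hv.2]
    exact sum_comp_smul_frame hφ hv.2 _
  · simp only [map_add, map_sum, map_smul, hD.omegaBar_lift hv.1, smul_zero, Finset.sum_const_zero,
      zero_add]
    exact sum_comp_smul_frame hφ hv.2 _

theorem pd_eq_sum_hderiv (f : TangentBundle (𝓡 n) M → ℝ) (N : Fin n → Fin n → ℝ)
    (z : Coord n × Coord n) : pd φ z f v = ∑ c, hderiv φ N c f v * z.1 c +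
      ∑ a, pdy φ a f v * (z.2 a + ∑ c, N a c * z.1 c) := by
  have h : ∑ c, (∑ a, N a c * pdy φ a f v) * z.1 c = ∑ a, pdy φ a f v * ∑ c, N a c * z.1 c := by
    simp only [Finset.mul_sum, Finset.sum_mul]
    rw [Finset.sum_comm]
    exact Finset.sum_congr rfl fun _ _ => Finset.sum_congr rfl fun _ _ => by ring
  simp only [pd_eq_sum z, hderiv, sub_mul, mul_add, Finset.sum_add_distrib,
    Finset.sum_sub_distrib, h, mul_comm (z.1 _), mul_comm (z.2 _)]
  ring

namespace LagrangianOn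

theorem gammaLow_comm (hL : LagrangianOn φ L) (hv : v ∈ slitDom φ) (a b c : Fin n) :
    gammaLow L φ v a b c = gammaLow L φ v a c b := by
  have h : ∀ a b c, delta L φ c (hess L φ a b) v = delta L φ c (hess L φ b a) v := fun a b c => by
    simp only [delta, pdx_eq_pd, pdy_eq_pd, pd_hess_comm hL.mem hL.smooth hv a b]
  rw [gammaLow, gammaLow, h b c a]
  ring

theorem gammaLow_add_gammaLow (hL : LagrangianOn φ L) (hv : v ∈ slitDom φ) (a b c : Fin n) :
    gammaLow L φ v a b c + gammaLow L φ v b a c = hderiv φ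
      (fun a c => barthelCoeff L φ a c v) c (hess L φ a b) v := by
  have h : ∀ a b c, delta L φ c (hess L φ a b) v = delta L φ c (hess L φ b a) v := fun a b c => by
    simp only [delta, pdx_eq_pd, pdy_eq_pd, pd_hess_comm hL.mem hL.smooth hv a b]
  rw [gammaLow, gammaLow, h b a c]
  change _ = delta L φ c (hess L φ a b) v
  ring

end LagrangianOn

theorem lower_hCoeff (a b c : Fin n) : lower g φ v (hCoeff D φ v) a b c =
    connLow D g φ v a b (lift D v (frame φ c v, 0)) := rfl

theorem lower_vCoeff (a b c : Fin n) : lower g φ v (vCoeff D φ v) a b c =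
    connLow D g φ v a b (lift D v (0, frame φ c v)) := rfl

namespace AdaptedAt

theorem lift_frame_zero (h : AdaptedAt g D L φ v) (hD : Regular D)
    (hφ : φ ∈ IsManifold.maximalAtlas (𝓡 n) ∞ M) (hv : v ∈ slitDom φ) (c : Fin n) :
    lift D v (frame φ c v, 0) = hvec φ v (fun a c => barthelCoeff L φ a c v) c := by
  refine hD.eq_of_omega_eq hv.1 ?_ ?_
  · rw [hD.omega_lift hv.1]
    refine comp_injective hφ hv.2 ?_
    rw [comp_omega hφ hv.2, dtcoord_hvec hφ hv.2, comp_frame hφ hv.2]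
  · rw [hD.omegaBar_lift hv.1]
    refine comp_injective hφ hv.2 ?_
    ext a
    rw [h.comp_omegaBar, dtcoord_hvec hφ hv.2, comp_zero]
    simp [PiLp.single_apply]

theorem lift_zero_frame (h : AdaptedAt g D L φ v) (hD : Regular D)
    (hφ : φ ∈ IsManifold.maximalAtlas (𝓡 n) ∞ M) (hv : v ∈ slitDom φ) (c : Fin n) :
    lift D v (0, frame φ c v) = vvec φ v c := by
  refine hD.eq_of_omega_eq hv.1 ?_ ?_
  · rw [hD.omega_lift hv.1]
    refine comp_injective hφ hv.2 ?_
    rw [comp_omega hφ hv.2, dtcoord_vvec hφ hv.2, comp_zero]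
  · rw [hD.omegaBar_lift hv.1]
    refine comp_injective hφ hv.2 ?_
    ext a
    rw [h.comp_omegaBar, dtcoord_vvec hφ hv.2, comp_frame hφ hv.2]
    simp

theorem eq_zero (h : AdaptedAt g D L φ v) (hφ : φ ∈ IsManifold.maximalAtlas (𝓡 n) ∞ M)
    (hv : v ∈ slitDom φ) {X : TangentSpace (𝓡 n).tangent v} (h1 : omega v X = 0)
    (h2 : omegaBar D v X = 0) : X = 0 := by
  have h3 : (dtcoord φ v X).1 = 0 := by rw [← comp_omega hφ hv.2, h1, comp_zero]
  have h4 : (dtcoord φ v X).2 = 0 := by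
    ext a
    have := h.comp_omegaBar X a
    rw [h2, comp_zero, h3] at this
    simpa using this.symm
  rw [← dtcoordSymm_dtcoord hφ hv.2 X, show dtcoord φ v X = 0 from Prod.ext h3 h4, map_zero]

/-- The difference is -(Dg)_{ab}/2, which is symmetric; by (ε) it is also annihilated by y. These
are the properties of Λ. -/
theorem connLow_sub_theta_comm (hφ : φ ∈ IsManifold.maximalAtlas (𝓡 n) ∞ M) (hv : v ∈ slitDom φ)
    (X : TangentSpace (𝓡 n).tangent v) (a b : Fin n) :
    connLow D g φ v a b X - theta D g φ v a b X = connLow D g φ v b a X - theta D g φ v b a X := by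
  rw [theta, theta, pd_gcomp_comm hφ hv b a]
  ring

theorem sum_ycoord_connLow_sub_theta (h : AdaptedAt g D L φ v)
    (X : TangentSpace (𝓡 n).tangent v) (b : Fin n) :
    ∑ a, ycoord φ a v * (connLow D g φ v a b X - theta D g φ v a b X) = 0 := by
  calc _ = ∑ a, -(1 / 2 : ℝ) * (ycoord φ a v * (pd φ (dtcoord φ v X) (gcomp g φ a b) v
          - connLow D g φ v b a X - connLow D g φ v a b X)) :=
        Finset.sum_congr rfl fun a _ => by rw [theta]; ring
    _ = 0 := by rw [← Finset.mul_sum, h.epsilon, mul_zero]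

theorem theta_hvec (h : AdaptedAt g D L φ v) (hφ : φ ∈ IsManifold.maximalAtlas (𝓡 n) ∞ M)
    (hv : v ∈ slitDom φ) (a b c : Fin n) :
    theta D g φ v a b (hvec φ v (fun a c => barthelCoeff L φ a c v) c) = gammaLow L φ v a b c := by
  rw [h.theta_eq]
  simp only [h.comp_omegaBar, dtcoord_hvec hφ hv.2]
  simp [PiLp.single_apply]

theorem theta_vvec (h : AdaptedAt g D L φ v) (hφ : φ ∈ IsManifold.maximalAtlas (𝓡 n) ∞ M)
    (hv : v ∈ slitDom φ) (a b c : Fin n) :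
    theta D g φ v a b (vvec φ v c) = (1 / 2 : ℝ) * pdy φ c (hess L φ a b) v := by
  rw [h.theta_eq]
  simp only [h.comp_omegaBar, dtcoord_vvec hφ hv.2]
  simp [PiLp.single_apply]

end AdaptedAt

/-- The coefficients of an adapted connection have the canonical form. -/
theorem hasCanonicalForm_of_adaptedAt (hD : Regular D)
    (hL : ∀ φ ∈ IsManifold.maximalAtlas (𝓡 n) ∞ M, LagrangianOn φ L)
    (h : ∀ φ ∈ IsManifold.maximalAtlas (𝓡 n) ∞ M, ∀ v ∈ slitDom φ, AdaptedAt g D L φ v) :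
    HasCanonicalForm L g D := by
  intro φ hφ v hv hvφ
  have hv' : v ∈ slitDom φ := ⟨hv, hvφ⟩
  have h := h φ hφ v hv'
  have hL := hL φ hφ
  -- Λ_{abc} is the value of ω_{ab} - θ_{ab} on δ_c, where θ_{ab} itself takes the value Γ_{abc}.
  refine ⟨⟨fun a b c => connLow D g φ v a b (hvec φ v (fun a c => barthelCoeff L φ a c v) c) -
    theta D g φ v a b (hvec φ v (fun a c => barthelCoeff L φ a c v) c), fun a b c => ?_,
    fun a b c => AdaptedAt.connLow_sub_theta_comm hφ hv' _ a b,
    fun b c => h.sum_ycoord_connLow_sub_theta _ b⟩, fun a b c => ?_, fun b c => ?_⟩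
  · rw [lower_hCoeff, h.lift_frame_zero hD hφ hv', ← h.theta_hvec hφ hv']
    ring
  · rw [lower_vCoeff, lower_vCoeff, h.lift_zero_frame hD hφ hv']
    have h1 := AdaptedAt.connLow_sub_theta_comm (D := D) (g := g) hφ hv' (vvec φ v c) a b
    rw [h.theta_vvec hφ hv', h.theta_vvec hφ hv',
      show pdy φ c (hess L φ a b) v = pdy φ c (hess L φ b a) v from
        pd_hess_comm hφ hL.smooth hv' a b _] at h1
    linarith
  -- V_{abc} is the value of ω_{ab} - θ_{ab} on ∂/∂y^c plus the Cartan torsion, and y annihilates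
  -- both.
  · have h1 := h.sum_ycoord_connLow_sub_theta (vvec φ v c) b
    simp only [h.theta_vvec hφ hv', mul_sub, Finset.sum_sub_distrib, mul_left_comm _ (1 / 2 : ℝ),
      ← Finset.mul_sum, hL.euler_pdy_hess hv', mul_zero, sub_zero] at h1
    simp only [lower_vCoeff, h.lift_zero_frame hD hφ hv']
    exact h1

theorem stronglyRegular_of_adaptedAt
    (h : ∀ φ ∈ IsManifold.maximalAtlas (𝓡 n) ∞ M, ∀ v ∈ slitDom φ, AdaptedAt g D L φ v) :
    StronglyRegular D := by
  intro v hv u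
  have hv' : v ∈ slitDom (chartAt (Coord n) v.proj) := ⟨hv, mem_chartDom_chartAt v⟩
  refine comp_injective (chartAt_mem v) hv'.2 ?_
  ext a
  rw [(h _ (chartAt_mem v) v hv').comp_omegaBar, dtcoord_verticalLift (chartAt_mem v) hv'.2]
  simp

theorem isBarthel_of_adaptedAt
    (h : ∀ φ ∈ IsManifold.maximalAtlas (𝓡 n) ∞ M, ∀ v ∈ slitDom φ, AdaptedAt g D L φ v) :
    IsBarthel L (inducedHorizontal D) := by
  intro φ hφ v hv hvφ X
  have h1 := (h φ hφ v ⟨hv, hvφ⟩).comp_omegaBar X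
  have h2 : X ∈ inducedHorizontal D v ↔ omegaBar D v X = 0 := Iff.rfl
  rw [h2]
  refine ⟨fun h3 a => ?_, fun h3 => comp_injective hφ hvφ ?_⟩
  · refine (h1 a).symm.trans ?_
    rw [h3, comp_zero]
    rfl
  · ext a
    rw [h1, comp_zero]
    exact h3 a

/-- A regular connection whose coefficients have the canonical form is adapted. -/
theorem adaptedAt_of_hasCanonicalForm (hD : Regular D) (h : HasCanonicalForm L g D)
    (hL : LagrangianOn φ L) (hg : ∀ v ∈ slitDom φ, ∀ a b, gcomp g φ a b v = hess L φ a b v)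
    (hv : v ∈ slitDom φ) : AdaptedAt g D L φ v := by
  have hφ := hL.mem
  obtain ⟨⟨Λ, hΛ, hΛs, hΛy⟩, hVs, hVy⟩ := h φ hφ v hv.1 hv.2
  have hlow : ∀ X a b, connLow D g φ v a b X =
      ∑ c, (gammaLow L φ v a b c + Λ a b c) * (dtcoord φ v X).1 c +
      ∑ c, lower g φ v (vCoeff D φ v) a b c * comp φ v (omegaBar D v X) c := fun X a b => by
    have h1 := congrArg ((isLinearMap_connLow D g a b).mk' (connLow D g φ v a b)) (hD.eq_sum_lift hφ hv X)
    rw [map_add, map_sum, map_sum] at h1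
    simp only [map_smul] at h1
    refine h1.trans ?_
    simp only [← hΛ, lower_hCoeff, lower_vCoeff, smul_eq_mul, mul_comm]
    rfl
  have hΛy' : ∀ a c, ∑ b, ycoord φ b v * Λ a b c = 0 := fun a c => by
    simp only [hΛs a]
    exact hΛy a c
  have hVy' : ∀ a c, ∑ b, ycoord φ b v * lower g φ v (vCoeff D φ v) a b c = 0 := fun a c => by
    simp only [hVs a]
    exact hVy a c
  -- In the expansion `hlow`, contraction with y^b removes Λ and V, hence every ω̄ on the right, and
  -- turns Γ_{abc} into Barthel's coefficients.
  have hω : ∀ X a, comp φ v (omegaBar D v X) a =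
      (dtcoord φ v X).2 a + ∑ c, barthelCoeff L φ a c v * (dtcoord φ v X).1 c := fun X a => by
    rw [comp_omegaBar D hφ hv]
    congr 1
    refine congrFun (eq_of_sum_hess (hL.det_ne_zero v hv)
      (x := fun a => ∑ b, connForm D φ v a b X * ycoord φ b v)
      (y := fun a => ∑ c, barthelCoeff L φ a c v * (dtcoord φ v X).1 c) fun a => ?_) a
    simp only [← hg v hv, sum_gcomp_sum_connForm, hlow, mul_add, Finset.sum_add_distrib]
    have h1 : ∀ (F : Fin n → Fin n → ℝ) (x : Coord n), ∑ b, ycoord φ b v * ∑ c, F b c * x c =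
        ∑ c, (∑ b, ycoord φ b v * F b c) * x c := fun F x => by
      simp only [Finset.mul_sum, Finset.sum_mul]
      rw [Finset.sum_comm]
      exact Finset.sum_congr rfl fun _ _ => Finset.sum_congr rfl fun _ _ => by ring
    rw [h1, h1]
    simp only [mul_add, Finset.sum_add_distrib, hΛy', hVy', hL.euler_gammaLow hv, zero_mul,
      Finset.sum_const_zero, add_zero, hg v hv, Finset.mul_sum, Finset.sum_mul]
    rw [Finset.sum_comm]
    exact Finset.sum_congr rfl fun _ _ => Finset.sum_congr rfl fun _ _ => by ring
  have hpd : ∀ X a b, pd φ (dtcoord φ v X) (gcomp g φ a b) v =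
      ∑ c, (gammaLow L φ v a b c + gammaLow L φ v b a c) * (dtcoord φ v X).1 c +
      ∑ c, pdy φ c (hess L φ a b) v * comp φ v (omegaBar D v X) c := fun X a b => by
    rw [pd_gcomp_eq_pd_hess hL hg hv, pd_eq_sum_hderiv _ fun a c => barthelCoeff L φ a c v]
    simp only [hL.gammaLow_add_gammaLow hv, hω]
  -- The symmetric Λ and V cancel in ω_{ab} - ω_{ba}.
  have hθ : ∀ X a b, theta D g φ v a b X = ∑ c, gammaLow L φ v a b c * (dtcoord φ v X).1 c +
      ∑ c, (1 / 2 : ℝ) * pdy φ c (hess L φ a b) v * comp φ v (omegaBar D v X) c := fun X a b => by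
    rw [theta, hpd, hlow, hlow]
    simp only [hΛs b a, hVs b a, add_mul, Finset.sum_add_distrib, mul_assoc, ← Finset.mul_sum]
    ring
  refine ⟨hω, hθ, fun X b => ?_⟩
  -- Here (Dg)_{ab} = -2Λ_{abc} dx^c + (∂g_{ab}/∂y^c - 2V_{abc}) ω̄^c, and y^a annihilates each
  -- coefficient.
  have h2 : ∀ a, pd φ (dtcoord φ v X) (gcomp g φ a b) v - connLow D g φ v b a X
      - connLow D g φ v a b X = -2 * ∑ c, Λ a b c * (dtcoord φ v X).1 c +
      ∑ c, (pdy φ c (hess L φ a b) v - 2 * lower g φ v (vCoeff D φ v) a b c) *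
        comp φ v (omegaBar D v X) c := fun a => by
    rw [hpd, hlow, hlow]
    simp only [hΛs b a, hVs b a, add_mul, sub_mul, Finset.sum_add_distrib, Finset.sum_sub_distrib,
      mul_assoc, ← Finset.mul_sum]
    ring
  have h1 : ∀ (F : Fin n → Fin n → ℝ) (x : Coord n), ∑ b, ycoord φ b v * ∑ c, F b c * x c =
      ∑ c, (∑ b, ycoord φ b v * F b c) * x c := fun F x => by
    simp only [Finset.mul_sum, Finset.sum_mul]
    rw [Finset.sum_comm]
    exact Finset.sum_congr rfl fun _ _ => Finset.sum_congr rfl fun _ _ => by ring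
  simp only [h2, mul_add, Finset.sum_add_distrib, mul_left_comm _ (-2 : ℝ), ← Finset.mul_sum, h1]
  simp only [mul_sub, Finset.sum_sub_distrib, mul_left_comm _ (2 : ℝ), ← Finset.mul_sum,
    hL.euler_pdy_hess hv]
  have h3 : ∀ c, ∑ a, ycoord φ a v * Λ a b c = 0 := fun c => hΛy b c
  have h4 : ∀ c, ∑ a, ycoord φ a v * lower g φ v (vCoeff D φ v) a b c = 0 := fun c => hVy b c
  simp [h3, h4]

end CanonicalForm

/-! ### Adapted connections satisfy (α)-(ε) -/

section Compatible

variable {φ : OpenPartialHomeomorph M (Coord n)} {v : TangentBundle (𝓡 n) M}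
  {g : FinslerMetric n M} {D : FinslerConnection n M} {L : TangentBundle (𝓡 n) M → ℝ}

/-- The trilinear form `C_{abc} x^a y^b z^c`, with the Cartan torsion `C` of `𝓛`. -/
def cartanForm (L : TangentBundle (𝓡 n) M → ℝ) (φ : OpenPartialHomeomorph M (Coord n))
    (v : TangentBundle (𝓡 n) M) (x y z : Coord n) : ℝ :=
  ∑ a, ∑ b, ∑ c, (1 / 2 : ℝ) * pdy φ c (hess L φ a b) v * x a * y b * z c

namespace LagrangianOn

theorem cartanForm_swap (hL : LagrangianOn φ L) (hv : v ∈ slitDom φ) (x y z : Coord n) :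
    cartanForm L φ v x y z = cartanForm L φ v y x z := by
  rw [cartanForm, Finset.sum_comm]
  refine Finset.sum_congr rfl fun b _ => Finset.sum_congr rfl fun a _ =>
    Finset.sum_congr rfl fun c _ => ?_
  rw [show pdy φ c (hess L φ a b) v = pdy φ c (hess L φ b a) v from
    pd_hess_comm hL.mem hL.smooth hv a b _]
  ring

theorem cartanForm_swap_outer (hL : LagrangianOn φ L) (hv : v ∈ slitDom φ) (x y z : Coord n) :
    cartanForm L φ v x y z = cartanForm L φ v z y x := by
  simp only [cartanForm]
  rw [Finset.sum_comm]
  conv_rhs => rw [Finset.sum_comm]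
  refine Finset.sum_congr rfl fun b _ => ?_
  rw [Finset.sum_comm]
  refine Finset.sum_congr rfl fun c _ => Finset.sum_congr rfl fun a _ => ?_
  rw [pdy_hess_comm hL.mem hL.smooth hv a b c]
  ring

theorem cartanForm_liouville (hL : LagrangianOn φ L) (hv : v ∈ slitDom φ) (y z : Coord n) :
    cartanForm L φ v (comp φ v (liouville v)) y z = 0 := by
  rw [cartanForm, Finset.sum_comm]
  refine Finset.sum_eq_zero fun b _ => ?_
  rw [Finset.sum_comm]
  refine Finset.sum_eq_zero fun c _ => ?_
  calc _ = (1 / 2 : ℝ) * y b * z c * ∑ a, ycoord φ a v * pdy φ c (hess L φ a b) v := by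
        rw [Finset.mul_sum]
        exact Finset.sum_congr rfl fun a _ => by rw [ycoord]; ring
    _ = 0 := by rw [hL.euler_pdy_hess hv, mul_zero]

end LagrangianOn

/-- In Ψ_a = θ_{ab} ∧ dx^b the part Γ_{abc} dx^c ∧ dx^b vanishes by symmetry in b and c, so only the
Cartan torsion remains. -/
theorem AdaptedAt.metric_canonicalTorsion (h : AdaptedAt g D L φ v) (hL : LagrangianOn φ L)
    (hv : v ∈ slitDom φ) (X Y : TangentSpace (𝓡 n).tangent v) (u : PB n M v) :
    g.toFun v (canonicalTorsion D g v X Y) u =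
      cartanForm L φ v (comp φ v u) (dtcoord φ v Y).1 (comp φ v (omegaBar D v X)) -
      cartanForm L φ v (comp φ v u) (dtcoord φ v X).1 (comp φ v (omegaBar D v Y)) := by
  rw [metric_canonicalTorsion_apply hL.mem hv, cartanForm, cartanForm, ← Finset.sum_sub_distrib]
  refine Finset.sum_congr rfl fun a _ => ?_
  have h1 : ∑ b, ∑ c, gammaLow L φ v a b c * (dtcoord φ v X).1 c * (dtcoord φ v Y).1 b =
      ∑ b, ∑ c, gammaLow L φ v a b c * (dtcoord φ v Y).1 c * (dtcoord φ v X).1 b := by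
    rw [Finset.sum_comm]
    refine Finset.sum_congr rfl fun b _ => Finset.sum_congr rfl fun c _ => ?_
    rw [hL.gammaLow_comm hv a c b]
    ring
  simp only [h.theta_eq, add_mul, Finset.sum_add_distrib, Finset.sum_sub_distrib, Finset.sum_mul,
    h1]
  rw [add_sub_add_left_eq_sub, sub_mul]
  simp only [Finset.sum_mul]
  congr 1 <;> exact Finset.sum_congr rfl fun b _ => Finset.sum_congr rfl fun c _ => by ring

theorem regular_of_adaptedAt
    (h : ∀ φ ∈ IsManifold.maximalAtlas (𝓡 n) ∞ M, ∀ v ∈ slitDom φ, AdaptedAt g D L φ v) :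
    Regular D := fun v hv _ h1 h2 =>
  have hv' : v ∈ slitDom (chartAt (Coord n) v.proj) := ⟨hv, mem_chartDom_chartAt v⟩
  (h _ (chartAt_mem v) v hv').eq_zero (chartAt_mem v) hv' h1 h2

/-- With Ψ_a = C_{abc} ω̄^c ∧ dx^b, a further wedge with dx^a or ω̄^a contracts a totally symmetric
tensor with a form that is antisymmetric in two of its indices; (γ) is y^a C_{abc} = 0. -/
theorem compatible_of_adaptedAt
    (hL : ∀ φ ∈ IsManifold.maximalAtlas (𝓡 n) ∞ M, LagrangianOn φ L)
    (h : ∀ φ ∈ IsManifold.maximalAtlas (𝓡 n) ∞ M, ∀ v ∈ slitDom φ, AdaptedAt g D L φ v) :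
    Compatible g D := by
  refine ⟨regular_of_adaptedAt h, fun v hv X Y Z => ?_, fun v hv X Y => ?_,
    fun v hv X Y Z => ?_, condEpsilon_iff.2 fun φ hφ v hv => (h φ hφ v hv).epsilon⟩
  all_goals
    have hφ := chartAt_mem v
    have hv' : v ∈ slitDom (chartAt (Coord n) v.proj) := ⟨hv, mem_chartDom_chartAt v⟩
    have hL' := hL _ hφ
    have hs := hL'.cartanForm_swap hv'
    have ho := hL'.cartanForm_swap_outer hv'
  · simp only [wedgeMetric, (h _ hφ v hv').metric_canonicalTorsion hL' hv',
      comp_omega hφ hv'.2]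
    rw [hs (dtcoord _ v Z).1 (dtcoord _ v Y).1, hs (dtcoord _ v Z).1 (dtcoord _ v X).1,
      hs (dtcoord _ v X).1 (dtcoord _ v Y).1]
    ring
  · rw [(h _ hφ v hv').metric_canonicalTorsion hL' hv', hL'.cartanForm_liouville hv',
      hL'.cartanForm_liouville hv', sub_zero]
  · simp only [wedgeMetric, (h _ hφ v hv').metric_canonicalTorsion hL' hv']
    rw [ho (comp _ v (omegaBar D v Z)) (dtcoord _ v Y).1,
      ho (comp _ v (omegaBar D v Z)) (dtcoord _ v X).1,
      ho (comp _ v (omegaBar D v X)) (dtcoord _ v Y).1,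
      ho (comp _ v (omegaBar D v X)) (dtcoord _ v Z).1]
    ring

theorem compatible_of_hasCanonicalForm (hL : IsFinslerLagrangian L) (hg : IsVerticalHessian L g)
    (hD : Regular D) (h : HasCanonicalForm L g D) : Compatible g D :=
  compatible_of_adaptedAt (fun _ hφ => hL.lagrangianOn hg hφ) fun _ hφ _ hv =>
    adaptedAt_of_hasCanonicalForm hD h (hL.lagrangianOn hg hφ)
      (fun _ hv => gcomp_eq_hess hφ (hL.smoothOver hφ) hg hv) hv

theorem Compatible.adaptedAt_energy (h : Compatible g D)
    (hφ : φ ∈ IsManifold.maximalAtlas (𝓡 n) ∞ M) (hv : v ∈ slitDom φ) :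
    AdaptedAt g D (energy g) φ v := by
  obtain ⟨hL, hg⟩ := isFinslerLagrangian_energy h.2.1 h.2.2.1
  exact h.adaptedAt (hL.lagrangianOn hg hφ)
    (fun _ hv => gcomp_eq_hess hφ (hL.smoothOver hφ) hg hv) hv

theorem Compatible.consequences (h : Compatible g D) :
    HasCanonicalForm (energy g) g D ∧ StronglyRegular D ∧
      IsBarthel (energy g) (inducedHorizontal D) := by
  obtain ⟨hL, hg⟩ := isFinslerLagrangian_energy h.2.1 h.2.2.1
  have ha := fun φ hφ v hv => h.adaptedAt_energy (φ := φ) (v := v) hφ hv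
  exact ⟨hasCanonicalForm_of_adaptedAt h.1 (fun φ hφ => hL.lagrangianOn hg hφ) ha,
    stronglyRegular_of_adaptedAt ha, isBarthel_of_adaptedAt ha⟩

/-! ### The notable connections -/

section Notable

theorem lower_eq_sum_hess (hg : ∀ v ∈ slitDom φ, ∀ a b, gcomp g φ a b v = hess L φ a b v)
    (hv : v ∈ slitDom φ) (F : Fin n → Fin n → Fin n → ℝ) (a b c : Fin n) :
    lower g φ v F a b c = ∑ d, hess L φ a d v * F d b c :=
  Finset.sum_congr rfl fun d _ => congrArg (· * _) (hg v hv a d)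

theorem LagrangianOn.lower_gammaUp (hL : LagrangianOn φ L)
    (hg : ∀ v ∈ slitDom φ, ∀ a b, gcomp g φ a b v = hess L φ a b v) (hv : v ∈ slitDom φ)
    (a b c : Fin n) : lower g φ v (gammaUp L φ v) a b c = gammaLow L φ v a b c := by
  rw [lower_eq_sum_hess hg hv]
  exact hess_mul_hessInv (hL.det_ne_zero v hv) _ a

theorem LagrangianOn.lower_cartanUp (hL : LagrangianOn φ L)
    (hg : ∀ v ∈ slitDom φ, ∀ a b, gcomp g φ a b v = hess L φ a b v) (hv : v ∈ slitDom φ)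
    (a b c : Fin n) :
    lower g φ v (cartanUp L φ v) a b c = (1 / 2 : ℝ) * pdy φ a (hess L φ b c) v := by
  rw [lower_eq_sum_hess hg hv]
  exact hess_mul_hessInv (hL.det_ne_zero v hv) _ a

/-- Exhibits the Λ of the Berwald and Hashiguchi connections. -/
theorem LagrangianOn.lower_berwaldUp (hL : LagrangianOn φ L)
    (hg : ∀ v ∈ slitDom φ, ∀ a b, gcomp g φ a b v = hess L φ a b v) (hv : v ∈ slitDom φ)
    (a b c : Fin n) : lower g φ v (berwaldUp L φ v) a b c =
      gammaLow L φ v a b c + -(1 / 2 : ℝ) * landsberg L φ v a b c := by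
  rw [lower_eq_sum_hess hg hv, hL.gammaLow_eq_berwaldLow hv]
  change berwaldLow L φ v a b c = _
  ring

theorem symmAnnihilated_zero : SymmAnnihilated φ v fun _ _ _ => 0 :=
  ⟨fun _ _ _ => rfl, fun _ _ => by simp⟩

theorem LagrangianOn.symmAnnihilated_landsberg (hL : LagrangianOn φ L) (hv : v ∈ slitDom φ) :
    SymmAnnihilated φ v fun a b c => -(1 / 2 : ℝ) * landsberg L φ v a b c := by
  refine ⟨fun a b c => congrArg _ (hL.landsberg_swap hv a b c), fun b c => ?_⟩
  have h := hL.euler_landsberg hv b c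
  simp only [mul_left_comm _ (-(1 / 2 : ℝ)), ← Finset.mul_sum]
  exact mul_eq_zero_of_right _ h

theorem LagrangianOn.symmAnnihilated_cartan (hL : LagrangianOn φ L) (hv : v ∈ slitDom φ) :
    SymmAnnihilated φ v fun a b c => (1 / 2 : ℝ) * pdy φ a (hess L φ b c) v := by
  refine ⟨fun a b c => congrArg _ (pdy_hess_comm hL.mem hL.smooth hv b c a), fun b c => ?_⟩
  have h := hL.euler_pdy_hess hv c b
  simp only [mul_left_comm _ (1 / 2 : ℝ), ← Finset.mul_sum]
  refine mul_eq_zero_of_right _ (h ▸ Finset.sum_congr rfl fun a _ => ?_)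
  rw [pdy_hess_comm hL.mem hL.smooth hv a c b]
  rfl

/-- The notable connections have the canonical form. -/
theorem hasCanonicalForm_of_hasCoefficients (hL : IsFinslerLagrangian L)
    (hg : IsVerticalHessian L g) {H V : OpenPartialHomeomorph M (Coord n) →
      TangentBundle (𝓡 n) M → Fin n → Fin n → Fin n → ℝ} (hD : HasCoefficients D H V)
    (hH : H = berwaldUp L ∨ H = gammaUp L) (hV : V = cartanUp L ∨ V = fun _ _ _ _ _ => 0) :
    HasCanonicalForm L g D := by
  intro φ hφ v hv hvφ
  have hv' : v ∈ slitDom φ := ⟨hv, hvφ⟩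
  have hL' := hL.lagrangianOn hg hφ
  have hg' : ∀ v ∈ slitDom φ, ∀ a b, gcomp g φ a b v = hess L φ a b v :=
    fun _ hv => gcomp_eq_hess hφ (hL.smoothOver hφ) hg hv
  have h := hD.2 φ hφ v hv hvφ
  rw [show hCoeff D φ v = H φ v from funext₃ fun a b c => (h a b c).1,
    show vCoeff D φ v = V φ v from funext₃ fun a b c => (h a b c).2]
  constructor
  · obtain rfl | rfl := hH
    · exact ⟨_, hL'.lower_berwaldUp hg' hv', hL'.symmAnnihilated_landsberg hv'⟩
    · exact ⟨_, fun a b c => by rw [hL'.lower_gammaUp hg' hv', add_zero], symmAnnihilated_zero⟩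
  · obtain rfl | rfl := hV
    · rw [show lower g φ v (cartanUp L φ v) = _ from
        funext₃ fun a b c => hL'.lower_cartanUp hg' hv' a b c]
      exact hL'.symmAnnihilated_cartan hv'
    · rw [show lower g φ v (fun _ _ _ => 0) = fun _ _ _ => 0 from
        funext₃ fun a b c => by simp [lower]]
      exact symmAnnihilated_zero

theorem compatible_of_hasCoefficients (hL : IsFinslerLagrangian L)
    (hg : IsVerticalHessian L g) {H V : OpenPartialHomeomorph M (Coord n) →
      TangentBundle (𝓡 n) M → Fin n → Fin n → Fin n → ℝ} (hD : HasCoefficients D H V)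
    (hH : H = berwaldUp L ∨ H = gammaUp L) (hV : V = cartanUp L ∨ V = fun _ _ _ _ _ => 0) :
    Compatible g D :=
  compatible_of_hasCanonicalForm hL hg hD.1 (hasCanonicalForm_of_hasCoefficients hL hg hD hH hV)

end Notable

end Compatible

/-! ### Smoothness of sections of homomorphism bundles -/

section HomBundle

/-- A basis of the finite-dimensional `F` identifies the space of linear maps with a finite power of
`G`. -/
theorem _root_.contMDiffAt_clm_of_apply {E H N F G : Type*} [NormedAddCommGroup E]
    [NormedSpace ℝ E] [TopologicalSpace H] {I : ModelWithCorners ℝ E H} [TopologicalSpace N]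
    [ChartedSpace H N] [NormedAddCommGroup F] [NormedSpace ℝ F] [FiniteDimensional ℝ F]
    [NormedAddCommGroup G] [NormedSpace ℝ G] {k : ℕ∞ω} {f : N → F →L[ℝ] G} {x : N}
    (h : ∀ y, ContMDiffAt I 𝓘(ℝ, G) k (fun x => f x y) x) :
    ContMDiffAt I 𝓘(ℝ, F →L[ℝ] G) k f x := by
  let d := Module.finrank ℝ F
  have hd : d = Module.finrank ℝ (Fin d → ℝ) := (Module.finrank_fin_fun ℝ).symm
  let e₁ := ContinuousLinearEquiv.ofFinrankEq hd
  let e₂ := (e₁.arrowCongr (1 : G ≃L[ℝ] G)).trans (ContinuousLinearEquiv.piRing (Fin d))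
  rw [← Function.id_comp f, ← e₂.symm_comp_self]
  exact e₂.symm.contDiff.contMDiff.contMDiffAt.comp x (contMDiffAt_pi_space.2 fun i => h _)

/-- In trivializations it is enough to apply `A` to constant vectors, and these are local values of
the smooth sections `FiberBundle.extend`. -/
theorem _root_.contMDiffAt_hom_section_of_apply {E H B : Type*} [NormedAddCommGroup E]
    [NormedSpace ℝ E] [TopologicalSpace H] {I : ModelWithCorners ℝ E H} [TopologicalSpace B]
    [ChartedSpace H B] {F₁ F₂ : Type*} [NormedAddCommGroup F₁]
    [NormedSpace ℝ F₁] [FiniteDimensional ℝ F₁] [NormedAddCommGroup F₂] [NormedSpace ℝ F₂]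
    {E₁ E₂ : B → Type*} [∀ x, AddCommGroup (E₁ x)] [∀ x, Module ℝ (E₁ x)]
    [TopologicalSpace (TotalSpace F₁ E₁)] [∀ x, TopologicalSpace (E₁ x)]
    [∀ x, AddCommGroup (E₂ x)] [∀ x, Module ℝ (E₂ x)]
    [TopologicalSpace (TotalSpace F₂ E₂)] [∀ x, TopologicalSpace (E₂ x)]
    [∀ x, IsTopologicalAddGroup (E₁ x)] [∀ x, ContinuousSMul ℝ (E₁ x)]
    [∀ x, IsTopologicalAddGroup (E₂ x)] [∀ x, ContinuousSMul ℝ (E₂ x)]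
    [FiberBundle F₁ E₁] [VectorBundle ℝ F₁ E₁] [FiberBundle F₂ E₂] [VectorBundle ℝ F₂ E₂]
    [ContMDiffVectorBundle ∞ F₁ E₁ I] [ContMDiffVectorBundle ∞ F₂ E₂ I]
    {A : Π x, E₁ x →L[ℝ] E₂ x} {x₀ : B}
    (h : ∀ X : Π x, E₁ x, ContMDiffAt I (I.prod 𝓘(ℝ, F₁)) ∞
        (fun x => TotalSpace.mk' F₁ x (X x)) x₀ →
      ContMDiffAt I (I.prod 𝓘(ℝ, F₂)) ∞ (fun x => TotalSpace.mk' F₂ x (A x (X x))) x₀) :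
    ContMDiffAt I (I.prod 𝓘(ℝ, F₁ →L[ℝ] F₂)) ∞
      (fun x => TotalSpace.mk' (F₁ →L[ℝ] F₂) (E := fun x => E₁ x →L[ℝ] E₂ x) x (A x)) x₀ := by
  refine (contMDiffAt_hom_bundle _).2 ⟨contMDiffAt_id, contMDiffAt_clm_of_apply fun y => ?_⟩
  have hX := h _ (FiberBundle.contMDiffAt_extend I F₁ ((trivializationAt F₁ E₁ x₀).symm x₀ y))
  refine ((contMDiffAt_totalSpace.1 hX).2).congr_of_eventuallyEq ?_
  filter_upwards [(trivializationAt F₁ E₁ x₀).open_baseSet.mem_nhds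
      (FiberBundle.mem_baseSet_trivializationAt' x₀),
    (trivializationAt F₂ E₂ x₀).open_baseSet.mem_nhds
      (FiberBundle.mem_baseSet_trivializationAt' x₀)] with x hx hx'
  rw [ContinuousLinearMap.inCoordinates_eq hx hx']
  simp [FiberBundle.extend,
    (trivializationAt F₁ E₁ x₀).apply_mk_symm (FiberBundle.mem_baseSet_trivializationAt' x₀)]

variable {φ : OpenPartialHomeomorph M (Coord n)} {v : TangentBundle (𝓡 n) M}

theorem contMDiffAt_dtcoord (hφ : φ ∈ IsManifold.maximalAtlas (𝓡 n) ∞ M)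
    (hv : v ∈ chartDom φ) {V : Π v : TangentBundle (𝓡 n) M, TangentSpace (𝓡 n).tangent v}
    (hV : ContMDiffAt (𝓡 n).tangent ((𝓡 n).tangent.prod 𝓘(ℝ, Coord n × Coord n)) ∞
      (fun z => TotalSpace.mk' (E := TangentSpace (𝓡 n).tangent) (Coord n × Coord n) z (V z)) v) :
    ContMDiffAt (𝓡 n).tangent 𝓘(ℝ, Coord n × Coord n) ∞ (fun z => dtcoord φ z (V z)) v := by
  have h := (contMDiffOn_tcoord hφ).contMDiffOn_tangentMapWithin (m := ∞)
      (by simp) (isOpen_chartDom φ).uniqueMDiffOn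
  have h' := (contMDiff_snd_tangentBundle_modelSpace (Coord n × Coord n)
    𝓘(ℝ, Coord n × Coord n) (n := ∞)).comp_contMDiffOn h
  have h1 : ContMDiffAt _ 𝓘(ℝ, Coord n × Coord n) ∞ _ _ :=
    h'.contMDiffAt (((isOpen_chartDom φ).preimage
      (FiberBundle.continuous_proj _ _)).mem_nhds (x := ⟨v, V v⟩) hv)
  refine (h1.comp v hV).congr_of_eventuallyEq ?_
  filter_upwards [(isOpen_chartDom φ).mem_nhds hv] with z hz
  simp only [Function.comp, tangentMapWithin, mfderivWithin_of_isOpen (isOpen_chartDom φ) hz]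
  rfl

theorem contMDiffAt_dtcoordSymm (hφ : φ ∈ IsManifold.maximalAtlas (𝓡 n) ∞ M)
    (hv : v ∈ chartDom φ) (p : Coord n × Coord n) :
    ContMDiffAt (𝓡 n).tangent ((𝓡 n).tangent.prod 𝓘(ℝ, Coord n × Coord n)) ∞
      (fun z => TotalSpace.mk' (E := TangentSpace (𝓡 n).tangent) (Coord n × Coord n) z
        (dtcoordSymm φ z p)) v := by
  have h := (contMDiffOn_tcoordSymm hφ).contMDiffOn_tangentMapWithin (m := ∞)
      (by simp) (isOpen_target_prod φ).uniqueMDiffOn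
  have h1 := h.contMDiffAt (((isOpen_target_prod φ).preimage
      (FiberBundle.continuous_proj _ _)).mem_nhds (x := ⟨tcoord φ v, p⟩) ⟨φ.map_source hv, trivial⟩)
  have h2 : ContMDiffAt (𝓡 n).tangent 𝓘(ℝ, Coord n × Coord n).tangent ∞
      (fun z => (⟨tcoord φ z, p⟩ : TangentBundle 𝓘(ℝ, Coord n × Coord n) (Coord n × Coord n)))
      v := by
    refine contMDiffAt_totalSpace.2 ⟨contMDiffAt_tcoord hφ hv, ?_⟩
    refine contMDiffAt_const (c := p) |>.congr_of_eventuallyEq (Eventually.of_forall fun z => ?_)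
    simp
  refine (h1.comp v h2).congr_of_eventuallyEq ?_
  filter_upwards [(isOpen_chartDom φ).mem_nhds hv] with z hz
  simp only [Function.comp, tangentMapWithin]
  rw [mfderivWithin_of_isOpen (isOpen_target_prod φ) ⟨φ.map_source hz, trivial⟩]
  exact congrArg (fun x => (⟨x, dtcoordSymm φ z p⟩ :
    TangentBundle (𝓡 n).tangent (TangentBundle (𝓡 n) M))) (tcoordSymm_tcoord hφ hz).symm

end HomBundle

/-! ### Smooth coefficients and the affine structure on connections -/

section AddOneForm

variable {φ : OpenPartialHomeomorph M (Coord n)} {v : TangentBundle (𝓡 n) M}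

/-- Frame fields are smooth only over the chart domain. A bump function on M cuts them off to global
sections; the Hausdorff property makes its extension by zero smooth. -/
theorem contMDiff_bump_smul_frame [T2Space M] (hφ : φ ∈ IsManifold.maximalAtlas (𝓡 n) ∞ M)
    {x : M} (ψ : SmoothBumpFunction (𝓡 n) x) (hψ : tsupport ψ ⊆ φ.source) (b : Fin n) :
    ContMDiff (𝓡 n).tangent ((𝓡 n).tangent.prod 𝓘(ℝ, Coord n)) ∞
      (fun z => TotalSpace.mk' (E := PB n M) (Coord n) z (ψ z.proj • frame φ b z)) := by
  intro z
  by_cases hz : z ∈ chartDom φ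
  · exact ContMDiffAt.smul_section
      (ψ.contMDiff.comp (contMDiff_proj (TangentSpace (𝓡 n) : M → Type))).contMDiffAt
      (contMDiffAt_frame hφ hz b)
  · have hs : z.proj ∈ (tsupport ψ)ᶜ := fun h => hz (hψ h)
    have h0 : ContMDiffAt (𝓡 n).tangent ((𝓡 n).tangent.prod 𝓘(ℝ, Coord n)) ∞
        (fun z => TotalSpace.mk' (E := PB n M) (Coord n) z 0) z :=
      (contMDiff_zeroSection ℝ (PB n M)) z
    refine h0.congr_of_eventuallyEq ?_
    filter_upwards [((isClosed_tsupport ψ).isOpen_compl.preimage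
      (FiberBundle.continuous_proj (Coord n) (TangentSpace (𝓡 n) : M → Type))).mem_nhds hs]
      with w hw
    rw [image_eq_zero_of_notMem_tsupport hw, zero_smul]

/-- The coefficients of a connection are smooth. -/
theorem SmoothOver.connForm [T2Space M] (D : FinslerConnection n M)
    (hφ : φ ∈ IsManifold.maximalAtlas (𝓡 n) ∞ M) (a b : Fin n) (p : Coord n × Coord n) :
    SmoothOver φ fun v => connForm D φ v a b (dtcoordSymm φ v p) := by
  refine .of_contMDiffAt hφ fun v hv => ?_
  -- Smoothness of ∇ is postulated on sections smooth over the whole slit bundle, so it is applied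
  -- to a cut-off frame field.
  obtain ⟨ψ, -, hψ⟩ := (SmoothBumpFunction.nhds_basis_tsupport (I := 𝓡 n) v.proj).mem_iff.1
    (φ.open_source.mem_nhds hv.2)
  have hσ := contMDiff_bump_smul_frame hφ ψ hψ b
  have h1 := (D.contMDiff.contMDiff (hσ.contMDiffOn)).contMDiffAt
    ((isOpen_slit n M).mem_nhds hv.1)
  have h2 := h1.clm_bundle_apply (contMDiffAt_dtcoordSymm hφ hv.2 p)
  have h3 := (EuclideanSpace.proj a : Coord n →L[ℝ] ℝ).contMDiff.contMDiffAt.comp v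
    ((contMDiffAt_section_iff_comp hφ hv.2).1 h2)
  refine h3.congr_of_eventuallyEq ?_
  -- The cut-off is invisible near every w close to v, so by locality both fields have the same
  -- covariant derivative at w.
  have hev : ∀ᶠ w in 𝓝 v, ∀ᶠ z in 𝓝 w, ψ z.proj • frame φ b z = frame φ b z := by
    refine eventually_eventually_nhds.2 ?_
    filter_upwards [(FiberBundle.continuous_proj (Coord n)
      (TangentSpace (𝓡 n) : M → Type)).continuousAt.eventually ψ.eventuallyEq_one] with z hz
    rw [hz, Pi.one_apply, one_smul]
  filter_upwards [hev, (isOpen_slitDom φ).mem_nhds hv] with w hw hws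
  have h4 : D.toFun (fun z => ψ z.proj • frame φ b z) w = D.toFun (frame φ b) w :=
    D.isCovariantDerivativeOn.congr_of_eventuallyEq (hσ.mdifferentiable (by simp) w)
      (secDiffAt_frame hφ hws.2 b) ((isOpen_slit n M).mem_nhds hws.1) hw
  show Finsler.comp φ w _ a = Finsler.comp φ w _ a
  rw [h4]

/-- An endomorphism-valued 1-form with smooth components. -/
def IsSmoothOneForm (W : Π v : TangentBundle (𝓡 n) M,
    PB n M v →L[ℝ] TangentSpace (𝓡 n).tangent v →L[ℝ] PB n M v) : Prop :=
  ∀ φ ∈ IsManifold.maximalAtlas (𝓡 n) ∞ M, ∀ a b p,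
    SmoothOver φ fun v => comp φ v (W v (frame φ b v) (dtcoordSymm φ v p)) a

theorem dtcoordSymm_eq_sum (v : TangentBundle (𝓡 n) M) (p : Coord n × Coord n) :
    dtcoordSymm φ v p =
      ∑ c, p.1 c • dtcoordSymm φ v (EuclideanSpace.single c (1 : ℝ), 0) +
      ∑ c, p.2 c • dtcoordSymm φ v (0, EuclideanSpace.single c (1 : ℝ)) := by
  conv_lhs => rw [prod_eq_sum p, map_add, map_sum, map_sum]
  simp only [map_smul]

theorem comp_oneForm_eq_sum (hφ : φ ∈ IsManifold.maximalAtlas (𝓡 n) ∞ M) (hv : v ∈ chartDom φ)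
    (A : PB n M v →L[ℝ] TangentSpace (𝓡 n).tangent v →L[ℝ] PB n M v) (u : PB n M v)
    (X : TangentSpace (𝓡 n).tangent v) :
    comp φ v (A u X) = ∑ b, comp φ v u b •
      (∑ c, (dtcoord φ v X).1 c •
        comp φ v (A (frame φ b v) (dtcoordSymm φ v (EuclideanSpace.single c (1 : ℝ), 0))) +
      ∑ c, (dtcoord φ v X).2 c •
        comp φ v (A (frame φ b v) (dtcoordSymm φ v (0, EuclideanSpace.single c (1 : ℝ))))) := by
  have h1 : A u X = ∑ b, comp φ v u b • A (frame φ b v) X := by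
    conv_lhs => rw [sum_comp_smul_frame hφ hv u, map_sum]
    rw [sum_apply]
    exact Finset.sum_congr rfl fun b _ => by rw [map_smul, smul_apply]
  rw [h1, ← compL_apply, map_sum]
  refine Finset.sum_congr rfl fun b _ => ?_
  rw [map_smul]
  congr 1
  conv_lhs => rw [← dtcoordSymm_dtcoord hφ hv X, dtcoordSymm_eq_sum]
  simp only [map_add, map_sum, map_smul, compL_apply]

theorem IsSmoothOneForm.contMDiffAt {W : Π v : TangentBundle (𝓡 n) M,
    PB n M v →L[ℝ] TangentSpace (𝓡 n).tangent v →L[ℝ] PB n M v} (hW : IsSmoothOneForm W)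
    (hv : v ∈ Slit n M) {σ : Π v, PB n M v}
    (hσ : ContMDiffAt (𝓡 n).tangent ((𝓡 n).tangent.prod 𝓘(ℝ, Coord n)) ∞
      (fun z => TotalSpace.mk' (Coord n) z (σ z)) v) :
    ContMDiffAt (𝓡 n).tangent ((𝓡 n).tangent.prod 𝓘(ℝ, Coord n × Coord n →L[ℝ] Coord n)) ∞
      (fun z => TotalSpace.mk' (Coord n × Coord n →L[ℝ] Coord n)
        (E := fun z => TangentSpace (𝓡 n).tangent z →L[ℝ] PB n M z) z (W z (σ z))) v := by
  have hφ := chartAt_mem v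
  have hv' : v ∈ slitDom (chartAt (Coord n) v.proj) := ⟨hv, mem_chartDom_chartAt v⟩
  refine contMDiffAt_hom_section_of_apply fun X hX => ?_
  refine (contMDiffAt_section_iff_comp hφ hv'.2).2 ?_
  have hX' := contMDiffAt_dtcoord hφ hv'.2 hX
  have hσ' := (contMDiffAt_section_iff_comp hφ hv'.2).1 hσ
  have hcoord : ∀ {f : TangentBundle (𝓡 n) M → Coord n} (a : Fin n),
      ContMDiffAt (𝓡 n).tangent 𝓘(ℝ, Coord n) ∞ f v →
      ContMDiffAt (𝓡 n).tangent 𝓘(ℝ, ℝ) ∞ (fun z => f z a) v := fun a hf =>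
    (EuclideanSpace.proj a : Coord n →L[ℝ] ℝ).contMDiff.contMDiffAt.comp v hf
  have hX1 : ContMDiffAt (𝓡 n).tangent 𝓘(ℝ, Coord n) ∞
      (fun z => (dtcoord (chartAt (Coord n) v.proj) z (X z)).1) v :=
    (ContinuousLinearMap.fst ℝ (Coord n) (Coord n)).contMDiff.contMDiffAt.comp v hX'
  have hX2 : ContMDiffAt (𝓡 n).tangent 𝓘(ℝ, Coord n) ∞
      (fun z => (dtcoord (chartAt (Coord n) v.proj) z (X z)).2) v :=
    (ContinuousLinearMap.snd ℝ (Coord n) (Coord n)).contMDiff.contMDiffAt.comp v hX'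
  have hWc : ∀ b p, ContMDiffAt (𝓡 n).tangent 𝓘(ℝ, Coord n) ∞
      (fun z => comp (chartAt (Coord n) v.proj) z (W z (frame (chartAt (Coord n) v.proj) b z)
        (dtcoordSymm (chartAt (Coord n) v.proj) z p))) v := fun b p => by
    have h := fun a => (hW _ hφ a b p).contMDiffAt hφ hv'
    exact ((EuclideanSpace.equiv (Fin n) ℝ).symm : (Fin n → ℝ) →L[ℝ] Coord
      n).contMDiff.contMDiffAt.comp v (contMDiffAt_pi_space.2 h)
  have hsum : ContMDiffAt (𝓡 n).tangent 𝓘(ℝ, Coord n) ∞ (fun z => ∑ b,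
      comp (chartAt (Coord n) v.proj) z (σ z) b •
      (∑ c, (dtcoord (chartAt (Coord n) v.proj) z (X z)).1 c •
        comp (chartAt (Coord n) v.proj) z (W z (frame (chartAt (Coord n) v.proj) b z)
        (dtcoordSymm (chartAt (Coord n) v.proj) z (EuclideanSpace.single c (1 : ℝ), 0))) +
      ∑ c, (dtcoord (chartAt (Coord n) v.proj) z (X z)).2 c •
        comp (chartAt (Coord n) v.proj) z (W z (frame (chartAt (Coord n) v.proj) b z)
        (dtcoordSymm (chartAt (Coord n) v.proj) z (0, EuclideanSpace.single c (1 : ℝ)))))) v :=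
    contMDiffAt_finsetSum fun b _ => (hcoord b hσ').smul <|
      (contMDiffAt_finsetSum fun c _ => (hcoord c hX1).smul (hWc b _)).add
      (contMDiffAt_finsetSum fun c _ => (hcoord c hX2).smul (hWc b _))
  refine hsum.congr_of_eventuallyEq ?_
  filter_upwards [(isOpen_slitDom _).mem_nhds hv'] with z hz
  exact comp_oneForm_eq_sum hφ hz.2 (W z) (σ z) (X z)

/-- The connection `∇ + W`. -/
def FinslerConnection.addOneForm (D : FinslerConnection n M) (W : Π v : TangentBundle (𝓡 n) M,
    PB n M v →L[ℝ] TangentSpace (𝓡 n).tangent v →L[ℝ] PB n M v) (hW : IsSmoothOneForm W) :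
    FinslerConnection n M where
  toFun σ v := D.toFun σ v + W v (σ v)
  isCovariantDerivativeOn := D.isCovariantDerivativeOn.add_one_form W
  contMDiff := ⟨fun hσ => (D.contMDiff.contMDiff hσ).add_section fun v hv =>
    (hW.contMDiffAt hv ((hσ v hv).contMDiffAt
      ((isOpen_slit n M).mem_nhds hv))).contMDiffWithinAt⟩

theorem connForm_addOneForm (D : FinslerConnection n M) {W : Π v : TangentBundle (𝓡 n) M,
    PB n M v →L[ℝ] TangentSpace (𝓡 n).tangent v →L[ℝ] PB n M v} (hW : IsSmoothOneForm W)
    (a b : Fin n) (X : TangentSpace (𝓡 n).tangent v) :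
    connForm (D.addOneForm W hW) φ v a b X =
      connForm D φ v a b X + comp φ v (W v (frame φ b v) X) a := by
  have h : (D.addOneForm W hW).toFun (frame φ b) v X =
      D.toFun (frame φ b) v X + W v (frame φ b v) X := rfl
  rw [connForm, h, comp_add]
  rfl

end AddOneForm

/-! ### Connections that satisfy (α)-(ε) form one class -/

section Class

variable {φ : OpenPartialHomeomorph M (Coord n)} {v : TangentBundle (𝓡 n) M}
  {g : FinslerMetric n M} {D D' : FinslerConnection n M}

theorem metric_oneForm_comm (hφ : φ ∈ IsManifold.maximalAtlas (𝓡 n) ∞ M) (hv : v ∈ slitDom φ)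
    (A : PB n M v →L[ℝ] TangentSpace (𝓡 n).tangent v →L[ℝ] PB n M v)
    (X : TangentSpace (𝓡 n).tangent v)
    (h : ∀ a b, g.toFun v (A (frame φ b v) X) (frame φ a v) =
      g.toFun v (A (frame φ a v) X) (frame φ b v)) (u w : PB n M v) :
    g.toFun v u (A w X) = g.toFun v w (A u X) := by
  have h1 : ∀ u w : PB n M v, g.toFun v u (A w X) = ∑ a, ∑ b, comp φ v u a * comp φ v w b *
      g.toFun v (A (frame φ b v) X) (frame φ a v) := fun u w => by
    rw [g.symm v hv.1]
    conv_lhs => rw [sum_comp_smul_frame hφ hv.2 u, sum_comp_smul_frame hφ hv.2 w]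
    simp only [map_sum, map_smul, sum_apply, smul_apply, smul_eq_mul, Finset.mul_sum, mul_assoc]
  rw [h1, h1, Finset.sum_comm]
  exact Finset.sum_congr rfl fun b _ => Finset.sum_congr rfl fun a _ => by rw [h]; ring

theorem connLow_sub_connLow (X : TangentSpace (𝓡 n).tangent v) (a b : Fin n)
    (hφ : φ ∈ IsManifold.maximalAtlas (𝓡 n) ∞ M) (hv : v ∈ slitDom φ) :
    connLow D g φ v a b X - connLow D g φ v b a X =
      theta D g φ v a b X - theta D g φ v b a X := by
  rw [theta, theta, pd_gcomp_comm hφ hv b a]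
  ring

/-- W is the difference tensor of the two connections. Both have the same θ, which fixes ω_{ab} -
ω_{ba} and makes W_{ab} symmetric, and the same ω̄, which gives W y = 0. -/
theorem Compatible.symmetryRelated (h : Compatible g D) (h' : Compatible g D') :
    SymmetryRelated g D D' := by
  have hW : ∀ {v}, v ∈ Slit n M → ∀ {σ : Π v, PB n M v}, SecDiffAt σ v →
      IsCovariantDerivativeOn.difference D'.isCovariantDerivativeOn D.isCovariantDerivativeOn v
        (σ v) = D'.toFun σ v - D.toFun σ v := fun {v} hv {σ} hσ =>
    IsCovariantDerivativeOn.difference_apply D'.isCovariantDerivativeOn D.isCovariantDerivativeOn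
      hv hσ
  have hω : ∀ {v}, v ∈ Slit n M → ∀ X, omegaBar D' v X = omegaBar D v X := fun {v} hv X => by
    have hv' : v ∈ slitDom (chartAt (Coord n) v.proj) := ⟨hv, mem_chartDom_chartAt v⟩
    refine comp_injective (chartAt_mem v) hv'.2 ?_
    ext a
    rw [(h.adaptedAt_energy (chartAt_mem v) hv').comp_omegaBar,
      (h'.adaptedAt_energy (chartAt_mem v) hv').comp_omegaBar]
  refine ⟨IsCovariantDerivativeOn.difference D'.isCovariantDerivativeOn D.isCovariantDerivativeOn,
    fun v hv σ hσ => ?_, fun v hv X u w => ?_, fun v hv X => ?_⟩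
  · rw [hW hv hσ, add_sub_cancel]
  · have hφ := chartAt_mem v
    have hv' : v ∈ slitDom (chartAt (Coord n) v.proj) := ⟨hv, mem_chartDom_chartAt v⟩
    refine metric_oneForm_comm hφ hv' (IsCovariantDerivativeOn.difference
      D'.isCovariantDerivativeOn D.isCovariantDerivativeOn v) X (fun a b => ?_) u w
    have hf : ∀ a b, g.toFun v (IsCovariantDerivativeOn.difference D'.isCovariantDerivativeOn
        D.isCovariantDerivativeOn v (frame (chartAt (Coord n) v.proj) b v) X)
        (frame (chartAt (Coord n) v.proj) a v) =
        connLow D' g (chartAt (Coord n) v.proj) v a b X -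
          connLow D g (chartAt (Coord n) v.proj) v a b X := fun a b => by
      rw [hW hv (secDiffAt_frame hφ hv'.2 b), sub_apply, g.symm v hv, map_sub,
        metric_frame_cov D' g hφ hv', metric_frame_cov D g hφ hv']
    refine (hf a b).trans (Eq.trans ?_ (hf b a).symm)
    have h1 := connLow_sub_connLow (D := D) (g := g) X a b hφ hv'
    have h2 := connLow_sub_connLow (D := D') (g := g) X a b hφ hv'
    have h3 : ∀ a b, theta D' g (chartAt (Coord n) v.proj) v a b X =
        theta D g (chartAt (Coord n) v.proj) v a b X := fun a b => by
      rw [(h.adaptedAt_energy hφ hv').theta_eq, (h'.adaptedAt_energy hφ hv').theta_eq, hω hv]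
    rw [h3, h3] at h2
    linarith
  · rw [hW hv (secDiffAt_liouville v), sub_apply]
    exact sub_eq_zero.2 (hω hv X)

theorem Compatible.of_symmetryRelated (h : Compatible g D) (hs : SymmetryRelated g D D') :
    Compatible g D' := by
  obtain ⟨h1, h2, h3, h4, h5⟩ := conditions_iff_of_symmetryRelated hs
  exact ⟨h1.1 h.1, h2.1 h.2.1, h3.1 h.2.2.1, h4.1 h.2.2.2.1, h5.1 h.2.2.2.2⟩

theorem Compatible.compatible_iff_equivalent (h : Compatible g D) :
    Compatible g D' ↔ Equivalent g D D' :=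
  ⟨fun h' => ⟨h.1, h'.1, h.symmetryRelated h'⟩, fun h' => h.of_symmetryRelated h'.2.2⟩

end Class

/-! ### Construction of connections in the class -/

section Construction

variable {φ : OpenPartialHomeomorph M (Coord n)} {v : TangentBundle (𝓡 n) M}
  {g : FinslerMetric n M} {D D' : FinslerConnection n M}

theorem exists_clm_of_bilinear {E F G : Type*} [NormedAddCommGroup E] [NormedSpace ℝ E]
    [NormedAddCommGroup F] [NormedSpace ℝ F] [NormedAddCommGroup G] [NormedSpace ℝ G]
    [FiniteDimensional ℝ E] [FiniteDimensional ℝ F] (f : E → F → G)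
    (h₁ : ∀ y, IsLinearMap ℝ fun x => f x y) (h₂ : ∀ x, IsLinearMap ℝ (f x)) :
    ∃ A : E →L[ℝ] F →L[ℝ] G, ∀ x y, A x y = f x y :=
  ⟨(LinearMap.toContinuousLinearMap.toLinearMap ∘ₗ LinearMap.mk₂ ℝ f
    (fun x x' y => (h₁ y).map_add x x') (fun c x y => (h₁ y).map_smul c x)
    (fun x => (h₂ x).map_add) (fun c x => (h₂ x).map_smul c)).toContinuousLinearMap,
    fun _ _ => rfl⟩

theorem comp_eq_sum_inv_gcomp (hφ : φ ∈ IsManifold.maximalAtlas (𝓡 n) ∞ M) (hv : v ∈ slitDom φ)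
    (w : PB n M v) (a : Fin n) : comp φ v w a =
      ∑ d, (Matrix.of fun a b => gcomp g φ a b v)⁻¹ a d * g.toFun v w (frame φ d v) := by
  have h1 : ∀ d, g.toFun v w (frame φ d v) =
      Matrix.mulVec (Matrix.of fun a b => gcomp g φ a b v) (fun e => comp φ v w e) d := fun d => by
    rw [g.symm v hv.1]
    exact metric_apply_eq_sum g hφ hv _ _
  simp only [h1]
  have h2 := Matrix.nonsing_inv_mul (Matrix.of fun a b => gcomp g φ a b v)
    (isUnit_iff_ne_zero.2 (det_gcomp_ne_zero g hφ hv))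
  have h3 := congrArg (fun A => Matrix.mulVec A (fun e => comp φ v w e) a) h2
  simp only [← Matrix.mulVec_mulVec, Matrix.one_mulVec] at h3
  exact h3.symm

/-- A connection `∇ + W` in the class of `∇`, with prescribed components `W_{ab}`. -/
theorem exists_connection_of_connLow [T2Space M] (D : FinslerConnection n M)
    (F : Π v : TangentBundle (𝓡 n) M, PB n M v → TangentSpace (𝓡 n).tangent v → PB n M v)
    (B : OpenPartialHomeomorph M (Coord n) → Π v : TangentBundle (𝓡 n) M,
      Fin n → Fin n → TangentSpace (𝓡 n).tangent v → ℝ)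
    (hF : ∀ φ ∈ IsManifold.maximalAtlas (𝓡 n) ∞ M, ∀ v ∈ slitDom φ, ∀ u X a,
      g.toFun v (F v u X) (frame φ a v) = ∑ b, B φ v a b X * comp φ v u b)
    (hlin : ∀ φ ∈ IsManifold.maximalAtlas (𝓡 n) ∞ M, ∀ v ∈ slitDom φ, ∀ a b,
      IsLinearMap ℝ (B φ v a b))
    (hsmooth : ∀ φ ∈ IsManifold.maximalAtlas (𝓡 n) ∞ M, ∀ a b p,
      SmoothOver φ fun v => B φ v a b (dtcoordSymm φ v p))
    (hsymm : ∀ φ ∈ IsManifold.maximalAtlas (𝓡 n) ∞ M, ∀ v ∈ slitDom φ, ∀ a b X,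
      B φ v a b X = B φ v b a X)
    (hy : ∀ φ ∈ IsManifold.maximalAtlas (𝓡 n) ∞ M, ∀ v ∈ slitDom φ, ∀ b X,
      ∑ a, ycoord φ a v * B φ v a b X = 0) :
    ∃ D' : FinslerConnection n M, SymmetryRelated g D D' ∧
      ∀ φ ∈ IsManifold.maximalAtlas (𝓡 n) ∞ M, ∀ v ∈ slitDom φ, ∀ a b X,
        connLow D' g φ v a b X = connLow D g φ v a b X + B φ v a b X := by
  -- `F` is chart-free, so nothing has to be glued. One chart at each slit point shows that it is
  -- bilinear; off the slit bundle zero is chosen.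
  have hex : ∀ v : TangentBundle (𝓡 n) M,
      ∃ A : PB n M v →L[ℝ] TangentSpace (𝓡 n).tangent v →L[ℝ] PB n M v,
      v ∈ Slit n M → ∀ u X, A u X = F v u X := by
    intro v
    by_cases hv : v ∈ Slit n M
    · have hφ := chartAt_mem v
      have hv' : v ∈ slitDom (chartAt (Coord n) v.proj) := ⟨hv, mem_chartDom_chartAt v⟩
      have hl := hlin _ hφ v hv'
      have h₁ : ∀ X, IsLinearMap ℝ fun u => F v u X := fun X =>
        ⟨fun u u' => eq_of_metric_frame_eq g hφ hv' fun a => by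
          simp only [hF _ hφ v hv', map_add, add_apply, comp_add, PiLp.add_apply, mul_add,
            Finset.sum_add_distrib], fun c u => eq_of_metric_frame_eq g hφ hv' fun a => by
          simp only [hF _ hφ v hv', map_smul, smul_apply, comp_smul, PiLp.smul_apply, smul_eq_mul,
            Finset.mul_sum, mul_left_comm]⟩
      have h₂ : ∀ u, IsLinearMap ℝ (F v u) := fun u =>
        ⟨fun X X' => eq_of_metric_frame_eq g hφ hv' fun a => by
          simp only [hF _ hφ v hv', map_add, add_apply, (hl _ _).map_add, add_mul,
            Finset.sum_add_distrib], fun c X => eq_of_metric_frame_eq g hφ hv' fun a => by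
          simp only [hF _ hφ v hv', map_smul, smul_apply, (hl _ _).map_smul, smul_eq_mul,
            Finset.mul_sum, mul_assoc]⟩
      obtain ⟨A, hA⟩ := exists_clm_of_bilinear (E := Coord n) (F := Coord n × Coord n)
        (G := Coord n) (F v) h₁ h₂
      exact ⟨A, fun _ => hA⟩
    · exact ⟨0, fun h => absurd h hv⟩
  choose W hW using hex
  have hlow : ∀ φ ∈ IsManifold.maximalAtlas (𝓡 n) ∞ M, ∀ v ∈ slitDom φ, ∀ a b X,
      g.toFun v (W v (frame φ b v) X) (frame φ a v) = B φ v a b X := fun φ hφ v hv a b X => by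
    rw [hW v hv.1, hF φ hφ v hv]
    simp [comp_frame hφ hv.2, PiLp.single_apply]
  have hWs : IsSmoothOneForm W := fun φ hφ a b p => by
    have h1 : SmoothOver φ fun v => ∑ d, (Matrix.of fun a b => gcomp g φ a b v)⁻¹ a d *
        B φ v d b (dtcoordSymm φ v p) :=
      .sum fun d _ => (SmoothOver.matrix_inv hφ (A := fun v => Matrix.of fun a b => gcomp g φ a b v)
        (fun i j => .gcomp g hφ i j) (fun v hv => det_gcomp_ne_zero g hφ hv) a d).mul
        (hsmooth φ hφ d b p)
    refine h1.congr hφ fun v hv => ?_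
    rw [comp_eq_sum_inv_gcomp (g := g) hφ hv]
    exact Finset.sum_congr rfl fun d _ => by rw [hlow φ hφ v hv]
  refine ⟨D.addOneForm W hWs, ⟨W, fun _ _ _ _ => rfl, fun v hv X u w => ?_, fun v hv X => ?_⟩,
    fun φ hφ v hv a b X => ?_⟩
  · have hφ := chartAt_mem v
    have hv' : v ∈ slitDom (chartAt (Coord n) v.proj) := ⟨hv, mem_chartDom_chartAt v⟩
    refine metric_oneForm_comm hφ hv' (W v) X (fun a b => ?_) u w
    refine (hlow _ hφ v hv' a b X).trans (Eq.trans ?_ (hlow _ hφ v hv' b a X).symm)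
    exact hsymm _ hφ v hv' a b X
  · have hφ := chartAt_mem v
    have hv' : v ∈ slitDom (chartAt (Coord n) v.proj) := ⟨hv, mem_chartDom_chartAt v⟩
    refine eq_of_metric_frame_eq g hφ hv' fun a => ?_
    rw [hW v hv, hF _ hφ v hv', map_zero, zero_apply, ← hy _ hφ v hv' a X]
    refine Finset.sum_congr rfl fun b _ => ?_
    rw [hsymm _ hφ v hv' a b, mul_comm]
    rfl
  · rw [connLow, connLow, ← hlow φ hφ v hv a b X, g.symm v hv.1, metric_apply_eq_sum g hφ hv,
      ← Finset.sum_add_distrib]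
    exact Finset.sum_congr rfl fun d _ => by rw [connForm_addOneForm, mul_add]; rfl

end Construction

/-! ### The notable connections of the class -/

section NotableConnections

variable {φ : OpenPartialHomeomorph M (Coord n)} {v : TangentBundle (𝓡 n) M}
  {g : FinslerMetric n M} {D D' : FinslerConnection n M} {L : TangentBundle (𝓡 n) M → ℝ}

theorem eq_of_lower_eq (hφ : φ ∈ IsManifold.maximalAtlas (𝓡 n) ∞ M) (hv : v ∈ slitDom φ)
    {F F' : Fin n → Fin n → Fin n → ℝ} {b c : Fin n}
    (h : ∀ a, lower g φ v F a b c = lower g φ v F' a b c) (a : Fin n) : F a b c = F' a b c := by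
  have h1 := congrFun (eq_zero_of_sum_gcomp g hφ hv (fun d => F d b c - F' d b c) fun a => by
    simp only [mul_sub, Finset.sum_sub_distrib]
    exact sub_eq_zero.2 (h a)) a
  exact sub_eq_zero.1 h1

/-- The lifts that define the coefficients are Barthel's δ_c and ∂/∂y^c, so the lowered coefficients
are values of ω_{ab} on them. -/
theorem Compatible.hasCoefficients (h : Compatible g D) {H V : OpenPartialHomeomorph M (Coord n) →
      TangentBundle (𝓡 n) M → Fin n → Fin n → Fin n → ℝ}
    (hH : ∀ φ ∈ IsManifold.maximalAtlas (𝓡 n) ∞ M, ∀ v ∈ slitDom φ, ∀ a b c,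
      connLow D g φ v a b (hvec φ v (fun a c => barthelCoeff (energy g) φ a c v) c) =
        lower g φ v (H φ v) a b c)
    (hV : ∀ φ ∈ IsManifold.maximalAtlas (𝓡 n) ∞ M, ∀ v ∈ slitDom φ, ∀ a b c,
      connLow D g φ v a b (vvec φ v c) = lower g φ v (V φ v) a b c) :
    HasCoefficients D H V := by
  refine ⟨h.1, fun φ hφ v hv hvφ a b c => ?_⟩
  have hv' : v ∈ slitDom φ := ⟨hv, hvφ⟩
  have ha := h.adaptedAt_energy hφ hv'
  refine ⟨eq_of_lower_eq (g := g) hφ hv' (fun a => ?_) a,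
    eq_of_lower_eq (g := g) hφ hv' (fun a => ?_) a⟩
  · rw [lower_hCoeff, ha.lift_frame_zero h.1 hφ hv', hH φ hφ v hv']
  · rw [lower_vCoeff, ha.lift_zero_frame h.1 hφ hv', hV φ hφ v hv']

theorem SmoothOver.connLow [T2Space M] (D : FinslerConnection n M) (g : FinslerMetric n M)
    (hφ : φ ∈ IsManifold.maximalAtlas (𝓡 n) ∞ M) (a b : Fin n) (p : Coord n × Coord n) :
    SmoothOver φ fun v => connLow D g φ v a b (dtcoordSymm φ v p) :=
  .sum fun d _ => (SmoothOver.gcomp g hφ a d).mul (.connForm D hφ d b p)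

/-- The metric connection of the class. -/
theorem Compatible.exists_connLow_eq_theta [T2Space M] (h : Compatible g D) :
    ∃ D' : FinslerConnection n M, SymmetryRelated g D D' ∧
      ∀ φ ∈ IsManifold.maximalAtlas (𝓡 n) ∞ M, ∀ v ∈ slitDom φ, ∀ a b X,
        connLow D' g φ v a b X = theta D g φ v a b X := by
  refine (exists_connection_of_connLow (g := g) D
    -- The tensor is Dg/2 with one index raised, because ω_{ab} + (Dg)_{ab}/2 = θ_{ab}.
    (fun v u X => (1 / 2 : ℝ) • (g.toFun v).inverse (dMetric D g v X u))
    (fun φ v a b X => (1 / 2 : ℝ) * (pd φ (dtcoord φ v X) (gcomp g φ a b) v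
      - connLow D g φ v b a X - connLow D g φ v a b X))
    (fun φ hφ v hv u X a => ?_) (fun φ hφ v hv a b => ⟨fun X Y => ?_, fun c X => ?_⟩)
    (fun φ hφ a b p => ?_) (fun φ hφ v hv a b X => ?_) (fun φ hφ v hv b X => ?_)).imp
    fun D' h' => ⟨h'.1, fun φ hφ v hv a b X => (h'.2 φ hφ v hv a b X).trans ?_⟩
  · rw [map_smul, smul_apply, metric_inverse_apply g hv.1]
    conv_lhs => rw [sum_comp_smul_frame hφ hv.2 u, map_sum]
    rw [sum_apply, smul_eq_mul, Finset.mul_sum]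
    refine Finset.sum_congr rfl fun b _ => ?_
    rw [map_smul, smul_apply, dMetric_frame D g hφ hv, smul_eq_mul, pd_gcomp_comm hφ hv b a]
    ring
  · simp only [map_add, pd_add_vec, (isLinearMap_connLow D g _ _).map_add]
    ring
  · simp only [map_smul, pd_smul_vec, (isLinearMap_connLow D g _ _).map_smul, smul_eq_mul]
    ring
  · refine ((SmoothOver.const (1 / 2 : ℝ)).mul ((((SmoothOver.gcomp g hφ a b).pd hφ p).sub
      (.connLow D g hφ b a p)).sub (.connLow D g hφ a b p))).congr hφ fun v hv => ?_
    rw [dtcoord_dtcoordSymm hφ hv.2]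
  · rw [pd_gcomp_comm hφ hv a b]
    ring
  · simp only [mul_left_comm _ (1 / 2 : ℝ), ← Finset.mul_sum]
    rw [condEpsilon_iff.1 h.2.2.2.2 φ hφ v hv X b, mul_zero]
  · rw [theta]
    ring

theorem AdaptedAt.isLinearMap_comp_omegaBar (D : FinslerConnection n M) (c : Fin n) :
    IsLinearMap ℝ fun X => comp φ v (omegaBar D v X) c where
  map_add X Y := by simp only [map_add, comp_add, PiLp.add_apply]
  map_smul r X := by simp only [map_smul, comp_smul, PiLp.smul_apply]

/-- Removal of the Cartan torsion from the vertical coefficients. -/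
theorem Compatible.exists_connLow_sub_cartan [T2Space M] (h : Compatible g D) :
    ∃ D' : FinslerConnection n M, SymmetryRelated g D D' ∧
      ∀ φ ∈ IsManifold.maximalAtlas (𝓡 n) ∞ M, ∀ v ∈ slitDom φ, ∀ a b X,
        connLow D' g φ v a b X = connLow D g φ v a b X +
          ∑ c, -(1 / 2 : ℝ) * pdy φ c (hess (energy g) φ a b) v *
            comp φ v (omegaBar D v X) c := by
  obtain ⟨hL, hg⟩ := isFinslerLagrangian_energy h.2.1 h.2.2.1
  refine exists_connection_of_connLow (g := g) D
    -- For the horizontal lift of u, Ψ(X, ·) is the Cartan torsion in the arguments u and ω̄(X): a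
    -- chart-free expression for it.
    (fun v u X => -canonicalTorsion D g v X (lift D v (u, 0)))
    (fun φ v a b X => ∑ c, -(1 / 2 : ℝ) * pdy φ c (hess (energy g) φ a b) v *
      comp φ v (omegaBar D v X) c)
    (fun φ hφ v hv u X a => ?_) (fun φ hφ v hv a b => ⟨fun X Y => ?_, fun c X => ?_⟩)
    (fun φ hφ a b p => ?_) (fun φ hφ v hv a b X => ?_) (fun φ hφ v hv b X => ?_)
  · rw [map_neg, neg_apply, (h.adaptedAt_energy hφ hv).metric_canonicalTorsion
      (hL.lagrangianOn hg hφ) hv, ← comp_omega hφ hv.2, h.1.omega_lift hv.1,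
      h.1.omegaBar_lift hv.1, comp_zero, comp_frame hφ hv.2]
    simp [cartanForm, PiLp.single_apply, Finset.sum_mul, Finset.sum_neg_distrib]
    refine Finset.sum_congr rfl fun b _ => Finset.sum_congr rfl fun c _ => ?_
    ring
  · simp only [(AdaptedAt.isLinearMap_comp_omegaBar D _).map_add, mul_add, Finset.sum_add_distrib]
  · simp only [(AdaptedAt.isLinearMap_comp_omegaBar D _).map_smul, smul_eq_mul, Finset.mul_sum,
      mul_left_comm]
  · have hL' := hL.lagrangianOn hg hφ
    have h1 : SmoothOver φ fun v => ∑ c, -(1 / 2 : ℝ) * pdy φ c (hess (energy g) φ a b) v *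
        (p.2 c + ∑ d, barthelCoeff (energy g) φ c d v * p.1 d) :=
      .sum fun c _ => ((SmoothOver.const _).mul ((hL'.smooth_hess a b).pdy hφ c)).mul
        ((SmoothOver.const _).add (.sum fun d _ => (hL'.smooth_barthelCoeff c d).mul (.const _)))
    refine h1.congr hφ fun v hv => ?_
    simp only [(h.adaptedAt_energy hφ hv).comp_omegaBar, dtcoord_dtcoordSymm hφ hv.2]
  · exact Finset.sum_congr rfl fun c _ => congrArg (fun x => -(1 / 2 : ℝ) * x * _)
      (pd_hess_comm hφ (hL.smoothOver hφ) hv a b _)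
  · simp only [Finset.mul_sum]
    rw [Finset.sum_comm]
    refine Finset.sum_eq_zero fun c _ => ?_
    calc _ = -(1 / 2 : ℝ) * comp φ v (omegaBar D v X) c *
          ∑ a, ycoord φ a v * pdy φ c (hess (energy g) φ a b) v := by
          rw [Finset.mul_sum]
          exact Finset.sum_congr rfl fun a _ => by ring
      _ = 0 := by rw [(hL.lagrangianOn hg hφ).euler_pdy_hess hv, mul_zero]

/-- The covariant exterior derivative of `ω̄`, with one argument a vertical vector. -/
theorem Compatible.comp_covExtDeriv_omegaBar (h : Compatible g D)
    (hφ : φ ∈ IsManifold.maximalAtlas (𝓡 n) ∞ M) (hv : v ∈ slitDom φ) (u : PB n M v)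
    (X : TangentSpace (𝓡 n).tangent v) (a : Fin n) :
    comp φ v (covExtDeriv D (omegaBar D) v (lift D v (0, u)) X) a =
      ∑ b, ((∑ c, berwaldUp (energy g) φ v a b c * (dtcoord φ v X).1 c) +
        (∑ c, connForm D φ v a c (vvec φ v b) * comp φ v (omegaBar D v X) c) -
        connForm D φ v a b X) * comp φ v u b := by
  obtain ⟨hL, hg⟩ := isFinslerLagrangian_energy h.2.1 h.2.2.1
  have hL' := hL.lagrangianOn hg hφ
  have ha := fun z hz => h.adaptedAt_energy (v := z) hφ hz
  -- The coordinate form ω̄^a = dy^a + N^a_c dx^c.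
  let B : Fin n → Coord n × Coord n → Coord n × Coord n →L[ℝ] ℝ := fun a q =>
    (EuclideanSpace.proj a : Coord n →L[ℝ] ℝ) ∘L ContinuousLinearMap.snd ℝ (Coord n) (Coord n) +
    ∑ c, barthelCoeff (energy g) φ a c (tcoordSymm φ q) •
      ((EuclideanSpace.proj c : Coord n →L[ℝ] ℝ) ∘L ContinuousLinearMap.fst ℝ (Coord n) (Coord n))
  have hBapp : ∀ a q w, B a q w = w.2 a +
      ∑ c, barthelCoeff (energy g) φ a c (tcoordSymm φ q) * w.1 c := fun a q w => by
    simp [B, sum_apply]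
  have hBd : ∀ a, DifferentiableAt ℝ (B a) (tcoord φ v) := fun a =>
    (differentiableAt_const _).add (DifferentiableAt.fun_sum fun c _ =>
      ((hL'.smooth_barthelCoeff a c).differentiableAt hv).smul_const _)
  have hBf : ∀ a z w, fderiv ℝ (B a) (tcoord φ v) z w =
      ∑ c, pd φ z (barthelCoeff (energy g) φ a c) v * w.1 c := fun a z w => by
    have h1 : fderiv ℝ (fun q => B a q w) (tcoord φ v) z = fderiv ℝ (B a) (tcoord φ v) z w := by
      rw [fderiv_clm_apply (hBd a) (differentiableAt_const w)]
      simp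
    rw [← h1]
    simp only [hBapp]
    have hs : ∀ c, SmoothOver φ fun v => barthelCoeff (energy g) φ a c v * w.1 c := fun c =>
      (hL'.smooth_barthelCoeff a c).mul (.const _)
    change pd φ z (fun v => w.2 a + ∑ c, barthelCoeff (energy g) φ a c v * w.1 c) v = _
    rw [pd_add (.const _) (.sum fun c _ => hs c) hv, pd_const, zero_add,
      pd_sum (fun c _ => hs c) hv]
    refine Finset.sum_congr rfl fun c _ => ?_
    rw [pd_mul hφ (hL'.smooth_barthelCoeff a c) (.const _) hv, pd_const, mul_zero, add_zero]
  have hlift1 : (dtcoord φ v (lift D v (0, u))).1 = 0 := by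
    rw [← comp_omega hφ hv.2, h.1.omega_lift hv.1, comp_zero]
  have hlift2 : comp φ v (omegaBar D v (lift D v (0, u))) = comp φ v u := by
    rw [h.1.omegaBar_lift hv.1]
  have hlift3 : (dtcoord φ v (lift D v (0, u))).2 = comp φ v u := by
    ext a
    rw [← hlift2, (ha v hv).comp_omegaBar, hlift1]
    simp
  have hlift : dtcoord φ v (lift D v (0, u)) = (0, comp φ v u) := Prod.ext hlift1 hlift3
  have hconn : ∀ a b, connForm D φ v a b (lift D v (0, u)) =
      ∑ c, comp φ v u c * connForm D φ v a b (vvec φ v c) := fun a b => by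
    rw [(isLinearMap_connForm D a b).eq_sum_hvec_add_sum_vvec hφ hv.2 (fun _ _ => 0), hlift]
    simp
  rw [comp_covExtDeriv D hφ hv (B := B) (fun z hz X a => ?_) hBd, hBf, hBf, hlift, hlift2]
  -- Of the exterior derivative of N^a_c dx^c only the derivative of N along u remains, as dx kills
  -- the vertical argument; it yields G^a_{bc}.
  · simp only [hconn, pd_vertical, PiLp.zero_apply, mul_zero, Finset.sum_const_zero, sub_zero,
      add_mul, sub_mul, Finset.sum_add_distrib, Finset.sum_sub_distrib, Finset.sum_mul]
    rw [← add_sub_assoc]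
    congr 1
    congr 1
    · rw [Finset.sum_comm]
      refine Finset.sum_congr rfl fun b _ => Finset.sum_congr rfl fun c _ => ?_
      rw [show berwaldUp (energy g) φ v a b c = pdy φ b (barthelCoeff (energy g) φ a c) v from rfl]
      ring
    · rw [Finset.sum_comm]
      exact Finset.sum_congr rfl fun b _ => Finset.sum_congr rfl fun c _ => by ring
  · rw [(ha z hz).comp_omegaBar, hBapp, tcoordSymm_tcoord hφ hz.2]

/-- Passage from the horizontal coefficients of Chern to those of Berwald. -/
theorem Compatible.exists_connLow_sub_landsberg [T2Space M] (h : Compatible g D)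
    (hH : ∀ φ ∈ IsManifold.maximalAtlas (𝓡 n) ∞ M, ∀ v ∈ slitDom φ, ∀ a b c,
      connLow D g φ v a b (hvec φ v (fun a c => barthelCoeff (energy g) φ a c v) c) =
        gammaLow (energy g) φ v a b c)
    (hV : ∀ φ ∈ IsManifold.maximalAtlas (𝓡 n) ∞ M, ∀ v ∈ slitDom φ, ∀ a b c,
      connLow D g φ v a b (vvec φ v c) = connLow D g φ v a c (vvec φ v b)) :
    ∃ D' : FinslerConnection n M, SymmetryRelated g D D' ∧
      ∀ φ ∈ IsManifold.maximalAtlas (𝓡 n) ∞ M, ∀ v ∈ slitDom φ, ∀ a b X,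
        connLow D' g φ v a b X = connLow D g φ v a b X +
          ∑ c, -(1 / 2 : ℝ) * landsberg (energy g) φ v a b c * (dtcoord φ v X).1 c := by
  obtain ⟨hL, hg⟩ := isFinslerLagrangian_energy h.2.1 h.2.2.1
  refine exists_connection_of_connLow (g := g) D
    -- The Landsberg-type tensor is obtained without charts from Dω̄: the derivative of N gives
    -- G_{abc} and the connection form subtracts Γ_{abc}.
    (fun v u X => covExtDeriv D (omegaBar D) v (lift D v (0, u)) X)
    (fun φ v a b X => ∑ c, -(1 / 2 : ℝ) * landsberg (energy g) φ v a b c * (dtcoord φ v X).1 c)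
    (fun φ hφ v hv u X a => ?_) (fun φ hφ v hv a b => ⟨fun X Y => ?_, fun c X => ?_⟩)
    (fun φ hφ a b p => ?_) (fun φ hφ v hv a b X => ?_) (fun φ hφ v hv b X => ?_)
  · have hL' := hL.lagrangianOn hg hφ
    have hg' := fun a b => gcomp_eq_hess hφ (hL.smoothOver hφ) hg hv a b
    have h1 : ∀ b, connLow D g φ v a b X =
        ∑ c, gammaLow (energy g) φ v a b c * (dtcoord φ v X).1 c +
        ∑ c, connLow D g φ v a c (vvec φ v b) * comp φ v (omegaBar D v X) c := fun b => by
      rw [(isLinearMap_connLow D g a b).eq_sum_hvec_add_sum_vvec hφ hv.2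
        (fun a c => barthelCoeff (energy g) φ a c v) X]
      simp only [hH φ hφ v hv, hV φ hφ v hv a b, (h.adaptedAt_energy hφ hv).comp_omegaBar, mul_comm]
    rw [g.symm v hv.1, metric_apply_eq_sum g hφ hv]
    simp only [h.comp_covExtDeriv_omegaBar hφ hv, Finset.mul_sum]
    rw [Finset.sum_comm]
    refine Finset.sum_congr rfl fun b _ => ?_
    simp only [← mul_assoc, ← Finset.sum_mul]
    congr 1
    have h2 : ∑ d, g.toFun v (frame φ a v) (frame φ d v) *
        ∑ c, berwaldUp (energy g) φ v d b c * (dtcoord φ v X).1 c =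
        ∑ c, berwaldLow (energy g) φ v a b c * (dtcoord φ v X).1 c := by
      simp only [berwaldLow, Finset.mul_sum, Finset.sum_mul, ← hg', gcomp, mul_assoc]
      exact Finset.sum_comm
    have h3 : ∑ d, g.toFun v (frame φ a v) (frame φ d v) *
        ∑ c, connForm D φ v d c (vvec φ v b) * comp φ v (omegaBar D v X) c =
        ∑ c, connLow D g φ v a c (vvec φ v b) * comp φ v (omegaBar D v X) c := by
      simp only [connLow, Finset.mul_sum, Finset.sum_mul, gcomp, mul_assoc]
      exact Finset.sum_comm
    have h4 : ∑ d, g.toFun v (frame φ a v) (frame φ d v) * connForm D φ v d b X =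
        connLow D g φ v a b X := rfl
    simp only [mul_add, mul_sub, Finset.sum_add_distrib, Finset.sum_sub_distrib, h2, h3, h4, h1]
    -- The ω̄ terms V_{acb} and V_{abc} have cancelled by `hV`.
    rw [add_sub_add_right_eq_sub, ← Finset.sum_sub_distrib]
    refine Finset.sum_congr rfl fun c _ => ?_
    rw [hL'.gammaLow_eq_berwaldLow hv]
    ring
  · simp only [map_add, Prod.fst_add, PiLp.add_apply, mul_add, Finset.sum_add_distrib]
  · simp only [map_smul, Prod.smul_fst, PiLp.smul_apply, smul_eq_mul, Finset.mul_sum,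
      mul_left_comm]
  · have hL' := hL.lagrangianOn hg hφ
    have h1 : SmoothOver φ fun v => ∑ c, -(1 / 2 : ℝ) * landsberg (energy g) φ v a b c * p.1 c :=
      .sum fun c _ => ((SmoothOver.const _).mul (.sum fun d _ =>
        (((hL'.smooth_barthelCoeff d c).pdy hφ b).pdy hφ a).mul (hL'.smooth.pdy hφ d))).mul
        (.const _)
    refine h1.congr hφ fun v hv => ?_
    rw [dtcoord_dtcoordSymm hφ hv.2]
  · exact Finset.sum_congr rfl fun c _ => congrArg (· * _)
      (((hL.lagrangianOn hg hφ).symmAnnihilated_landsberg hv).1 a b c)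
  · simp only [Finset.mul_sum, ← mul_assoc]
    rw [Finset.sum_comm]
    refine Finset.sum_eq_zero fun c _ => ?_
    rw [← Finset.sum_mul]
    have h1 := ((hL.lagrangianOn hg hφ).symmAnnihilated_landsberg hv).2 b c
    simp only [← mul_assoc] at h1
    exact mul_eq_zero_of_left h1 _

end NotableConnections

/-! ### Existence of the four notable connections in the class. -/

section Existence

variable {φ : OpenPartialHomeomorph M (Coord n)} {v : TangentBundle (𝓡 n) M}
  {g : FinslerMetric n M} {D D' : FinslerConnection n M}

theorem AdaptedAt.sum_mul_comp_omegaBar_hvec {L : TangentBundle (𝓡 n) M → ℝ}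
    (h : AdaptedAt g D L φ v) (hφ : φ ∈ IsManifold.maximalAtlas (𝓡 n) ∞ M) (hv : v ∈ slitDom φ)
    (F : Fin n → ℝ) (c : Fin n) :
    ∑ d, F d * comp φ v (omegaBar D v (hvec φ v (fun a c => barthelCoeff L φ a c v) c)) d = 0 := by
  simp only [h.comp_omegaBar, dtcoord_hvec hφ hv.2]
  simp [PiLp.single_apply]

theorem AdaptedAt.sum_mul_comp_omegaBar_vvec {L : TangentBundle (𝓡 n) M → ℝ}
    (h : AdaptedAt g D L φ v) (hφ : φ ∈ IsManifold.maximalAtlas (𝓡 n) ∞ M) (hv : v ∈ slitDom φ)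
    (F : Fin n → ℝ) (c : Fin n) :
    ∑ d, F d * comp φ v (omegaBar D v (vvec φ v c)) d = F c := by
  simp only [h.comp_omegaBar, dtcoord_vvec hφ hv.2]
  simp [PiLp.single_apply]

theorem sum_mul_dtcoord_hvec (hφ : φ ∈ IsManifold.maximalAtlas (𝓡 n) ∞ M) (hv : v ∈ slitDom φ)
    (N : Fin n → Fin n → ℝ) (F : Fin n → ℝ) (c : Fin n) :
    ∑ d, F d * (dtcoord φ v (hvec φ v N c)).1 d = F c := by
  rw [dtcoord_hvec hφ hv.2]
  simp [PiLp.single_apply]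

theorem sum_mul_dtcoord_vvec (hφ : φ ∈ IsManifold.maximalAtlas (𝓡 n) ∞ M) (hv : v ∈ slitDom φ)
    (F : Fin n → ℝ) (c : Fin n) :
    ∑ d, F d * (dtcoord φ v (vvec φ v c)).1 d = 0 := by
  rw [dtcoord_vvec hφ hv.2]
  simp

/-- The class of a compatible connection contains a connection with the lowered coefficients
`Γ_{abc}` and `∂g_{ab}/∂y^c / 2`. -/
theorem Compatible.exists_cartan [T2Space M] (h : Compatible g D) :
    ∃ D', Compatible g D' ∧ ∀ φ ∈ IsManifold.maximalAtlas (𝓡 n) ∞ M, ∀ v ∈ slitDom φ, ∀ a b c,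
      connLow D' g φ v a b (hvec φ v (fun a c => barthelCoeff (energy g) φ a c v) c) =
        gammaLow (energy g) φ v a b c ∧
      connLow D' g φ v a b (vvec φ v c) = (1 / 2 : ℝ) * pdy φ c (hess (energy g) φ a b) v := by
  obtain ⟨D', hs, hD'⟩ := h.exists_connLow_eq_theta
  refine ⟨D', h.of_symmetryRelated hs, fun φ hφ v hv a b c => ?_⟩
  have ha := h.adaptedAt_energy hφ hv
  rw [hD' φ hφ v hv, hD' φ hφ v hv, ha.theta_hvec hφ hv, ha.theta_vvec hφ hv]
  exact ⟨rfl, rfl⟩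

/-- Obtained from Cartan's connection of the class by subtracting its Cartan torsion along ω̄. -/
theorem Compatible.exists_chern [T2Space M] (h : Compatible g D) :
    ∃ D', Compatible g D' ∧ ∀ φ ∈ IsManifold.maximalAtlas (𝓡 n) ∞ M, ∀ v ∈ slitDom φ, ∀ a b c,
      connLow D' g φ v a b (hvec φ v (fun a c => barthelCoeff (energy g) φ a c v) c) =
        gammaLow (energy g) φ v a b c ∧
      connLow D' g φ v a b (vvec φ v c) = 0 := by
  obtain ⟨D₁, h₁, hD₁⟩ := h.exists_cartan
  obtain ⟨D', hs, hD'⟩ := h₁.exists_connLow_sub_cartan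
  refine ⟨D', h₁.of_symmetryRelated hs, fun φ hφ v hv a b c => ?_⟩
  have ha := h₁.adaptedAt_energy hφ hv
  rw [hD' φ hφ v hv, hD' φ hφ v hv, (hD₁ φ hφ v hv a b c).1, (hD₁ φ hφ v hv a b c).2,
    ha.sum_mul_comp_omegaBar_hvec hφ hv, ha.sum_mul_comp_omegaBar_vvec hφ hv]
  exact ⟨add_zero _, by ring⟩

/-- Passage from the horizontal coefficients `Γ_{abc}` to the coefficients `G_{abc}`. -/
theorem Compatible.exists_berwald_of_gamma [T2Space M] (h : Compatible g D)
    {V : OpenPartialHomeomorph M (Coord n) → TangentBundle (𝓡 n) M → Fin n → Fin n → Fin n → ℝ}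
    (hD : ∀ φ ∈ IsManifold.maximalAtlas (𝓡 n) ∞ M, ∀ v ∈ slitDom φ, ∀ a b c,
      connLow D g φ v a b (hvec φ v (fun a c => barthelCoeff (energy g) φ a c v) c) =
        gammaLow (energy g) φ v a b c ∧ connLow D g φ v a b (vvec φ v c) = V φ v a b c)
    (hV : ∀ φ ∈ IsManifold.maximalAtlas (𝓡 n) ∞ M, ∀ v ∈ slitDom φ, ∀ a b c,
      V φ v a b c = V φ v a c b) :
    ∃ D', Compatible g D' ∧ ∀ φ ∈ IsManifold.maximalAtlas (𝓡 n) ∞ M, ∀ v ∈ slitDom φ, ∀ a b c,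
      connLow D' g φ v a b (hvec φ v (fun a c => barthelCoeff (energy g) φ a c v) c) =
        lower g φ v (berwaldUp (energy g) φ v) a b c ∧
      connLow D' g φ v a b (vvec φ v c) = V φ v a b c := by
  obtain ⟨hL, hg⟩ := isFinslerLagrangian_energy h.2.1 h.2.2.1
  obtain ⟨D', hs, hD'⟩ := h.exists_connLow_sub_landsberg
    (fun φ hφ v hv a b c => (hD φ hφ v hv a b c).1) fun φ hφ v hv a b c => by
      rw [(hD φ hφ v hv a b c).2, (hD φ hφ v hv a c b).2, hV φ hφ v hv]
  refine ⟨D', h.of_symmetryRelated hs, fun φ hφ v hv a b c => ?_⟩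
  rw [hD' φ hφ v hv, hD' φ hφ v hv, (hD φ hφ v hv a b c).1, (hD φ hφ v hv a b c).2,
    sum_mul_dtcoord_hvec hφ hv, sum_mul_dtcoord_vvec hφ hv,
    (hL.lagrangianOn hg hφ).lower_berwaldUp
      (fun _ hv => gcomp_eq_hess hφ (hL.smoothOver hφ) hg hv) hv]
  exact ⟨rfl, add_zero _⟩

theorem Compatible.lower_gammaUp (h : Compatible g D)
    (hφ : φ ∈ IsManifold.maximalAtlas (𝓡 n) ∞ M) (hv : v ∈ slitDom φ) (a b c : Fin n) :
    lower g φ v (gammaUp (energy g) φ v) a b c = gammaLow (energy g) φ v a b c := by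
  obtain ⟨hL, hg⟩ := isFinslerLagrangian_energy h.2.1 h.2.2.1
  exact (hL.lagrangianOn hg hφ).lower_gammaUp
    (fun _ hv => gcomp_eq_hess hφ (hL.smoothOver hφ) hg hv) hv a b c

theorem Compatible.lower_cartanUp (h : Compatible g D)
    (hφ : φ ∈ IsManifold.maximalAtlas (𝓡 n) ∞ M) (hv : v ∈ slitDom φ) (a b c : Fin n) :
    lower g φ v (cartanUp (energy g) φ v) a b c =
      (1 / 2 : ℝ) * pdy φ c (hess (energy g) φ a b) v := by
  obtain ⟨hL, hg⟩ := isFinslerLagrangian_energy h.2.1 h.2.2.1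
  have hs := hL.smoothOver hφ
  rw [(hL.lagrangianOn hg hφ).lower_cartanUp (fun _ hv => gcomp_eq_hess hφ hs hg hv) hv,
    pdy_hess_comm hφ hs hv a b c]
  exact congrArg _ (pd_hess_comm hφ hs hv b c _)

theorem lower_zero (a b c : Fin n) : lower g φ v (fun _ _ _ => 0) a b c = 0 := by
  simp [lower]

theorem Compatible.exists_isCartan [T2Space M] (h : Compatible g D) :
    ∃ D', IsCartan (energy g) D' ∧ Equivalent g D D' := by
  obtain ⟨D', h', hD'⟩ := h.exists_cartan
  refine ⟨D', h'.hasCoefficients (fun φ hφ v hv a b c => ?_) fun φ hφ v hv a b c => ?_,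
    h.compatible_iff_equivalent.1 h'⟩
  · rw [(hD' φ hφ v hv a b c).1, h'.lower_gammaUp hφ hv]
  · rw [(hD' φ hφ v hv a b c).2, h'.lower_cartanUp hφ hv]

theorem Compatible.exists_isChern [T2Space M] (h : Compatible g D) :
    ∃ D', IsChern (energy g) D' ∧ Equivalent g D D' := by
  obtain ⟨D', h', hD'⟩ := h.exists_chern
  refine ⟨D', h'.hasCoefficients (fun φ hφ v hv a b c => ?_) fun φ hφ v hv a b c => ?_,
    h.compatible_iff_equivalent.1 h'⟩
  · rw [(hD' φ hφ v hv a b c).1, h'.lower_gammaUp hφ hv]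
  · rw [(hD' φ hφ v hv a b c).2, lower_zero]

/-- Starts from Chern's connection, whose vanishing V trivially has the symmetry that the passage
from Γ to G requires. -/
theorem Compatible.exists_isBerwald [T2Space M] (h : Compatible g D) :
    ∃ D', IsBerwald (energy g) D' ∧ Equivalent g D D' := by
  obtain ⟨D₁, h₁, hD₁⟩ := h.exists_chern
  obtain ⟨D', h', hD'⟩ := h₁.exists_berwald_of_gamma (V := fun _ _ _ _ _ => 0) hD₁
    fun _ _ _ _ _ _ _ => rfl
  refine ⟨D', h'.hasCoefficients (fun φ hφ v hv a b c => (hD' φ hφ v hv a b c).1)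
    fun φ hφ v hv a b c => ?_, h.compatible_iff_equivalent.1 h'⟩
  rw [(hD' φ hφ v hv a b c).2, lower_zero]

/-- Starts from Cartan's connection; the symmetry of V in its last two indices is the total symmetry
of the third vertical derivatives of the energy. -/
theorem Compatible.exists_isHashiguchi [T2Space M] (h : Compatible g D) :
    ∃ D', IsHashiguchi (energy g) D' ∧ Equivalent g D D' := by
  obtain ⟨hL, hg⟩ := isFinslerLagrangian_energy h.2.1 h.2.2.1
  obtain ⟨D₁, h₁, hD₁⟩ := h.exists_cartan
  obtain ⟨D', h', hD'⟩ := h₁.exists_berwald_of_gamma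
    (V := fun φ v a b c => (1 / 2 : ℝ) * pdy φ c (hess (energy g) φ a b) v) hD₁
    fun φ hφ v hv a b c => by
      have hs := hL.smoothOver hφ
      refine congrArg _ ((pd_hess_comm hφ hs hv a b _).trans ?_)
      refine (pdy_hess_comm hφ hs hv b a c).trans ?_
      exact pd_hess_comm hφ hs hv c a _
  refine ⟨D', h'.hasCoefficients (fun φ hφ v hv a b c => (hD' φ hφ v hv a b c).1)
    fun φ hφ v hv a b c => ?_, h.compatible_iff_equivalent.1 h'⟩
  rw [(hD' φ hφ v hv a b c).2, h'.lower_cartanUp hφ hv]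

end Existence

end Finsler

end

theorem mainTheorem1 {n : ℕ} {M : Type*} [TopologicalSpace M] [T2Space M]
    [ChartedSpace (Finsler.Coord n) M] [IsManifold (𝓡 n) ∞ M] (g : Finsler.FinslerMetric n M) :
    -- (α), (β), (γ) imply that `g` is the vertical Hessian of the Finsler Lagrangian `g_y(y,y)/2`
    (∀ D : Finsler.FinslerConnection n M,
      Finsler.Regular D → Finsler.CondBeta g D → Finsler.CondGamma g D →
        Finsler.IsFinslerLagrangian (Finsler.energy g) ∧
        Finsler.IsVerticalHessian (Finsler.energy g) g) ∧
    -- consequences of (α)-(ε)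
    (∀ D : Finsler.FinslerConnection n M, Finsler.Compatible g D →
      Finsler.HasCanonicalForm (Finsler.energy g) g D ∧
      Finsler.StronglyRegular D ∧
      Finsler.IsBarthel (Finsler.energy g) (Finsler.inducedHorizontal D)) ∧
    -- invariance of each condition under the symmetry
    (∀ D D' : Finsler.FinslerConnection n M, Finsler.SymmetryRelated g D D' →
      (Finsler.Regular D ↔ Finsler.Regular D') ∧
      (Finsler.CondBeta g D ↔ Finsler.CondBeta g D') ∧
      (Finsler.CondGamma g D ↔ Finsler.CondGamma g D') ∧
      (Finsler.CondDelta g D ↔ Finsler.CondDelta g D') ∧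
      (Finsler.CondEpsilon g D ↔ Finsler.CondEpsilon g D')) ∧
    -- the coefficients `Λ` and `V` are not constrained further; the notable connections of a
    -- Finsler Lagrangian with vertical Hessian `g` satisfy (α)-(ε)
    (∀ L : TangentBundle (𝓡 n) M → ℝ, Finsler.IsFinslerLagrangian L →
      Finsler.IsVerticalHessian L g → ∀ D : Finsler.FinslerConnection n M,
        (Finsler.Regular D → Finsler.HasCanonicalForm L g D → Finsler.Compatible g D) ∧
        (Finsler.IsBerwald L D → Finsler.Compatible g D) ∧
        (Finsler.IsChern L D → Finsler.Compatible g D) ∧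
        (Finsler.IsCartan L D → Finsler.Compatible g D) ∧
        (Finsler.IsHashiguchi L D → Finsler.Compatible g D)) ∧
    -- the connections that satisfy (α)-(ε) form one class, which contains the notable connections
    (∀ D : Finsler.FinslerConnection n M, Finsler.Compatible g D →
      (∀ D' : Finsler.FinslerConnection n M,
        Finsler.Compatible g D' ↔ Finsler.Equivalent g D D') ∧
      (∃ D', Finsler.IsBerwald (Finsler.energy g) D' ∧ Finsler.Equivalent g D D') ∧
      (∃ D', Finsler.IsChern (Finsler.energy g) D' ∧ Finsler.Equivalent g D D') ∧
      (∃ D', Finsler.IsCartan (Finsler.energy g) D' ∧ Finsler.Equivalent g D D') ∧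
      (∃ D', Finsler.IsHashiguchi (Finsler.energy g) D' ∧ Finsler.Equivalent g D D')) := by
  refine ⟨fun D _ hβ hγ => Finsler.isFinslerLagrangian_energy hβ hγ, fun D h => h.consequences,
    fun D D' h => Finsler.conditions_iff_of_symmetryRelated h, fun L hL hg D => ?_, fun D h => ?_⟩
  · exact ⟨fun hD h => Finsler.compatible_of_hasCanonicalForm hL hg hD h,
      fun h => Finsler.compatible_of_hasCoefficients hL hg h (.inl rfl) (.inr rfl),
      fun h => Finsler.compatible_of_hasCoefficients hL hg h (.inr rfl) (.inr rfl),
      fun h => Finsler.compatible_of_hasCoefficients hL hg h (.inr rfl) (.inl rfl),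
      fun h => Finsler.compatible_of_hasCoefficients hL hg h (.inl rfl) (.inl rfl)⟩
  · exact ⟨fun D' => h.compatible_iff_equivalent, h.exists_isBerwald, h.exists_isChern,
      h.exists_isCartan, h.exists_isHashiguchi⟩
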